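/- Let $r\ge 1$, $s\ge 0$, $n_1,\dots,n_s\ge 1$ be integers, $M=\sum_j n_j$, $\lambda_1,\dots,\lambda_s\in\mathbb C$ (not assumed distinct), and let $$A(x)=\sum_{j\le r}A_j\,x^{j-1},\qquad A_j\in \mathrm{Mat}_{M}(\mathbb C),$$ be a formal connection at $x=\infty$ whose leading coefficient is in Jordan form $A_r=\mathrm{diag}(J_1,\dots,J_s)$, where $J_j$ is the upper triangular Jordan cell of size $n_j$ with eigenvalue $\lambda_j$. Let $L$ be the $s\times s$ Lidskii matrix: $L_{ij}$ is the lower-left entry of the $(i,j)$ block of $A_{r-1}$ in the corresponding block partition. For an eigenvalue $\lambda$ and a size $m$ occurring among the pairs $(\lambda_j,n_j)$ let $P_{\lambda,m}(\mu)$ be the determinant of the principal submatrix of $L$ on the indices $\{j:\lambda_j=\lambda,\ n_j\ge m\}$ minus $\mu$ times the projector onto the indices with $n_j=m$. The roots of the $P_{\lambda,m}$ are the Lidskii pseudovalues. Assume that they are generic: no pseudovalue is $0$ and every $P_{\lambda,m}$ has nonzero discriminant. If $r=1$, assume in addition that, for each $\lambda$ having a cell of size $1$, no two roots of $P_{\lambda,1}$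 differ by a nonzero integer. For $n\ge 1$ let $\mathcal H_{(n)}(x)$ be the $n\times n$ matrix with ones below the diagonal, $x$ in the upper right corner and zeros elsewhere ($\mathcal H_{(1)}=x$). Put $\mathcal H_j=\mathcal H_{(n_j)}$ and $G_j=\mathrm{diag}(0,1,\dots,n_j-1)$. Call $(Y,t)$ a normalizing pair if $Y(x)=Y_0+\sum_{k\ge1}x^{-k}Y_k$ is a formal series with $\det Y_0\ne0$, $t=(t_{J,j})_{1\le j\le s,\ 0\le J\le rn_j}$ are complex numbers with $t_{rn_j,j}=n_j\lambda_j$, and $$Y^{-1}AY-Y^{-1}Y'=\mathrm{diag}(D_1,\dots,D_s),\qquad D_j=\frac1{n_jx}\sum_{J=0}^{rn_j}t_{J,j}\,\mathcal H_j(x)^J-\frac{G_j}{n_jx}.$$ Then: 1. A normalizing pair exists. 2. For every normalizing pair $(Y,t)$, $$\Psi_{form}=Y(x)\cdot\mathrm{diag}_{j}\Big(\exp\Big(\sum_{J=1}^{rn_j}\frac{t_{J,j}}J\mathcal H_j^J\Big)\,x^{(t_{0,j}-G_j)/n_j}\Big)$$ is a fundamental (i.e. invertible) formal solution of $\Psi'=A\Psi$.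 Here formal solutions have entries in the differential ring $\mathbb C((x^{-1}))\otimes_{\mathbb C[x,x^{-1}]}\mathcal O$, where $\mathcal O$ is the ring of holomorphic functions on the universal covering of $\mathbb C\setminus\{0\}$. 3. $Y$ is uniquely determined by $t$ up to the normalization of each block: if $(Y,t)$ and $(\tilde Y,t)$ are normalizing pairs, then $\tilde Y=Y\,\mathrm{diag}(c_1\mathbf 1_{n_1},\dots,c_s\mathbf 1_{n_s})$ with nonzero constants $c_j$. 4. $(Y,t)$ is unique up to this normalization, the numbering of the blocks and the determination of the roots $x^{1/n_j}$: if $(Y,t)$ and $(\tilde Y,\tilde t)$ are normalizing pairs, there are a permutation $\sigma$ of $\{1,\dots,s\}$ with $n_{\sigma(j)}=n_j$, $\lambda_{\sigma(j)}=\lambda_j$, roots of unity $\zeta_j$ with $\zeta_j^{n_j}=1$, and nonzero constants $c_j$, such that $t_{J,\sigma(j)}=\zeta_j^J\,\tilde t_{J,j}$ for $0\le J\le rn_j$ and $\tilde Y=YP$, where $P$ is the constant matrix whose $(\sigma(j),j)$ block is $c_j\,\mathrm{diag}(1,\zeta_j,\dots,\zeta_j^{n_j-1})$ and whose other blocks are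 zero. -/

import Mathlib

open scoped TensorProduct

noncomputable section

namespace ResonantConnection

/-! ### Formal Laurent series at `x = ∞` -/

/-- The field of formal series `∑_{k ≤ N} a_k x ^ k` at `x = ∞`, i.e. formal Laurent series in the
local parameter `z = x⁻¹`. -/
abbrev FormalSeries : Type := LaurentSeries ℂ

instance : Field FormalSeries := inferInstance

instance : CommRing FormalSeries := Field.toCommRing

instance : CommSemiring FormalSeries := CommRing.toCommSemiring

instance : Ring FormalSeries := CommRing.toRing

instance : Semiring FormalSeries := Ring.toSemiring

namespace FormalSeries

/-- The formal variable `x = z⁻¹`. -/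
def x : FormalSeries := HahnSeries.single (-1 : ℤ) (1 : ℂ)

/-- The coefficient of `x ^ k`. -/
def xcoeff (f : FormalSeries) (k : ℤ) : ℂ := f.coeff (-k)

/-- The derivation `d/dx = - z ^ 2 d/dz`. -/
def ddx (f : FormalSeries) : FormalSeries :=
  -(HahnSeries.single (2 : ℤ) (1 : ℂ) * LaurentSeries.derivative ℂ f)

theorem xcoeff_ext {f g : FormalSeries} (h : ∀ k, xcoeff f k = xcoeff g k) : f = g := by
  refine HahnSeries.ext (funext fun k => ?_)
  simpa [xcoeff] using h (-k)

theorem xcoeff_ddx (f : FormalSeries) (k : ℤ) :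
    xcoeff (ddx f) k = (k + 1) * xcoeff f (k + 1) := by
  unfold xcoeff ddx
  have h : (-k : ℤ) = (-k - 2) + 2 := by ring
  rw [HahnSeries.coeff_neg, h, HahnSeries.coeff_single_mul_add, LaurentSeries.derivative_apply,
    LaurentSeries.hasseDeriv_coeff]
  have h2 : (-k - 2 + ((1 : ℕ) : ℤ) : ℤ) = -(k + 1) := by push_cast; ring
  rw [h2, Ring.choose_one_right, zsmul_eq_mul]
  push_cast
  ring

theorem ddx_add (f g : FormalSeries) : ddx (f + g) = ddx f + ddx g := by
  unfold ddx
  rw [map_add]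
  ring

/-- The Euler operator `z d/dz`, used only to check the Leibniz rule. -/
def euler (f : FormalSeries) : FormalSeries where
  coeff n := n * f.coeff n
  isPWO_support' := f.isPWO_support.mono fun n hn h0 => hn (by
    change (n : ℂ) * f.coeff n = 0
    rw [h0, mul_zero])

theorem support_euler (f : FormalSeries) : (euler f).support ⊆ f.support := fun n hn h0 =>
  hn (by change (n : ℂ) * f.coeff n = 0; rw [h0, mul_zero])

theorem euler_mul (f g : FormalSeries) : euler (f * g) = euler f * g + f * euler g := by
  ext n
  rw [HahnSeries.coeff_add, HahnSeries.coeff_mul_left' f.isPWO_support (support_euler f),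
    HahnSeries.coeff_mul_right' g.isPWO_support (support_euler g), ← Finset.sum_add_distrib]
  change (n : ℂ) * (f * g).coeff n = _
  rw [HahnSeries.coeff_mul, Finset.mul_sum]
  refine Finset.sum_congr rfl fun ij hij => ?_
  have h : ij.1 + ij.2 = n := by
    simp only [Finset.mem_antidiagonal] at hij
    exact hij.2.2
  change (n : ℂ) * _ = ((ij.1 : ℂ) * f.coeff ij.1) * _ + _ * ((ij.2 : ℂ) * g.coeff ij.2)
  rw [← h]
  push_cast
  ring

theorem ddx_eq_euler (f : FormalSeries) :
    ddx f = -(HahnSeries.single (1 : ℤ) (1 : ℂ) * euler f) := by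
  refine xcoeff_ext fun k => ?_
  rw [xcoeff_ddx]
  unfold xcoeff
  have h : (-k : ℤ) = (-k - 1) + 1 := by ring
  rw [HahnSeries.coeff_neg, h, HahnSeries.coeff_single_mul_add]
  change _ = -(1 * (((-k - 1 : ℤ) : ℂ) * HahnSeries.coeff f (-k - 1)))
  have h2 : (-(k + 1) : ℤ) = -k - 1 := by ring
  rw [h2]
  push_cast
  ring

theorem ddx_mul (f g : FormalSeries) : ddx (f * g) = ddx f * g + f * ddx g := by
  rw [ddx_eq_euler, ddx_eq_euler, ddx_eq_euler, euler_mul]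
  ring

theorem ddx_C (c : ℂ) : ddx (HahnSeries.C c) = 0 := by
  refine xcoeff_ext fun k => ?_
  rw [xcoeff_ddx]
  unfold xcoeff
  by_cases h : k + 1 = 0
  · have : (k : ℂ) + 1 = 0 := by exact_mod_cast h
    simp [this]
  · simp only [HahnSeries.C_apply, HahnSeries.coeff_zero]
    rw [HahnSeries.coeff_single_of_ne (neg_ne_zero.mpr h), mul_zero]

theorem ddx_x : ddx x = 1 := by
  refine xcoeff_ext fun k => ?_
  rw [xcoeff_ddx]
  change _ * HahnSeries.coeff (HahnSeries.single (-1 : ℤ) (1 : ℂ)) (-(k + 1)) =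
    HahnSeries.coeff (HahnSeries.single (0 : ℤ) (1 : ℂ)) (-k)
  by_cases h : k = 0
  · subst h; simp
  · rw [HahnSeries.coeff_single_of_ne (by omega), HahnSeries.coeff_single_of_ne (by omega),
      mul_zero]

/-- `x` as a unit. -/
def xUnit : FormalSeriesˣ := Units.mk0 x (by simp [x])

end FormalSeries

/-! ### Holomorphic functions on the universal covering of `ℂ ∖ {0}` -/

/-- The algebra of entire functions. -/
def entireFunctions : Subalgebra ℂ (ℂ → ℂ) where
  carrier := {f | Differentiable ℂ f}
  mul_mem' := fun hf hg => Differentiable.mul hf hg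
  add_mem' := fun hf hg => Differentiable.add hf hg
  algebraMap_mem' := fun c => differentiable_const c

/-- Holomorphic functions on the universal covering of `ℂ ∖ {0}`, uniformized by
`w ↦ x = exp w`; thus `w` is `log x` and `exp (a * w)` is `x ^ a`. -/
abbrev HolFun : Type := entireFunctions

namespace HolFun

/-- The coordinate `x = exp w`, as a unit. -/
def xUnit : HolFunˣ where
  val := ⟨fun w => Complex.exp w, Complex.differentiable_exp⟩
  inv := ⟨fun w => Complex.exp (-w), Complex.differentiable_exp.comp differentiable_neg⟩
  val_inv := Subtype.ext (funext fun w => by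
    change Complex.exp w * Complex.exp (-w) = 1
    rw [← Complex.exp_add, add_neg_cancel, Complex.exp_zero])
  inv_val := Subtype.ext (funext fun w => by
    change Complex.exp (-w) * Complex.exp w = 1
    rw [← Complex.exp_add, neg_add_cancel, Complex.exp_zero])

/-- The derivation `d/dx = exp (-w) d/dw`. -/
def ddx (f : HolFun) : HolFun :=
  ⟨fun w => Complex.exp (-w) * deriv f.1 w,
    (Complex.differentiable_exp.comp differentiable_neg).mul (Differentiable.deriv f.2)⟩

theorem ddx_add (f g : HolFun) : ddx (f + g) = ddx f + ddx g := by
  refine Subtype.ext (funext fun w => ?_)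
  change Complex.exp (-w) * deriv (f.1 + g.1) w =
    Complex.exp (-w) * deriv f.1 w + Complex.exp (-w) * deriv g.1 w
  rw [deriv_add (f.2 w) (g.2 w)]
  ring

theorem ddx_mul (f g : HolFun) : ddx (f * g) = ddx f * g + f * ddx g := by
  refine Subtype.ext (funext fun w => ?_)
  change Complex.exp (-w) * deriv (f.1 * g.1) w =
    Complex.exp (-w) * deriv f.1 w * g.1 w + f.1 w * (Complex.exp (-w) * deriv g.1 w)
  rw [deriv_mul (f.2 w) (g.2 w)]
  ring

theorem ddx_algebraMap (c : ℂ) : ddx (algebraMap ℂ HolFun c) = 0 := by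
  refine Subtype.ext (funext fun w => ?_)
  change Complex.exp (-w) * deriv (fun _ : ℂ => c) w = 0
  simp

theorem ddx_x : ddx xUnit = 1 := by
  refine Subtype.ext (funext fun w => ?_)
  change Complex.exp (-w) * deriv (fun w => Complex.exp w) w = 1
  rw [(Complex.hasDerivAt_exp w).deriv, ← Complex.exp_add]
  simp

end HolFun

/-! ### Formal solutions: formal series times holomorphic functions -/

/-- Laurent polynomials in `x` as formal series. -/
instance : Algebra (LaurentPolynomial ℂ) FormalSeries :=
  (LaurentPolynomial.eval₂ HahnSeries.C FormalSeries.xUnit).toAlgebra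

/-- Laurent polynomials in `x` as holomorphic functions. -/
instance : Algebra (LaurentPolynomial ℂ) HolFun :=
  (LaurentPolynomial.eval₂ (algebraMap ℂ HolFun) HolFun.xUnit).toAlgebra

/-- The ring in which formal solutions live: finite sums of products of a formal series in `x⁻¹`
(with finitely many positive powers) and a holomorphic function of `log x`, Laurent polynomials in
`x` being identified in the two factors. -/
abbrev FormalSolutionRing : Type := FormalSeries ⊗[LaurentPolynomial ℂ] HolFun

/-- Every Laurent polynomial has the same derivative as a formal series and as a function. -/
theorem exists_derivative (p : LaurentPolynomial ℂ) : ∃ p' : LaurentPolynomial ℂ,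
    FormalSeries.ddx (algebraMap _ FormalSeries p) = algebraMap _ FormalSeries p' ∧
    HolFun.ddx (algebraMap _ HolFun p) = algebraMap _ HolFun p' := by
  have hK : ∀ q : LaurentPolynomial ℂ, algebraMap _ FormalSeries q =
    LaurentPolynomial.eval₂ HahnSeries.C FormalSeries.xUnit q := fun _ => rfl
  have hO : ∀ q : LaurentPolynomial ℂ, algebraMap _ HolFun q =
    LaurentPolynomial.eval₂ (algebraMap ℂ HolFun) HolFun.xUnit q := fun _ => rfl
  have key : ∀ {S : Type} [CommRing S] (d : S → S)
      (_ : ∀ f g, d (f * g) = d f * g + f * d g) (u : Sˣ), d u = 1 →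
      d (u⁻¹ : Sˣ) = -((u⁻¹ : Sˣ) * (u⁻¹ : Sˣ)) := by
    intro S _ d hd u hu
    have h1 : d 1 = 0 := by
      have := hd 1 1
      simp only [mul_one, one_mul] at this
      exact left_eq_add.mp this
    have h2 := hd u (u⁻¹ : Sˣ)
    rw [Units.mul_inv, h1, hu, one_mul] at h2
    calc d (u⁻¹ : Sˣ) = (u⁻¹ : Sˣ) * (u * d (u⁻¹ : Sˣ)) := by rw [Units.inv_mul_cancel_left]
      _ = _ := by rw [eq_neg_of_add_eq_zero_right h2.symm, mul_neg]
  induction p using LaurentPolynomial.induction_on with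
  | h_C a =>
    refine ⟨0, ?_, ?_⟩
    · rw [hK, LaurentPolynomial.eval₂_C, FormalSeries.ddx_C, map_zero]
    · rw [hO, LaurentPolynomial.eval₂_C, HolFun.ddx_algebraMap, map_zero]
  | h_add hp hq =>
    obtain ⟨p', h1, h2⟩ := hp
    obtain ⟨q', h3, h4⟩ := hq
    exact ⟨p' + q', by rw [map_add, map_add, FormalSeries.ddx_add, h1, h3],
      by rw [map_add, map_add, HolFun.ddx_add, h2, h4]⟩
  | h_C_mul_T n a ih =>
    obtain ⟨p', h1, h2⟩ := ih
    refine ⟨p' * LaurentPolynomial.T 1 + LaurentPolynomial.C a * LaurentPolynomial.T n, ?_, ?_⟩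
    · rw [LaurentPolynomial.T_add, ← mul_assoc, map_mul, FormalSeries.ddx_mul, h1, map_add,
        map_mul _ p', hK (LaurentPolynomial.T 1), LaurentPolynomial.eval₂_T, zpow_one,
        show FormalSeries.ddx (FormalSeries.xUnit : FormalSeries) = 1 from FormalSeries.ddx_x,
        mul_one]
    · rw [LaurentPolynomial.T_add, ← mul_assoc, map_mul, HolFun.ddx_mul, h2, map_add,
        map_mul _ p', hO (LaurentPolynomial.T 1), LaurentPolynomial.eval₂_T, zpow_one,
        HolFun.ddx_x, mul_one]
  | h_C_mul_T_Z n a ih =>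
    obtain ⟨p', h1, h2⟩ := ih
    refine ⟨p' * LaurentPolynomial.T (-1) - LaurentPolynomial.C a * LaurentPolynomial.T (-n)
      * (LaurentPolynomial.T (-1) * LaurentPolynomial.T (-1)), ?_, ?_⟩
    · rw [sub_eq_add_neg (-(n : ℤ)) 1, LaurentPolynomial.T_add, ← mul_assoc, map_mul,
        FormalSeries.ddx_mul, h1, map_sub, map_mul _ p', map_mul _ (_ * _) (_ * _),
        map_mul _ (LaurentPolynomial.T (-1)) (LaurentPolynomial.T (-1)),
        hK (LaurentPolynomial.T (-1)), LaurentPolynomial.eval₂_T, zpow_neg_one,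
        key FormalSeries.ddx FormalSeries.ddx_mul FormalSeries.xUnit FormalSeries.ddx_x]
      ring
    · rw [sub_eq_add_neg (-(n : ℤ)) 1, LaurentPolynomial.T_add, ← mul_assoc, map_mul,
        HolFun.ddx_mul, h2, map_sub, map_mul _ p', map_mul _ (_ * _) (_ * _),
        map_mul _ (LaurentPolynomial.T (-1)) (LaurentPolynomial.T (-1)),
        hO (LaurentPolynomial.T (-1)), LaurentPolynomial.eval₂_T, zpow_neg_one,
        key HolFun.ddx HolFun.ddx_mul HolFun.xUnit HolFun.ddx_x]
      ring

namespace FormalSolutionRing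

/-- The derivation `d/dx` of the ring of formal solutions, given by
`(f ⊗ φ)' = f' ⊗ φ + f ⊗ φ'`. -/
def ddx : FormalSolutionRing →+ FormalSolutionRing :=
  TensorProduct.liftAddHom
    (AddMonoidHom.mk' (fun f => AddMonoidHom.mk'
        (fun φ => FormalSeries.ddx f ⊗ₜ[LaurentPolynomial ℂ] φ
          + f ⊗ₜ[LaurentPolynomial ℂ] HolFun.ddx φ)
        (fun φ ψ => by
          rw [HolFun.ddx_add, TensorProduct.tmul_add, TensorProduct.tmul_add]; abel))
      (fun f g => by
        ext φ
        simp only [AddMonoidHom.mk'_apply, AddMonoidHom.add_apply]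
        rw [FormalSeries.ddx_add, TensorProduct.add_tmul, TensorProduct.add_tmul]; abel))
    (fun p f φ => by
      obtain ⟨p', h1, h2⟩ := exists_derivative p
      simp only [AddMonoidHom.mk'_apply]
      have e1 : FormalSeries.ddx (p • f) = p' • f + p • FormalSeries.ddx f := by
        rw [Algebra.smul_def, Algebra.smul_def, Algebra.smul_def, FormalSeries.ddx_mul, h1]
      have e2 : HolFun.ddx (p • φ) = p' • φ + p • HolFun.ddx φ := by
        rw [Algebra.smul_def, Algebra.smul_def, Algebra.smul_def, HolFun.ddx_mul, h2]
      rw [e1, e2, TensorProduct.add_tmul, TensorProduct.tmul_add,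
        TensorProduct.smul_tmul, TensorProduct.smul_tmul, TensorProduct.smul_tmul]
      abel)

theorem ddx_tmul (f : FormalSeries) (φ : HolFun) :
    ddx (f ⊗ₜ[LaurentPolynomial ℂ] φ) =
      FormalSeries.ddx f ⊗ₜ[LaurentPolynomial ℂ] φ
        + f ⊗ₜ[LaurentPolynomial ℂ] HolFun.ddx φ := rfl

/-- The Leibniz rule. -/
theorem ddx_mul (u v : FormalSolutionRing) : ddx (u * v) = ddx u * v + u * ddx v := by
  induction u using TensorProduct.induction_on with
  | zero => simp
  | add u₁ u₂ h₁ h₂ => rw [add_mul, map_add, h₁, h₂, map_add]; ring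
  | tmul f φ =>
    induction v using TensorProduct.induction_on with
    | zero => simp
    | add v₁ v₂ h₁ h₂ => rw [mul_add, map_add, h₁, h₂, map_add]; ring
    | tmul g ψ =>
      rw [Algebra.TensorProduct.tmul_mul_tmul, ddx_tmul, ddx_tmul, ddx_tmul,
        FormalSeries.ddx_mul, HolFun.ddx_mul]
      simp only [add_mul, mul_add, TensorProduct.add_tmul, TensorProduct.tmul_add,
        Algebra.TensorProduct.tmul_mul_tmul]
      abel

/-- A formal series as an element of the ring of formal solutions. -/
def ofSeries (f : FormalSeries) : FormalSolutionRing := f ⊗ₜ[LaurentPolynomial ℂ] 1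

/-- A holomorphic function as an element of the ring of formal solutions. -/
def ofHol (φ : HolFun) : FormalSolutionRing := 1 ⊗ₜ[LaurentPolynomial ℂ] φ

end FormalSolutionRing

/-! ### Jordan cells, Lidskii matrices and genericity -/

/-- The index set of matrices partitioned into blocks of sizes `n 0, …, n (s - 1)`. -/
abbrev BlockIndex {s : ℕ} (n : Fin s → ℕ) : Type := Σ j : Fin s, Fin (n j)

/-- The upper triangular Jordan cell of size `m` with eigenvalue `c`. -/
def jordanCell (c : ℂ) (m : ℕ) : Matrix (Fin m) (Fin m) ℂ :=
  Matrix.of fun a b => if a = b then c else if (b : ℕ) = a + 1 then 1 else 0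

/-- The Lidskii matrix of `B`: the lower-left entries of the blocks of `B`. -/
def lidskiiMatrix {s : ℕ} {n : Fin s → ℕ} (hn : ∀ j, 1 ≤ n j)
    (B : Matrix (BlockIndex n) (BlockIndex n) ℂ) : Matrix (Fin s) (Fin s) ℂ :=
  Matrix.of fun i j => B ⟨i, ⟨n i - 1, Nat.sub_lt (hn i) one_pos⟩⟩ ⟨j, ⟨0, hn j⟩⟩

open Classical in
/-- The Lidskii pseudo-characteristic polynomial attached to the cells with eigenvalue `c` and
size `m`: the determinant of the submatrix of the Lidskii matrix on the cells with eigenvalue `c`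
and size at least `m`, minus the variable times the projector onto the cells of size exactly
`m`. -/
def pseudoCharpoly {s : ℕ} {n : Fin s → ℕ} (hn : ∀ j, 1 ≤ n j) (lam : Fin s → ℂ)
    (B : Matrix (BlockIndex n) (BlockIndex n) ℂ) (c : ℂ) (m : ℕ) : Polynomial ℂ :=
  Matrix.det (Matrix.of fun i j : {j : Fin s // lam j = c ∧ m ≤ n j} =>
    Polynomial.C (lidskiiMatrix hn B i j) -
      if i = j ∧ n i = m then Polynomial.X else 0)

/-- The Lidskii pseudovalues (roots of the pseudo-characteristic polynomials) of `B` are generic: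
none of them is zero and every pseudo-characteristic polynomial has nonzero discriminant. -/
def LidskiiGeneric {s : ℕ} {n : Fin s → ℕ} (hn : ∀ j, 1 ≤ n j) (lam : Fin s → ℂ)
    (B : Matrix (BlockIndex n) (BlockIndex n) ℂ) : Prop :=
  ∀ j, ¬ (pseudoCharpoly hn lam B (lam j) (n j)).IsRoot 0 ∧
    (pseudoCharpoly hn lam B (lam j) (n j)).discr ≠ 0

/-! ### The normal form -/

/-- The `m × m` matrix `H(x)` with ones below the diagonal and `x` in the upper right corner
(`H(x) = (x)` for `m = 1`). -/
def shiftMatrix {R : Type*} [CommRing R] (m : ℕ) (x : R) : Matrix (Fin m) (Fin m) R :=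
  Matrix.of fun a b =>
    if (a : ℕ) = b + 1 then 1 else if (a : ℕ) = 0 ∧ (b : ℕ) + 1 = m then x else 0

/-- The matrix of coefficients of `x ^ k`. -/
def coeffMatrix {ι : Type*} (A : Matrix ι ι FormalSeries) (k : ℤ) : Matrix ι ι ℂ :=
  A.map fun f => FormalSeries.xcoeff f k

/-- The block `(m x)⁻¹ ∑_{J = 0}^{r m} t_J H(x) ^ J - (m x)⁻¹ G`, `G = diag (0, 1, …, m - 1)`. -/
def normalBlock (r m : ℕ) (t : ℕ → ℂ) : Matrix (Fin m) (Fin m) FormalSeries :=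
  ((m : FormalSeries) * FormalSeries.x)⁻¹ •
    (∑ J ∈ Finset.range (r * m + 1),
        (HahnSeries.C (t J) : FormalSeries) • shiftMatrix m FormalSeries.x ^ J
      - Matrix.diagonal fun a : Fin m => ((a : ℕ) : FormalSeries))

/-- The block diagonal connection `D = diag (D_1, …, D_s)`. -/
def normalForm {s : ℕ} (r : ℕ) (n : Fin s → ℕ) (t : Fin s → ℕ → ℂ) :
    Matrix (BlockIndex n) (BlockIndex n) FormalSeries :=
  Matrix.blockDiagonal' fun j => normalBlock r (n j) (t j)

/-- `Y = Y_0 + ∑_{j ≥ 1} x ^ (-j) Y_j` with `det Y_0 ≠ 0`. -/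
def IsFormalGauge {ι : Type*} [Fintype ι] [DecidableEq ι] (Y : Matrix ι ι FormalSeries) : Prop :=
  (∀ k : ℤ, 0 < k → coeffMatrix Y k = 0) ∧ (coeffMatrix Y 0).det ≠ 0

/-- `Y` is a formal gauge that transforms `A` into the normal form with parameters
`t j J`, `0 ≤ J ≤ r n_j`, where `t j (r n_j) = n_j λ_j`. -/
def IsNormalizingGauge {s : ℕ} (r : ℕ) (n : Fin s → ℕ) (lam : Fin s → ℂ)
    (A Y : Matrix (BlockIndex n) (BlockIndex n) FormalSeries) (t : Fin s → ℕ → ℂ) : Prop :=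
  IsFormalGauge Y ∧ (∀ j, t j (r * n j) = n j * lam j) ∧
    Y⁻¹ * A * Y - Y⁻¹ * Y.map FormalSeries.ddx = normalForm r n t

/-! ### The bare solution -/

/-- The value at `w = log x` of `exp (∑_{J = 1}^{r m} (t_J / J) H(x) ^ J) x ^ ((t_0 - G) / m)`. -/
def bareBlock (r m : ℕ) (t : ℕ → ℂ) (w : ℂ) : Matrix (Fin m) (Fin m) ℂ :=
  NormedSpace.exp (∑ J ∈ Finset.Icc 1 (r * m), (t J / J) • shiftMatrix m (Complex.exp w) ^ J) *
    Matrix.diagonal fun a : Fin m => Complex.exp ((t 0 - (a : ℕ)) / m * w)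

section

attribute [local instance] Matrix.linftyOpNormedRing Matrix.linftyOpNormedAlgebra

theorem differentiable_bareBlock (r m : ℕ) (t : ℕ → ℂ) : Differentiable ℂ (bareBlock r m t) := by
  have hH : Differentiable ℂ fun w : ℂ => shiftMatrix m (Complex.exp w) := by
    have : (fun w : ℂ => shiftMatrix m (Complex.exp w)) = fun w =>
        shiftMatrix m (0 : ℂ) + Complex.exp w • (shiftMatrix m (1 : ℂ) - shiftMatrix m 0) := by
      funext w
      ext a b
      simp only [shiftMatrix, Matrix.of_apply, Matrix.add_apply, Matrix.smul_apply,
        Matrix.sub_apply, smul_eq_mul]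
      split_ifs <;> simp
    rw [this]
    exact (differentiable_const _).add (Complex.differentiable_exp.smul_const _)
  have hS : Differentiable ℂ fun w : ℂ =>
      ∑ J ∈ Finset.Icc 1 (r * m), (t J / J) • shiftMatrix m (Complex.exp w) ^ J :=
    Differentiable.fun_sum fun J _ => (hH.fun_pow J).fun_const_smul _
  have hE : Differentiable ℂ (NormedSpace.exp : Matrix (Fin m) (Fin m) ℂ → _) := fun M =>
    (NormedSpace.exp_analytic (𝕂 := ℂ) M).differentiableAt
  have hD : Differentiable ℂ fun w : ℂ =>
      (Matrix.diagonal fun a : Fin m => Complex.exp ((t 0 - (a : ℕ)) / m * w) :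
        Matrix (Fin m) (Fin m) ℂ) := by
    have : (fun w : ℂ => (Matrix.diagonal fun a : Fin m =>
        Complex.exp ((t 0 - (a : ℕ)) / m * w) : Matrix (Fin m) (Fin m) ℂ)) = fun w =>
        ∑ a : Fin m, Complex.exp ((t 0 - (a : ℕ)) / m * w) • Matrix.single a a (1 : ℂ) := by
      funext w
      rw [← Matrix.sum_single_eq_diagonal]
      simp [Matrix.smul_single]
    rw [this]
    exact Differentiable.fun_sum fun a _ =>
      ((differentiable_id.const_mul _).cexp).smul_const _
  exact (hE.comp hS).mul hD

theorem differentiable_bareBlock_apply (r m : ℕ) (t : ℕ → ℂ) (a b : Fin m) :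
    Differentiable ℂ fun w => bareBlock r m t w a b :=
  (LinearMap.toContinuousLinearMap (Matrix.entryLinearMap ℂ ℂ a b)).differentiable.comp
    (differentiable_bareBlock r m t)

end

/-- The matrix `Ψ^bare`, with entries holomorphic in `w = log x`. -/
def bareSolution {s : ℕ} (r : ℕ) (n : Fin s → ℕ) (t : Fin s → ℕ → ℂ) :
    Matrix (BlockIndex n) (BlockIndex n) HolFun :=
  Matrix.blockDiagonal' fun j => Matrix.of fun a b =>
    (⟨fun w => bareBlock r (n j) (t j) w a b, differentiable_bareBlock_apply r (n j) (t j) a b⟩ :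
      HolFun)

/-- The product `Y · Ψ^bare`. -/
def formalSolution {s : ℕ} (r : ℕ) (n : Fin s → ℕ)
    (Y : Matrix (BlockIndex n) (BlockIndex n) FormalSeries) (t : Fin s → ℕ → ℂ) :
    Matrix (BlockIndex n) (BlockIndex n) FormalSolutionRing :=
  Y.map FormalSolutionRing.ofSeries * (bareSolution r n t).map FormalSolutionRing.ofHol

/-- `Ψ` is a fundamental formal solution of `Ψ' = A Ψ`. -/
def IsFundamentalSolution {ι : Type*} [Fintype ι] [DecidableEq ι]
    (A : Matrix ι ι FormalSeries) (Ψ : Matrix ι ι FormalSolutionRing) : Prop :=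
  Ψ.map FormalSolutionRing.ddx = A.map FormalSolutionRing.ofSeries * Ψ ∧ IsUnit Ψ.det

/-- The constant matrix that sends the `j`-th block to the `σ j`-th block, of the same size, by
`c_j diag (1, ζ_j, …, ζ_j ^ (n_j - 1))`. -/
def monomialMatrix {s : ℕ} (n : Fin s → ℕ) (σ : Equiv.Perm (Fin s)) (ζ c : Fin s → ℂ) :
    Matrix (BlockIndex n) (BlockIndex n) FormalSeries :=
  Matrix.of fun p q => if p.1 = σ q.1 ∧ (p.2 : ℕ) = q.2 then
    HahnSeries.C (c q.1 * ζ q.1 ^ (q.2 : ℕ)) else 0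

end ResonantConnection

end

/-!
Existence. Every pseudovalue of the Lidskii matrix has a pseudo-eigenvector, supported on the cells
with the same eigenvalue and at least the same size. It is the leading term of a formal eigenvector
`A v - v' = q v` in powers of `z = x ^ (-1 / n j)`: genericity makes the linear equations of each
order solvable, and a scalar factor removes the powers of `x` below `x⁻¹` from `q`. The parts of `v`
with exponents in the classes modulo `n j` are the columns of `Y` in the `j`-th block.

Uniqueness. The quotient of two normalizing gauges intertwines the two normal forms. In the basis
`e_0, …, e_{n j - 1}` of each block, extended to all indices by `e_{α + n j} = x e_α`, the matrix
`H(x)` is the shift and the intertwining relations become convolution equations. Their solutions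
vanish between inequivalent blocks and are geometric along one diagonal otherwise; the ratio is
the root of unity `ζ j`.

Fundamental solutions. Conjugation with `x ^ (-G / n j)` turns `H(x)` into a scalar multiple of a
constant matrix, so that all the exponents commute and the exponential can be differentiated.
-/

noncomputable section

namespace ResonantConnection

/-! ### Pencils of matrices -/

section Pencil

open Matrix Polynomial

variable {K : Type*} [Field K]

theorem nodup_roots_of_discr_ne_zero [CharZero K] {f : K[X]} (h : f.discr ≠ 0) :
    f.roots.Nodup := by
  rcases eq_or_ne f.natDegree 0 with h0 | h0
  · rw [eq_C_of_natDegree_eq_zero h0, roots_C]; exact Multiset.nodup_zero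
  have hd : 0 < f.degree := natDegree_pos_iff_degree_pos.mp (Nat.pos_of_ne_zero h0)
  have hf : f ≠ 0 := by rintro rfl; exact h0 natDegree_zero
  have hres : resultant f f.derivative f.natDegree (f.natDegree - 1) ≠ 0 := by
    rw [resultant_deriv hd]
    exact mul_ne_zero (mul_ne_zero (pow_ne_zero _ (neg_ne_zero.mpr one_ne_zero))
      (leadingCoeff_ne_zero.mpr hf)) h
  rw [← natDegree_derivative f] at hres
  refine nodup_roots ?_
  by_contra hcop
  exact hres (resultant_eq_zero_iff.mpr ⟨Or.inl hf, hcop⟩)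

variable {κ κ₁ κ₂ : Type*} [Fintype κ] [Fintype κ₁] [Fintype κ₂] [DecidableEq κ₁]

theorem exists_eigenbasis [IsAlgClosed K] [DecidableEq κ] (S : Matrix κ κ K)
    (h : S.charpoly.roots.Nodup) :
    ∃ (μ : κ → K) (e : Module.Basis κ K (κ → K)), Function.Injective μ ∧
      (∀ j, S.charpoly.IsRoot (μ j)) ∧ ∀ j, S *ᵥ e j = μ j • e j := by
  classical
  have hcard : S.charpoly.roots.toFinset.card = Fintype.card κ := by
    rw [Multiset.toFinset_card_of_nodup h, ← S.charpoly_natDegree_eq_dim]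
    exact (IsAlgClosed.splits S.charpoly).natDegree_eq_card_roots.symm
  let μ : κ ≃ S.charpoly.roots.toFinset :=
    Fintype.equivOfCardEq (by rw [Fintype.card_coe, hcard])
  have hroot : ∀ j, S.charpoly.IsRoot (μ j : K) := fun j =>
    isRoot_of_mem_roots (Multiset.mem_toFinset.mp (μ j).2)
  have hev : ∀ j, Module.End.HasEigenvalue (toLin' S) (μ j : K) := fun j => by
    rw [Module.End.hasEigenvalue_iff_isRoot_charpoly, charpoly_toLin']
    exact hroot j
  choose v hv using fun j => (hev j).exists_hasEigenvector
  have hinj : Function.Injective fun j => (μ j : K) := Subtype.val_injective.comp μ.injective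
  have hli := Module.End.eigenvectors_linearIndependent' (toLin' S) _ hinj v hv
  refine ⟨fun j => μ j, Module.Basis.mk hli
    (hli.span_eq_top_of_card_eq_finrank' (by simp)).ge, hinj, hroot, fun j => ?_⟩
  rw [Module.Basis.mk_apply, ← toLin'_apply]
  exact (hv j).apply_eq_smul

theorem eq_smul_of_mulVec_eq {S : Matrix κ κ K} {μ : κ → K} (hμ : Function.Injective μ)
    {e : Module.Basis κ K (κ → K)} (he : ∀ j, S *ᵥ e j = μ j • e j) {j : κ} {v : κ → K} {a : K}
    (h : S *ᵥ v = μ j • v + a • e j) : a = 0 ∧ v = e.repr v j • e j := by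
  classical
  have hcoord : ∀ k, μ k * e.repr v k = μ j * e.repr v k + a * e.repr (e j) k := by
    have hS : ∀ k, e.repr (S *ᵥ v) k = μ k * e.repr v k := fun k => by
      conv_lhs => rw [← e.sum_repr v, mulVec_sum]
      simp [mulVec_smul, he, Finsupp.single_apply, mul_comm]
    intro k
    rw [← hS, h]
    simp [Finsupp.single_apply]
  have ha : a = 0 := by simpa using hcoord j
  refine ⟨ha, ?_⟩
  conv_lhs => rw [← e.sum_repr v]
  refine Finset.sum_eq_single j (fun k _ hk => ?_) (by simp)
  have hk0 : (μ k - μ j) * e.repr v k = 0 := by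
    rw [sub_mul, hcoord k, ha]
    ring
  rw [(mul_eq_zero.mp hk0).resolve_left (sub_ne_zero.mpr (hμ.ne hk)), zero_smul]

theorem eq_zero_of_sum_mul_basis {p : κ → Prop}
    (e : Module.Basis {i // p i} K ({i // p i} → K)) {U : κ → κ → K}
    (hU : ∀ k i : {i // p i}, U k i = e k i) {a : κ → K} (ha : ∀ k, a k ≠ 0 → p k)
    (h : ∀ i, p i → ∑ k, a k * U k i = 0) : a = 0 := by
  classical
  have hsum : ∑ k : {i // p i}, a k • e k = 0 := by
    funext i
    rw [Pi.zero_apply, ← h i i.2, Finset.sum_apply]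
    refine Fintype.sum_of_injective _ Subtype.val_injective _ _ (fun k hk => ?_) fun k => ?_
    · by_contra h0
      exact hk ⟨⟨k, ha k (left_ne_zero_of_mul h0)⟩, rfl⟩
    · rw [hU]; rfl
  have h0 := Fintype.linearIndependent_iff.mp e.linearIndependent _ hsum
  funext k
  by_contra hk
  exact hk (h0 ⟨k, ha k hk⟩)

/-- The Schur complement of the upper left block. -/
def schurComplement (L : Matrix (κ₁ ⊕ κ₂) (κ₁ ⊕ κ₂) K) : Matrix κ₂ κ₂ K :=
  L.toBlocks₂₂ - L.toBlocks₂₁ * L.toBlocks₁₁⁻¹ * L.toBlocks₁₂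

/-- The extension of a vector `v` to a solution `u` of the first block of rows of `L u = 0`. -/
def schurLift (L : Matrix (κ₁ ⊕ κ₂) (κ₁ ⊕ κ₂) K) (v : κ₂ → K) : κ₁ ⊕ κ₂ → K :=
  Sum.elim (-(L.toBlocks₁₁⁻¹ *ᵥ L.toBlocks₁₂ *ᵥ v)) v

variable {L : Matrix (κ₁ ⊕ κ₂) (κ₁ ⊕ κ₂) K}

theorem schurLift_smul (b : K) (v : κ₂ → K) : schurLift L (b • v) = b • schurLift L v := by
  ext (i | i) <;> simp [schurLift, mulVec_smul]

theorem mulVec_schurLift (hT : L.toBlocks₁₁.det ≠ 0) (v : κ₂ → K) :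
    L *ᵥ schurLift L v = Sum.elim (0 : κ₁ → K) (schurComplement L *ᵥ v) := by
  rw [← congrArg (· *ᵥ schurLift L v) (fromBlocks_toBlocks L), fromBlocks_mulVec, schurLift]
  congr 1
  · simp only [Sum.elim_comp_inl, Sum.elim_comp_inr, mulVec_neg]
    rw [mulVec_mulVec, mul_nonsing_inv _ hT.isUnit, one_mulVec, neg_add_cancel]
  · simp only [Sum.elim_comp_inl, Sum.elim_comp_inr, schurComplement, sub_mulVec, mulVec_neg,
      ← mulVec_mulVec]
    abel

theorem eq_schurLift (hT : L.toBlocks₁₁.det ≠ 0) {u : κ₁ ⊕ κ₂ → K} {w : κ₂ → K}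
    (hu : L *ᵥ u = Sum.elim (0 : κ₁ → K) w) : u = schurLift L (u ∘ Sum.inr) := by
  rw [← fromBlocks_toBlocks L, fromBlocks_mulVec] at hu
  have h₁ : L.toBlocks₁₁ *ᵥ (u ∘ Sum.inl) = -(L.toBlocks₁₂ *ᵥ (u ∘ Sum.inr)) :=
    eq_neg_of_add_eq_zero_left (funext fun i => congrFun hu (Sum.inl i))
  have h₂ : u ∘ Sum.inl = -(L.toBlocks₁₁⁻¹ *ᵥ L.toBlocks₁₂ *ᵥ (u ∘ Sum.inr)) := by
    rw [← mulVec_neg, ← h₁, mulVec_mulVec, nonsing_inv_mul _ hT.isUnit, one_mulVec]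
  ext (i | i)
  · exact congrFun h₂ i
  · rfl

theorem eq_smul_schurLift_of_mulVec_eq (hT : L.toBlocks₁₁.det ≠ 0) {μ : κ₂ → K}
    (hμ : Function.Injective μ) {e : Module.Basis κ₂ K (κ₂ → K)}
    (he : ∀ j, schurComplement L *ᵥ e j = μ j • e j) {j : κ₂} {u : κ₁ ⊕ κ₂ → K} {a : K}
    (h : L *ᵥ u = Sum.elim (0 : κ₁ → K) (μ j • (u ∘ Sum.inr) + a • e j)) :
    a = 0 ∧ ∃ b : K, u = b • schurLift L (e j) := by
  have hu := eq_schurLift hT h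
  rw [hu, mulVec_schurLift hT] at h
  obtain ⟨ha, hb⟩ := eq_smul_of_mulVec_eq hμ he (funext fun i => congrFun h (Sum.inr i))
  exact ⟨ha, _, by rw [← schurLift_smul, ← hb]; exact hu⟩

theorem det_pencil [DecidableEq κ₂] (hT : L.toBlocks₁₁.det ≠ 0) :
    (L.map C - diagonal (Sum.elim (0 : κ₁ → K[X]) fun _ => X)).det =
      C (L.toBlocks₁₁.det * (-1) ^ Fintype.card κ₂) * (schurComplement L).charpoly := by
  have hu : IsUnit L.toBlocks₁₁.det := hT.isUnit
  let _ : Invertible (L.toBlocks₁₁.map (C : K → K[X])) :=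
    ⟨(L.toBlocks₁₁⁻¹).map C,
      by rw [← Matrix.map_mul, nonsing_inv_mul _ hu, Matrix.map_one _ C_0 C_1],
      by rw [← Matrix.map_mul, mul_nonsing_inv _ hu, Matrix.map_one _ C_0 C_1]⟩
  have hinv : ⅟(L.toBlocks₁₁.map (C : K → K[X])) = (L.toBlocks₁₁⁻¹).map C := rfl
  have hblocks : L.map C - diagonal (Sum.elim (0 : κ₁ → K[X]) fun _ => X) =
      fromBlocks (L.toBlocks₁₁.map C) (L.toBlocks₁₂.map C) (L.toBlocks₂₁.map C)
        (L.toBlocks₂₂.map C - scalar κ₂ X) := by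
    ext (i | i) (j | j) : 1 <;>
      simp [diagonal_apply, toBlocks₁₁, toBlocks₁₂, toBlocks₂₁, toBlocks₂₂]
  have hschur : L.toBlocks₂₂.map C - scalar κ₂ X -
      (L.toBlocks₂₁ * L.toBlocks₁₁⁻¹ * L.toBlocks₁₂).map C =
        -charmatrix (schurComplement L) := by
    ext i j : 1
    simp only [schurComplement, Matrix.sub_apply, map_apply, Matrix.neg_apply, charmatrix_apply,
      scalar_apply, C_sub]
    ring
  have hdet : (L.toBlocks₁₁.map (C : K → K[X])).det = C L.toBlocks₁₁.det :=
    (RingHom.map_det C _).symm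
  rw [hblocks, det_fromBlocks₁₁, hinv, ← Matrix.map_mul, ← Matrix.map_mul, hschur, det_neg, hdet,
    charpoly]
  simp only [C_mul, C_pow, C_neg, C_1]
  ring

end Pencil

/-! ### Pseudo-eigenvectors of the Lidskii matrix -/

section Lidskii

open Matrix Polynomial

variable {s : ℕ} (n : Fin s → ℕ) (lam : Fin s → ℂ)

/-- The `i`-th cell lies above the `j`-th one if it has the same eigenvalue and at least the same
size; the pseudo-eigenvector of the `j`-th cell is supported on the cells above it. -/
abbrev Above (j i : Fin s) : Prop := lam i = lam j ∧ n j ≤ n i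

/-- Pseudovalues `ν j` and pseudo-eigenvectors `U j` of the Lidskii matrix of `B`, one for each
cell. In `eigen` and `simple` the pencil has the projector onto the cells of size `n j`. -/
structure LidskiiBasis {n} (hn : ∀ j, 1 ≤ n j) (lam : Fin s → ℂ)
    (B : Matrix (BlockIndex n) (BlockIndex n) ℂ) (ν : Fin s → ℂ) (U : Fin s → Fin s → ℂ) :
    Prop where
  isRoot : ∀ j, (pseudoCharpoly hn lam B (lam j) (n j)).IsRoot (ν j)
  injective : ∀ j j', lam j' = lam j → n j' = n j → ν j = ν j' → j = j'
  support : ∀ j i, U j i ≠ 0 → Above n lam j i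
  eigen : ∀ j i, Above n lam j i →
    (lidskiiMatrix hn B *ᵥ U j) i = if n i = n j then ν j * U j i else 0
  simple : ∀ j (u : Fin s → ℂ) (a : ℂ), (∀ i, u i ≠ 0 → Above n lam j i) →
    (∀ i, Above n lam j i → (lidskiiMatrix hn B *ᵥ u) i =
      if n i = n j then ν j * u i + a * U j i else 0) → a = 0 ∧ ∃ b : ℂ, u = b • U j
  indep : ∀ j (a : Fin s → ℂ), (∀ k, a k ≠ 0 → lam k = lam j ∧ n k = n j) →
    (∀ i, lam i = lam j → n i = n j → ∑ k, a k * U k i = 0) → a = 0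

/-- The cells with eigenvalue `c` and size greater than `m`, followed by those of size `m`. -/
abbrev CellSum (c : ℂ) (m : ℕ) : Type :=
  {i : Fin s // lam i = c ∧ m < n i} ⊕ {i : Fin s // lam i = c ∧ n i = m}

variable {n lam}

namespace CellSum

variable {c : ℂ} {m : ℕ}

/-- The position of a cell in the list of all cells. -/
def index : CellSum n lam c m → Fin s := Sum.elim (↑) (↑)

theorem index_mem (a : CellSum n lam c m) : lam a.index = c ∧ m ≤ n a.index := by
  rcases a with ⟨i, hc, hm⟩ | ⟨i, hc, hm⟩
  exacts [⟨hc, hm.le⟩, ⟨hc, hm.ge⟩]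

theorem index_injective : Function.Injective (index : CellSum n lam c m → Fin s) := by
  rintro (⟨i, -, hi⟩ | ⟨i, -, hi⟩) (⟨j, -, hj⟩ | ⟨j, -, hj⟩) (rfl : i = j)
  exacts [rfl, absurd hj hi.ne', absurd hi hj.ne', rfl]

theorem exists_index_eq {i : Fin s} (hc : lam i = c) (hm : m ≤ n i) :
    ∃ a : CellSum n lam c m, a.index = i := by
  rcases hm.lt_or_eq with h | h
  exacts [⟨.inl ⟨i, hc, h⟩, rfl⟩, ⟨.inr ⟨i, hc, h.symm⟩, rfl⟩]

/-- The cells of a `CellSum`, without the distinction of the size. -/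
def equiv : CellSum n lam c m ≃ {i : Fin s // lam i = c ∧ m ≤ n i} :=
  Equiv.ofBijective (fun a => ⟨a.index, a.index_mem⟩)
    ⟨fun _ _ h => index_injective (congrArg Subtype.val h),
      fun ⟨_, hc, hm⟩ => (exists_index_eq hc hm).imp fun _ h => Subtype.ext h⟩

end CellSum

open CellSum

variable (hn : ∀ j, 1 ≤ n j) (lam : Fin s → ℂ) (B : Matrix (BlockIndex n) (BlockIndex n) ℂ)

/-- The submatrix of the Lidskii matrix on the cells with eigenvalue `c` and size at least `m`. -/
def lidskiiBlock (c : ℂ) (m : ℕ) :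
    Matrix (CellSum n lam c m) (CellSum n lam c m) ℂ :=
  (lidskiiMatrix hn B).submatrix index index

open Classical in
theorem pseudoCharpoly_eq_det_pencil (c : ℂ) (m : ℕ) :
    pseudoCharpoly hn lam B c m = ((lidskiiBlock hn lam B c m).map C -
      diagonal (Sum.elim (0 : {i // lam i = c ∧ m < n i} → ℂ[X]) fun _ => X)).det := by
  rw [pseudoCharpoly, ← det_submatrix_equiv_self CellSum.equiv]
  congr 1
  ext a b : 1
  have hval : ∀ a : CellSum n lam c m, ((CellSum.equiv a : {i // _}) : Fin s) = a.index :=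
    fun _ => rfl
  simp only [lidskiiBlock, of_apply, submatrix_apply, Matrix.sub_apply, map_apply, diagonal_apply,
    hval, CellSum.equiv.injective.eq_iff]
  by_cases hab : a = b
  · subst hab
    rcases a with ⟨i, hc, hm⟩ | ⟨i, hc, hm⟩
    · simp [index, hm.ne']
    · simp [index, hm]
  · simp [hab]

open Classical in
theorem eval_pseudoCharpoly (c : ℂ) (m : ℕ) (μ : ℂ) :
    (pseudoCharpoly hn lam B c m).eval μ = (lidskiiBlock hn lam B c m -
      diagonal (Sum.elim (0 : {i // lam i = c ∧ m < n i} → ℂ) fun _ => μ)).det := by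
  rw [pseudoCharpoly_eq_det_pencil, ← coe_evalRingHom, RingHom.map_det]
  congr 1
  ext a b
  rcases eq_or_ne a b with rfl | hab
  · rcases a with a | a <;> simp
  · simp [diagonal_apply_ne _ hab]

variable {hn lam B}

open Classical in
theorem det_toBlocks₁₁_lidskiiBlock_ne_zero (hgen : LidskiiGeneric hn lam B) (c : ℂ) (m : ℕ) :
    (lidskiiBlock hn lam B c m).toBlocks₁₁.det ≠ 0 := by
  by_cases hne : ∃ i : Fin s, lam i = c ∧ m < n i
  · -- The larger cells are those of at least the smallest larger size.
    obtain ⟨j, hj, hmin⟩ := Finset.exists_min_image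
      (Finset.univ.filter fun i : Fin s => lam i = c ∧ m < n i) n
      (hne.imp fun i hi => Finset.mem_filter.mpr ⟨Finset.mem_univ i, hi⟩)
    obtain ⟨rfl, hmj⟩ := (Finset.mem_filter.mp hj).2
    let e : {i : Fin s // lam i = lam j ∧ m < n i} ≃ CellSum n lam (lam j) (n j) :=
      (Equiv.subtypeEquivRight fun i =>
        ⟨fun h => ⟨h.1, hmin i (Finset.mem_filter.mpr ⟨Finset.mem_univ i, h⟩)⟩,
          fun h => ⟨h.1, hmj.trans_le h.2⟩⟩).trans CellSum.equiv.symm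
    have he : ∀ i, (e i).index = i := fun i =>
      congrArg Subtype.val (CellSum.equiv.apply_symm_apply _)
    have h0 : (lidskiiBlock hn lam B (lam j) (n j)).det ≠ 0 := by
      have h := (hgen j).1
      have hzero : (Sum.elim 0 fun _ => 0 : CellSum n lam (lam j) (n j) → ℂ) = fun _ => 0 :=
        Sum.elim_zero_zero
      rwa [IsRoot, eval_pseudoCharpoly, hzero, diagonal_zero, sub_zero] at h
    rw [← det_submatrix_equiv_self e] at h0
    convert! h0 using 2
    ext a b
    simp only [lidskiiBlock, submatrix_apply, he]
    rfl
  · have : IsEmpty {i : Fin s // lam i = c ∧ m < n i} := ⟨fun i => hne ⟨i, i.2⟩⟩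
    rw [det_isEmpty]
    exact one_ne_zero

section Transfer

variable {j : Fin s} {u : Fin s → ℂ}

open Classical in
theorem lidskiiBlock_mulVec_eq_iff (hu : ∀ i, u i ≠ 0 → Above n lam j i) (w : Fin s → ℂ) :
    lidskiiBlock hn lam B (lam j) (n j) *ᵥ (u ∘ index) =
        Sum.elim (0 : {i // lam i = lam j ∧ n j < n i} → ℂ)
          (fun a : {i // lam i = lam j ∧ n i = n j} => w a) ↔
      ∀ i, Above n lam j i → (lidskiiMatrix hn B *ᵥ u) i = if n i = n j then w i else 0 := by
  have hrestrict : ∀ a : CellSum n lam (lam j) (n j),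
      (lidskiiBlock hn lam B (lam j) (n j) *ᵥ (u ∘ index)) a =
        (lidskiiMatrix hn B *ᵥ u) a.index := by
    intro a
    simp only [mulVec, dotProduct]
    refine Fintype.sum_of_injective index index_injective _ _ (fun i hi => ?_) fun _ => rfl
    refine mul_eq_zero_of_right _ ?_
    by_contra h
    exact hi (exists_index_eq (hu i h).1 (hu i h).2)
  constructor
  · rintro h i ⟨hc, hm⟩
    obtain ⟨a, rfl⟩ := exists_index_eq hc hm
    rw [← hrestrict, h]
    rcases a with ⟨i, -, hi⟩ | ⟨i, -, hi⟩
    · exact (if_neg hi.ne').symm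
    · exact (if_pos hi).symm
  · intro h
    ext a
    rw [hrestrict, h _ a.index_mem]
    rcases a with ⟨i, -, hi⟩ | ⟨i, -, hi⟩
    · exact if_neg hi.ne'
    · exact if_pos hi

theorem extend_comp_index (hu : ∀ i, u i ≠ 0 → Above n lam j i) :
    Function.extend (index : CellSum n lam (lam j) (n j) → Fin s) (u ∘ index) 0 = u := by
  funext i
  by_cases hi : ∃ a : CellSum n lam (lam j) (n j), a.index = i
  · obtain ⟨a, rfl⟩ := hi
    exact index_injective.extend_apply _ _ a
  · rw [Function.extend_apply' _ _ _ hi]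
    by_contra h
    exact hi (exists_index_eq (hu i (Ne.symm h)).1 (hu i (Ne.symm h)).2)

theorem above_of_extend_index_ne_zero {v : CellSum n lam (lam j) (n j) → ℂ} {i : Fin s}
    (h : Function.extend index v 0 i ≠ 0) : Above n lam j i := by
  by_contra hi
  refine h (Function.extend_apply' _ _ _ ?_)
  rintro ⟨a, rfl⟩
  exact hi a.index_mem

theorem eq_zero_of_not_isRoot {μ : ℂ}
    (hμ : ¬ (pseudoCharpoly hn lam B (lam j) (n j)).IsRoot μ)
    (hu : ∀ i, u i ≠ 0 → Above n lam j i)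
    (h : ∀ i, Above n lam j i →
      (lidskiiMatrix hn B *ᵥ u) i = if n i = n j then μ * u i else 0) : u = 0 := by
  classical
  rw [IsRoot, eval_pseudoCharpoly] at hμ
  have h0 : u ∘ index = (0 : CellSum n lam (lam j) (n j) → ℂ) := by
    refine eq_zero_of_mulVec_eq_zero hμ ?_
    rw [sub_mulVec, (lidskiiBlock_mulVec_eq_iff hu fun i => μ * u i).mpr h, sub_eq_zero]
    ext (a | a) <;> simp [mulVec_diagonal, index]
  rw [← extend_comp_index hu, h0]
  exact Function.extend_const _ 0

end Transfer

open Classical in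
theorem nodup_roots_charpoly_schurComplement_lidskiiBlock (hgen : LidskiiGeneric hn lam B)
    (j : Fin s) : (schurComplement (lidskiiBlock hn lam B (lam j) (n j))).charpoly.roots.Nodup := by
  have hT := det_toBlocks₁₁_lidskiiBlock_ne_zero hgen (lam j) (n j)
  have h := nodup_roots_of_discr_ne_zero (hgen j).2
  rwa [pseudoCharpoly_eq_det_pencil, det_pencil hT,
    roots_C_mul _ (mul_ne_zero hT (pow_ne_zero _ (neg_ne_zero.mpr one_ne_zero)))] at h

theorem exists_lidskiiBasis (hgen : LidskiiGeneric hn lam B) :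
    ∃ ν U, LidskiiBasis hn lam B ν U := by
  classical
  have hT := det_toBlocks₁₁_lidskiiBlock_ne_zero hgen
  have hnod := nodup_roots_charpoly_schurComplement_lidskiiBlock hgen
  choose μ e hμ hroot heig using fun c m => exists_eigenbasis
    (schurComplement (lidskiiBlock hn lam B c m))
  let ν : Fin s → ℂ := fun j => μ _ _ (hnod j) ⟨j, rfl, rfl⟩
  let v : ∀ j, {i // lam i = lam j ∧ n i = n j} → ℂ := fun j => e _ _ (hnod j) ⟨j, rfl, rfl⟩
  let U : Fin s → Fin s → ℂ := fun j =>
    Function.extend index (schurLift (lidskiiBlock hn lam B _ _) (v j)) 0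
  have ν_eq : ∀ c m h k (hk : lam k = c ∧ n k = m), ν k = μ c m h ⟨k, hk⟩ := by
    rintro _ _ _ k ⟨rfl, rfl⟩; rfl
  have support : ∀ j i, U j i ≠ 0 → Above n lam j i := fun j i => above_of_extend_index_ne_zero
  have U_comp_index : ∀ j, U j ∘ index = schurLift (lidskiiBlock hn lam B _ _) (v j) := fun j =>
    Function.extend_comp index_injective _ _
  have U_coe : ∀ j, (fun i : {i // lam i = lam j ∧ n i = n j} => U j i) = v j := fun j =>
    funext fun i => congrFun (U_comp_index j) (Sum.inr i)
  have U_eq : ∀ c m h (k i : {i // lam i = c ∧ n i = m}), U k i = e c m h k i := by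
    rintro _ _ _ ⟨k, rfl, rfl⟩ i; exact congrFun (U_coe k) i
  refine ⟨ν, U, fun j => ?_, fun j j' hc hm h => ?_, support, fun j => ?_, fun j u a hu h => ?_,
    fun j a ha h => ?_⟩
  · rw [pseudoCharpoly_eq_det_pencil, det_pencil (hT _ _)]
    exact root_mul_left_of_isRoot _ (hroot _ _ (hnod j) _)
  · rw [ν_eq _ _ (hnod j) j ⟨rfl, rfl⟩, ν_eq _ _ (hnod j) j' ⟨hc, hm⟩] at h
    exact congrArg Subtype.val (hμ _ _ (hnod j) h)
  · refine (lidskiiBlock_mulVec_eq_iff (support j) (ν j • U j)).mp ?_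
    rw [U_comp_index, mulVec_schurLift (hT _ _), heig _ _ (hnod j)]
    exact congrArg _ (congrArg (ν j • ·) (U_coe j).symm)
  · have block := (lidskiiBlock_mulVec_eq_iff hu (ν j • u + a • U j)).mpr h
    obtain ⟨ha, b, hb⟩ := eq_smul_schurLift_of_mulVec_eq (hT _ _) (hμ _ _ (hnod j))
      (heig _ _ (hnod j)) (j := ⟨j, rfl, rfl⟩) (a := a)
      (block.trans (congrArg _ (congrArg (ν j • (u ∘ (↑)) + a • ·) (U_coe j))))
    refine ⟨ha, b, ?_⟩
    rw [← extend_comp_index hu, hb, show b • schurLift _ (v j) = (b • U j) ∘ index from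
      congrArg (b • ·) (U_comp_index j).symm]
    exact extend_comp_index fun i hi => support j i (right_ne_zero_of_mul hi)
  · exact eq_zero_of_sum_mul_basis _ (U_eq _ _ (hnod j)) ha fun i hi => h i hi.1 hi.2

theorem LidskiiBasis.ne_zero {ν : Fin s → ℂ} {U : Fin s → Fin s → ℂ}
    (h : LidskiiBasis hn lam B ν U) (hgen : LidskiiGeneric hn lam B) (j : Fin s) : ν j ≠ 0 :=
  fun h0 => (hgen j).1 (h0 ▸ h.isRoot j)

end Lidskii

/-! ### Formal eigenvectors with a derivation -/

section Perturbation

open PowerSeries Function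

theorem exists_seq_of_step {W : Type*} (a₀ : W) (Φ : ℕ → (ℕ → W) → Prop)
    (hlocal : ∀ k ω ω', (∀ i ≤ k, ω i = ω' i) → Φ k ω → Φ k ω')
    (hstep : ∀ k ω, 0 < k → ω 0 = a₀ → ∃ a, Φ k (update ω k a)) :
    ∃ ω, ω 0 = a₀ ∧ ∀ k, 0 < k → Φ k ω := by
  have : Nonempty W := ⟨a₀⟩
  choose! f hf using hstep
  let F : ∀ k, (∀ i < k, W) → ℕ → W := fun k ω i => if h : i < k then ω i h else a₀
  let ω : ℕ → W := Nat.lt_wfRel.wf.fix fun k ω => if 0 < k then f k (F k ω) else a₀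
  have hω : ∀ k, ω k = if 0 < k then f k (F k fun i _ => ω i) else a₀ := fun k =>
    Nat.lt_wfRel.wf.fix_eq _ k
  have h0 : ω 0 = a₀ := hω 0
  refine ⟨ω, h0, fun k hk => hlocal k _ ω (fun i hi => ?_) (hf k (F k fun i _ => ω i) hk ?_)⟩
  · rcases hi.lt_or_eq with h | rfl
    · rw [update_of_ne h.ne]
      exact dif_pos h
    · rw [update_self, hω, if_pos hk]
  · exact (dif_pos hk).trans h0

/-- The Euler operator `X d/dX`. -/
def theta (f : ℂ⟦X⟧) : ℂ⟦X⟧ := X * d⁄dX ℂ f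

theorem coeff_theta (f : ℂ⟦X⟧) (k : ℕ) : coeff k (theta f) = k * coeff k f := by
  rcases k with - | k
  · simp [theta]
  · rw [theta, coeff_succ_X_mul, coeff_derivative]
    push_cast
    ring

theorem constantCoeff_theta (f : ℂ⟦X⟧) : constantCoeff (theta f) = 0 := by
  rw [← coeff_zero_eq_constantCoeff_apply, coeff_theta, Nat.cast_zero, zero_mul]

theorem theta_mul (f g : ℂ⟦X⟧) : theta (f * g) = theta f * g + f * theta g := by
  simp only [theta, Derivation.leibniz, smul_eq_mul]
  ring

theorem theta_add (f g : ℂ⟦X⟧) : theta (f + g) = theta f + theta g := by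
  rw [theta, map_add, mul_add]
  rfl

theorem theta_C_mul_X_pow (c : ℂ) (k : ℕ) : theta (C c * X ^ k) = C (k * c) * X ^ k := by
  ext i
  simp only [coeff_theta, coeff_C_mul, coeff_X_pow]
  split_ifs with h <;> simp [h]

theorem theta_X_pow_mul (k : ℕ) (f : ℂ⟦X⟧) :
    theta (X ^ k * f) = X ^ k * (theta f + C (k : ℂ) * f) := by
  have h := theta_C_mul_X_pow 1 k
  rw [map_one, one_mul, mul_one] at h
  rw [theta_mul, h]
  ring

theorem coeff_mul_congr {f g f' g' : ℂ⟦X⟧} {k : ℕ} (hf : ∀ i ≤ k, coeff i f = coeff i f')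
    (hg : ∀ i ≤ k, coeff i g = coeff i g') : ∀ i ≤ k, coeff i (f * g) = coeff i (f' * g') := by
  intro i hi
  rw [coeff_mul, coeff_mul]
  refine Finset.sum_congr rfl fun a ha => ?_
  have := Finset.HasAntidiagonal.mem_antidiagonal.mp ha
  rw [hf _ (by lia), hg _ (by lia)]

theorem coeff_mul_C_mul_X_pow (f : ℂ⟦X⟧) (c : ℂ) (k : ℕ) :
    coeff k (f * (C c * X ^ k)) = constantCoeff f * c := by
  rw [← mul_assoc, coeff_mul_X_pow', if_pos le_rfl, Nat.sub_self, coeff_zero_eq_constantCoeff_apply,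
    map_mul, constantCoeff_C]

theorem mk_update (ω : ℕ → ℂ) (k : ℕ) (a : ℂ) :
    mk (update ω k a) = mk (update ω k 0) + C a * X ^ k := by
  ext i
  rcases eq_or_ne i k with rfl | hi
  · simp
  · simp [coeff_X_pow, hi]

variable {ι : Type*} [Fintype ι]

/-- The residual `B w + κ X ^ α (θ + d) w - X ^ β Q w` of a formal eigenvalue problem with a
derivation, with eigenvalue `Q` and eigenvector `w`. -/
def residual (B : Matrix ι ι ℂ⟦X⟧) (κ : ℂ) (d : ι → ℂ) (α β : ι → ℕ) (w : ι → ℂ⟦X⟧) (Q : ℂ⟦X⟧)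
    (p : ι) : ℂ⟦X⟧ :=
  ∑ q, B p q * w q + C κ * X ^ α p * (theta (w p) + C (d p) * w p) - X ^ β p * (Q * w p)

variable (B : Matrix ι ι ℂ⟦X⟧) (κ : ℂ) (d : ι → ℂ) (α β : ι → ℕ)

theorem coeff_residual_congr {w w' : ι → ℂ⟦X⟧} {Q Q' : ℂ⟦X⟧} {k : ℕ}
    (hw : ∀ p, ∀ i ≤ k, coeff i (w p) = coeff i (w' p)) (hQ : ∀ i ≤ k, coeff i Q = coeff i Q')
    (p : ι) : coeff k (residual B κ d α β w Q p) = coeff k (residual B κ d α β w' Q' p) := by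
  simp only [residual, map_sub, map_add, map_sum]
  congr 1
  · congr 1
    · exact Finset.sum_congr rfl fun q _ => coeff_mul_congr (fun _ _ => rfl) (hw q) k le_rfl
    · refine coeff_mul_congr (fun _ _ => rfl) (fun i hi => ?_) k le_rfl
      rw [map_add, map_add, coeff_theta, coeff_theta, coeff_C_mul, coeff_C_mul, hw p i hi]
  · exact coeff_mul_congr (fun _ _ => rfl) (coeff_mul_congr hQ (hw p)) k le_rfl

theorem constantCoeff_residual (w : ι → ℂ⟦X⟧) (Q : ℂ⟦X⟧) (p : ι) :
    constantCoeff (residual B κ d α β w Q p) =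
      ∑ q, constantCoeff (B p q) * constantCoeff (w q) +
        (if α p = 0 then κ * (d p * constantCoeff (w p)) else 0) -
        if β p = 0 then constantCoeff Q * constantCoeff (w p) else 0 := by
  simp only [residual, map_sub, map_add, map_sum, map_mul, map_pow, constantCoeff_C,
    constantCoeff_X, constantCoeff_theta, zero_add, zero_pow_eq, mul_ite, ite_mul, mul_one,
    mul_zero, zero_mul, one_mul]

theorem coeff_residual_add_monomial (w : ι → ℂ⟦X⟧) (Q : ℂ⟦X⟧) {k : ℕ} (hk : 0 < k) (a : ι → ℂ)
    (b : ℂ) (p : ι) :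
    coeff k (residual B κ d α β (fun q => w q + C (a q) * X ^ k) (Q + C b * X ^ k) p) =
      coeff k (residual B κ d α β w Q p) + (∑ q, constantCoeff (B p q) * a q +
        (if α p = 0 then κ * ((k + d p) * a p) else 0) -
        if β p = 0 then constantCoeff Q * a p + b * constantCoeff (w p) else 0) := by
  have hexpand : residual B κ d α β (fun q => w q + C (a q) * X ^ k) (Q + C b * X ^ k) p =
      residual B κ d α β w Q p + (∑ q, B p q * (C (a q) * X ^ k) +
        C κ * X ^ α p * (C ((k + d p) * a p) * X ^ k) -
        (X ^ β p * Q * (C (a p) * X ^ k) + X ^ β p * (w p + C (a p) * X ^ k) * (C b * X ^ k))) := by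
    simp only [residual, theta_add, theta_C_mul_X_pow, mul_add, Finset.sum_add_distrib, add_mul,
      map_add, map_mul]
    ring
  rw [hexpand, map_add, map_sub, map_add, map_sum, map_add]
  simp only [coeff_mul_C_mul_X_pow]
  simp only [map_add, map_mul, map_pow, constantCoeff_C, constantCoeff_X, zero_pow_eq, hk.ne',
    if_false, mul_zero, add_zero]
  split_ifs <;> ring

theorem exists_formal_eigenvector (w₀ : ι → ℂ) (μ : ℂ)
    (h0 : ∀ p, ∑ q, constantCoeff (B p q) * w₀ q +
      (if α p = 0 then κ * (d p * w₀ p) else 0) = if β p = 0 then μ * w₀ p else 0)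
    (hsurj : ∀ k : ℕ, 0 < k → ∀ R : ι → ℂ, ∃ (a : ι → ℂ) (b : ℂ), ∀ p,
      ∑ q, constantCoeff (B p q) * a q + (if α p = 0 then κ * ((k + d p) * a p) else 0) -
        (if β p = 0 then μ * a p + b * w₀ p else 0) = R p) :
    ∃ (w : ι → ℂ⟦X⟧) (Q : ℂ⟦X⟧), (∀ p, constantCoeff (w p) = w₀ p) ∧ constantCoeff Q = μ ∧
      residual B κ d α β w Q = 0 := by
  let w : (ℕ → (ι → ℂ) × ℂ) → ι → ℂ⟦X⟧ := fun ω p => mk fun k => (ω k).1 p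
  let Q : (ℕ → (ι → ℂ) × ℂ) → ℂ⟦X⟧ := fun ω => mk fun k => (ω k).2
  have hw0 : ∀ {ω : ℕ → (ι → ℂ) × ℂ}, ω 0 = (w₀, μ) → ∀ p, constantCoeff (w ω p) = w₀ p :=
    fun h p => by rw [← coeff_zero_eq_constantCoeff_apply, coeff_mk, h]
  have hQ0 : ∀ {ω : ℕ → (ι → ℂ) × ℂ}, ω 0 = (w₀, μ) → constantCoeff (Q ω) = μ :=
    fun h => by rw [← coeff_zero_eq_constantCoeff_apply, coeff_mk, h]
  obtain ⟨ω, hω0, hω⟩ := exists_seq_of_step (w₀, μ)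
    (fun k ω => ∀ p, coeff k (residual B κ d α β (w ω) (Q ω) p) = 0)
    (fun k ω ω' h hω p => by
      rw [← hω p]
      exact coeff_residual_congr B κ d α β (fun p i hi => by simp only [w, coeff_mk, h i hi])
        (fun i hi => by simp only [Q, coeff_mk, h i hi]) p)
    (fun k ω hk hω => by
      have hz : update ω k 0 0 = (w₀, μ) := by rw [update_of_ne hk.ne, hω]
      obtain ⟨a, b, hab⟩ := hsurj k hk fun p =>
        -coeff k (residual B κ d α β (w (update ω k 0)) (Q (update ω k 0)) p)
      have hw : w (update ω k (a, b)) = fun q => w (update ω k 0) q + C (a q) * X ^ k := by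
        funext q
        exact (congrArg mk (comp_update (fun c => c.1 q) ω k (a, b))).trans <|
          (mk_update _ k (a q)).trans <| congrArg (mk · + _)
            (comp_update (fun c => c.1 q) ω k 0).symm
      have hQ : Q (update ω k (a, b)) = Q (update ω k 0) + C b * X ^ k :=
        (congrArg mk (comp_update Prod.snd ω k (a, b))).trans <|
          (mk_update _ k b).trans <| congrArg (mk · + _) (comp_update Prod.snd ω k 0).symm
      refine ⟨(a, b), fun p => ?_⟩
      rw [hw, hQ, coeff_residual_add_monomial _ _ _ _ _ _ _ hk, hw0 hz, hQ0 hz, hab p,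
        add_neg_cancel])
  refine ⟨w ω, Q ω, hw0 hω0, hQ0 hω0, ?_⟩
  ext p k
  rcases k.eq_zero_or_pos with rfl | hk
  · rw [coeff_zero_eq_constantCoeff_apply, constantCoeff_residual]
    simp only [hw0 hω0, hQ0 hω0, h0, sub_self]
    rfl
  · exact hω k hk p

theorem exists_theta_eq_mul {g : ℂ⟦X⟧} (hg : constantCoeff g = 0) :
    ∃ f : ℂ⟦X⟧, constantCoeff f = 1 ∧ theta f = g * f := by
  obtain ⟨ω, hω0, hω⟩ := exists_seq_of_step (1 : ℂ)
    (fun k ω => coeff k (theta (mk ω)) = coeff k (g * mk ω))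
    (fun k ω ω' h hω => by
      have hc : ∀ i ≤ k, coeff i (mk ω) = coeff i (mk ω') := fun i hi => by
        rw [coeff_mk, coeff_mk, h i hi]
      rw [← coeff_mul_congr (fun _ _ => rfl) hc k le_rfl, ← hω, coeff_theta, coeff_theta,
        hc k le_rfl])
    (fun k ω hk _ => by
      refine ⟨(k : ℂ)⁻¹ * coeff k (g * mk (update ω k 0)), ?_⟩
      rw [mk_update, mul_add, map_add, coeff_mul_C_mul_X_pow, hg, ← mk_update, coeff_theta,
        coeff_mk, update_self, mul_inv_cancel_left₀ (Nat.cast_ne_zero.mpr hk.ne'), zero_mul,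
        add_zero])
  refine ⟨mk ω, by rw [← coeff_zero_eq_constantCoeff_apply, coeff_mk, hω0], ?_⟩
  ext k
  rcases k.eq_zero_or_pos with rfl | hk
  · simp [coeff_theta, hg]
  · exact hω k hk

theorem exists_truncated_eigenvalue {κ : ℂ} (hκ : κ ≠ 0) (N : ℕ) {v : ι → ℂ⟦X⟧} {Q : ℂ⟦X⟧}
    (h : ∀ p, ∑ q, B p q * v q + C κ * X ^ N * theta (v p) = Q * v p) :
    ∃ f : ℂ⟦X⟧, constantCoeff f = 1 ∧ ∀ p, ∑ q, B p q * (f * v q) +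
      C κ * X ^ N * theta (f * v p) = (trunc (N + 1) Q : ℂ⟦X⟧) * (f * v p) := by
  let g : ℂ⟦X⟧ := X * mk fun i => coeff (i + (N + 1)) Q
  have hQ : Q = X ^ N * g + (trunc (N + 1) Q : ℂ⟦X⟧) := by
    rw [← mul_assoc, ← pow_succ]
    exact eq_X_pow_mul_shift_add_trunc (N + 1) Q
  obtain ⟨f, hf, hfg⟩ := exists_theta_eq_mul (g := C (-κ⁻¹) * g) (by simp [g])
  refine ⟨f, hf, fun p => ?_⟩
  have hsum : ∑ q, B p q * (f * v q) = f * ∑ q, B p q * v q := by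
    rw [Finset.mul_sum]
    exact Finset.sum_congr rfl fun q _ => by ring
  have hC : C κ * C (-κ⁻¹) = (-1 : ℂ⟦X⟧) := by
    rw [← map_mul, mul_neg, mul_inv_cancel₀ hκ, map_neg, map_one]
  have hp := h p
  rw [hQ] at hp
  rw [hsum, theta_mul, hfg]
  linear_combination f * hp + X ^ N * g * f * v p * hC

end Perturbation

/-! ### Formal Laurent series and extended bases -/

namespace FormalSeries

theorem x_ne_zero : x ≠ 0 := by simp [x]

theorem x_zpow (k : ℤ) : x ^ k = HahnSeries.single (-k) (1 : ℂ) := by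
  have hnat : ∀ m : ℕ, x ^ m = HahnSeries.single (-(m : ℤ)) (1 : ℂ) := fun m => by
    unfold x
    rw [HahnSeries.single_pow]
    simp
  obtain ⟨m, rfl | rfl⟩ := k.eq_nat_or_neg
  · rw [zpow_natCast, hnat]
  · rw [zpow_neg, zpow_natCast, hnat, HahnSeries.inv_single]
    simp

theorem xcoeff_zpow_mul (k m : ℤ) (f : FormalSeries) :
    xcoeff (x ^ k * f) m = xcoeff f (m - k) := by
  unfold xcoeff
  rw [x_zpow, show -m = -(m - k) + -k by ring, HahnSeries.coeff_single_mul_add, one_mul]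

theorem xcoeff_x_mul (m : ℤ) (f : FormalSeries) : xcoeff (x * f) m = xcoeff f (m - 1) := by
  simpa using xcoeff_zpow_mul 1 m f

theorem xcoeff_sub (f g : FormalSeries) (k : ℤ) :
    xcoeff (f - g) k = xcoeff f k - xcoeff g k := rfl

theorem xcoeff_zero (k : ℤ) : xcoeff 0 k = 0 := rfl

theorem xcoeff_sum {ι : Type*} (s : Finset ι) (f : ι → FormalSeries) (k : ℤ) :
    xcoeff (∑ i ∈ s, f i) k = ∑ i ∈ s, xcoeff (f i) k :=
  HahnSeries.coeff_sum ..

theorem xcoeff_C_mul (c : ℂ) (f : FormalSeries) (k : ℤ) :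
    xcoeff (HahnSeries.C c * f) k = c * xcoeff f k := by
  unfold xcoeff
  rw [HahnSeries.C_mul_eq_smul]
  rfl

theorem natCast_eq_C (m : ℕ) : (m : FormalSeries) = HahnSeries.C (m : ℂ) := by
  rw [map_natCast]

theorem natCast_ne_zero {m : ℕ} (hm : m ≠ 0) : (m : FormalSeries) ≠ 0 := by
  rw [natCast_eq_C]
  exact HahnSeries.C_ne_zero (Nat.cast_ne_zero.mpr hm)

theorem xcoeff_natCast_mul (c : ℕ) (f : FormalSeries) (k : ℤ) :
    xcoeff ((c : FormalSeries) * f) k = c * xcoeff f k := by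
  rw [natCast_eq_C, xcoeff_C_mul]

theorem xcoeff_x_mul_ddx (f : FormalSeries) (k : ℤ) :
    xcoeff (x * ddx f) k = k * xcoeff f k := by
  rw [xcoeff_x_mul, xcoeff_ddx]
  simp

end FormalSeries

section Extension

open FormalSeries Matrix

variable {m : ℕ}

/-- The residue of an integer modulo `m`. -/
def residue (hm : 1 ≤ m) (β : ℤ) : Fin m :=
  ⟨(β % m).toNat, by have := Int.emod_lt_of_pos β (b := m) (by omega); omega⟩

theorem residue_natCast (hm : 1 ≤ m) (b : Fin m) : residue hm (b : ℕ) = b := by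
  ext
  simp only [residue]
  rw [Int.emod_eq_of_lt (by omega) (by have := b.2; omega), Int.toNat_natCast]

theorem residue_add_mul (hm : 1 ≤ m) (β l : ℤ) : residue hm (β + m * l) = residue hm β := by
  ext
  simp [residue]

theorem residue_add_ediv (hm : 1 ≤ m) (β : ℤ) : ((residue hm β : ℕ) : ℤ) + m * (β / m) = β := by
  have h1 := Int.emod_nonneg β (b := m) (by omega)
  have h2 := Int.emod_add_mul_ediv β m
  simp only [residue]
  rw [Int.toNat_of_nonneg h1]
  exact h2

/-- The basis vector `e_b`, `0 ≤ b < m`, being extended by `e_{b + m} = x e_b`, the image of `e_β`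
under the linear form `y`. -/
def colExt (hm : 1 ≤ m) (y : Fin m → FormalSeries) (β : ℤ) : FormalSeries :=
  x ^ (β / m) * y (residue hm β)

/-- The coefficient of the vector `y` with respect to `e_α`, extended as in `colExt`. -/
def rowExt (hm : 1 ≤ m) (y : Fin m → FormalSeries) (α : ℤ) : FormalSeries :=
  x ^ (-(α / m)) * y (residue hm α)

theorem colExt_add_mul (hm : 1 ≤ m) (y : Fin m → FormalSeries) (β l : ℤ) :
    colExt hm y (β + m * l) = x ^ l * colExt hm y β := by
  unfold colExt
  rw [residue_add_mul, Int.add_mul_ediv_left _ _ (by omega), zpow_add₀ x_ne_zero]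
  ring

theorem rowExt_add_mul (hm : 1 ≤ m) (y : Fin m → FormalSeries) (α l : ℤ) :
    rowExt hm y (α + m * l) = x ^ (-l) * rowExt hm y α := by
  unfold rowExt
  rw [residue_add_mul, Int.add_mul_ediv_left _ _ (by omega), neg_add, zpow_add₀ x_ne_zero]
  ring

theorem colExt_natCast (hm : 1 ≤ m) (y : Fin m → FormalSeries) (b : Fin m) :
    colExt hm y (b : ℕ) = y b := by
  unfold colExt
  rw [residue_natCast, Int.ediv_eq_zero_of_lt (by omega) (by have := b.2; omega), zpow_zero,
    one_mul]

theorem rowExt_natCast (hm : 1 ≤ m) (y : Fin m → FormalSeries) (a : Fin m) :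
    rowExt hm y (a : ℕ) = y a := by
  unfold rowExt
  rw [residue_natCast, Int.ediv_eq_zero_of_lt (by omega) (by have := a.2; omega), neg_zero,
    zpow_zero, one_mul]

theorem vecMul_shiftMatrix (hm : 1 ≤ m) (y : Fin m → FormalSeries) (b : Fin m) :
    (y ᵥ* shiftMatrix m x) b = colExt hm y ((b : ℕ) + 1) := by
  rw [Matrix.vecMul, dotProduct]
  by_cases hb : (b : ℕ) + 1 < m
  · have h1 := colExt_natCast hm y ⟨b + 1, hb⟩
    push_cast at h1
    rw [h1, Finset.sum_eq_single ⟨b + 1, hb⟩]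
    · simp [shiftMatrix]
    · intro a _ ha
      have h2 : (a : ℕ) ≠ b + 1 := fun h => ha (Fin.ext h)
      simp [shiftMatrix, h2, show (b : ℕ) + 1 ≠ m by omega]
    · simp
  · have hb' : (b : ℕ) + 1 = m := by have := b.2; omega
    have h0 := colExt_natCast hm y ⟨0, hm⟩
    have h1 := colExt_add_mul hm y 0 1
    simp only [Nat.cast_zero] at h0
    rw [zero_add, mul_one, zpow_one, h0] at h1
    rw [show ((b : ℕ) : ℤ) + 1 = m by exact_mod_cast hb', h1, Finset.sum_eq_single ⟨0, hm⟩]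
    · simp [shiftMatrix, hb', mul_comm, show 0 ≠ m by omega]
    · intro a _ ha
      have h2 : (a : ℕ) ≠ 0 := fun h => ha (Fin.ext h)
      have := a.2
      simp [shiftMatrix, h2, show (a : ℕ) ≠ b + 1 by omega]
    · simp

theorem shiftMatrix_mulVec (hm : 1 ≤ m) (y : Fin m → FormalSeries) (a : Fin m) :
    (shiftMatrix m x *ᵥ y) a = rowExt hm y ((a : ℕ) - 1) := by
  rw [Matrix.mulVec, dotProduct]
  have ham := a.2
  by_cases ha : (a : ℕ) = 0
  · have h1 := rowExt_natCast hm y ⟨m - 1, by omega⟩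
    have h2 := rowExt_add_mul hm y ((m - 1 : ℕ) : ℤ) (-1)
    rw [neg_neg, zpow_one] at h2
    simp only at h1
    rw [h1] at h2
    rw [show ((a : ℕ) : ℤ) - 1 = ((m - 1 : ℕ) : ℤ) + m * (-1) by push_cast [hm]; omega, h2,
      Finset.sum_eq_single ⟨m - 1, by omega⟩]
    · simp [shiftMatrix, ha, show m - 1 + 1 = m by omega, show 0 ≠ m by omega]
    · intro b _ hb
      have h2 : (b : ℕ) ≠ m - 1 := fun h => hb (Fin.ext h)
      simp [shiftMatrix, ha, show (b : ℕ) + 1 ≠ m by omega]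
    · simp
  · have h1 := rowExt_natCast hm y ⟨a - 1, by omega⟩
    simp only at h1
    rw [show ((a : ℕ) : ℤ) - 1 = ((a - 1 : ℕ) : ℤ) by omega, h1,
      Finset.sum_eq_single ⟨a - 1, by omega⟩]
    · simp [shiftMatrix, show (a : ℕ) - 1 + 1 = a by omega]
    · intro b _ hb
      have h2 : (b : ℕ) ≠ a - 1 := fun h => hb (Fin.ext h)
      simp [shiftMatrix, ha, show (a : ℕ) ≠ b + 1 by omega]
    · simp

theorem colExt_vecMul_shiftMatrix_pow (hm : 1 ≤ m) (y : Fin m → FormalSeries) (J : ℕ) (β : ℤ) :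
    colExt hm (y ᵥ* shiftMatrix m x ^ J) β = colExt hm y (β + J) := by
  induction J generalizing β with
  | zero => simp
  | succ J ih =>
    rw [pow_succ, ← Matrix.vecMul_vecMul]
    conv_lhs => rw [colExt, vecMul_shiftMatrix hm, ← colExt_add_mul, ih]
    congr 1
    have := residue_add_ediv hm β
    push_cast
    linarith

theorem rowExt_shiftMatrix_pow_mulVec (hm : 1 ≤ m) (y : Fin m → FormalSeries) (J : ℕ) (α : ℤ) :
    rowExt hm (shiftMatrix m x ^ J *ᵥ y) α = rowExt hm y (α - J) := by
  induction J generalizing α with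
  | zero => simp
  | succ J ih =>
    rw [pow_succ', ← mulVec_mulVec]
    conv_lhs => rw [rowExt, shiftMatrix_mulVec hm, ← rowExt_add_mul, ih]
    congr 1
    have := residue_add_ediv hm α
    push_cast
    linarith

theorem vecMul_normalBlock (hm : 1 ≤ m) (r : ℕ) (t : ℕ → ℂ) (y : Fin m → FormalSeries)
    (b : Fin m) :
    (m : FormalSeries) * x * (y ᵥ* normalBlock r m t) b =
      ∑ J ∈ Finset.range (r * m + 1), HahnSeries.C (t J) * colExt hm y ((b : ℕ) + (J : ℕ))
        - (b : ℕ) * y b := by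
  have hmx : (m : FormalSeries) * x ≠ 0 :=
    mul_ne_zero (natCast_ne_zero (by omega)) x_ne_zero
  rw [normalBlock, vecMul_smul, Pi.smul_apply, smul_eq_mul, mul_inv_cancel_left₀ hmx,
    vecMul_sub, Pi.sub_apply]
  congr 1
  · rw [vecMul_sum, Finset.sum_apply]
    refine Finset.sum_congr rfl fun J _ => ?_
    rw [vecMul_smul, Pi.smul_apply, smul_eq_mul, ← colExt_vecMul_shiftMatrix_pow,
      colExt_natCast]
  · rw [vecMul_diagonal, mul_comm]

theorem normalBlock_mulVec (hm : 1 ≤ m) (r : ℕ) (t : ℕ → ℂ) (y : Fin m → FormalSeries)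
    (a : Fin m) :
    (m : FormalSeries) * x * (normalBlock r m t *ᵥ y) a =
      ∑ J ∈ Finset.range (r * m + 1), HahnSeries.C (t J) * rowExt hm y ((a : ℕ) - (J : ℕ))
        - (a : ℕ) * y a := by
  have hmx : (m : FormalSeries) * x ≠ 0 :=
    mul_ne_zero (natCast_ne_zero (by omega)) x_ne_zero
  rw [normalBlock, smul_mulVec, Pi.smul_apply, smul_eq_mul, mul_inv_cancel_left₀ hmx,
    sub_mulVec, Pi.sub_apply]
  congr 1
  · rw [sum_mulVec, Finset.sum_apply]
    refine Finset.sum_congr rfl fun J _ => ?_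
    rw [smul_mulVec, Pi.smul_apply, smul_eq_mul, ← rowExt_shiftMatrix_pow_mulVec,
      rowExt_natCast]
  · rw [mulVec_diagonal]

end Extension

/-! ### Intertwiners of two normal blocks -/

section Intertwiners

/-- The coefficients of an intertwiner `W` of two normal blocks of sizes `m` and `l`, with respect
to the extended bases `e_α`: `W e_β = ∑ F α β e_α`. -/
structure IsIntertwiner (r m l : ℕ) (t t' : ℕ → ℂ) (F : ℤ → ℤ → ℂ) : Prop where
  periodic : ∀ α β, F (α + m) (β + l) = F α β
  bounded : ∃ K : ℤ, ∀ α β, K < α * l - β * m → F α β = 0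
  eqn : ∀ α β, l * ∑ J ∈ Finset.range (r * m + 1), t J * F (α - J) β -
    m * ∑ J ∈ Finset.range (r * l + 1), t' J * F α (β + J) = (α * l - β * m) * F α β

theorem sum_range_eq_last {M : Type*} [AddCommMonoid M] {f : ℕ → M} {N : ℕ} (hN : 0 < N)
    (h : ∀ J, J + 1 < N → f J = 0) : ∑ J ∈ Finset.range N, f J = f (N - 1) :=
  Finset.sum_eq_single_of_mem _ (Finset.mem_range.mpr (by lia)) fun J hJ hne =>
    h J (by have := Finset.mem_range.mp hJ; lia)

theorem eq_pow_mul_of_eq_mul_sub_one {R : Type*} [CommMonoid R] {g : ℤ → R} {ζ : R}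
    (hg : ∀ β, g β = ζ * g (β - 1)) (β : ℤ) (k : ℕ) : g (β + k) = ζ ^ k * g β := by
  induction k with
  | zero => simp
  | succ k ih =>
    rw [hg, Nat.cast_succ, ← add_assoc, add_sub_cancel_right, ih, ← mul_assoc, pow_succ']

theorem eq_mul_sub_one_of_periodic {K : Type*} [Field K] [CharZero K] {f : ℤ → K} {ζ : K} {m : ℕ}
    (hm : m ≠ 0) (hζ : ζ ^ m = 1) (hper : ∀ β, f (β + m) = f β)
    (hf : ∀ β, f β - ζ * f (β - 1) = ζ * (f (β - 1) - ζ * f (β - 1 - 1))) (β : ℤ) :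
    f β = ζ * f (β - 1) := by
  have hlin : ∀ k : ℕ, ζ * f (β - 1 + k) =
      ζ ^ k * (ζ * f (β - 1) + k * (f β - ζ * f (β - 1))) := by
    intro k
    induction k with
    | zero => simp
    | succ k ih =>
      have hk := eq_pow_mul_of_eq_mul_sub_one (g := fun β => f β - ζ * f (β - 1)) hf β k
      simp only [show β + k - 1 = β - 1 + k by ring] at hk
      rw [show β - 1 + ((k + 1 : ℕ) : ℤ) = β + k by push_cast; ring]
      push_cast
      linear_combination ζ * hk + ζ * ih
  have h := hlin m
  rw [hper, hζ, one_mul, left_eq_add, mul_eq_zero] at h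
  exact sub_eq_zero.mp (h.resolve_left (Nat.cast_ne_zero.mpr hm))

theorem eq_zero_of_sum_mul_sub_eq {N : ℕ} {c : ℕ → ℂ} {φ : ℤ → ℂ} {D : ℤ} (hD : φ D ≠ 0)
    (hmax : ∀ α, D < α → φ α = 0)
    (h : ∀ α : ℤ, ∑ J ∈ Finset.range (N + 1), c J * φ (α - J) = α * φ α) :
    (∀ J, 1 ≤ J → J ≤ N → c J = 0) ∧ c 0 = D ∧ ∀ α, α ≠ D → φ α = 0 := by
  induction N with
  | zero =>
    have h0 : ∀ α : ℤ, (c 0 - α) * φ α = 0 := fun α => by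
      have := h α
      rw [Finset.sum_range_one, Nat.cast_zero, sub_zero] at this
      rw [sub_mul, this, sub_self]
    have hc : c 0 = D := sub_eq_zero.mp ((mul_eq_zero.mp (h0 D)).resolve_right hD)
    refine ⟨fun J h1 h2 => absurd (h1.trans h2) (by simp), hc, fun α hα => ?_⟩
    refine (mul_eq_zero.mp (h0 α)).resolve_left fun h1 => hα ?_
    exact_mod_cast ((sub_eq_zero.mp h1).symm.trans hc)
  | succ N ih =>
    have htop : c (N + 1) = 0 := by
      have e := h (D + (N + 1 : ℕ))
      rw [sum_range_eq_last (by lia) fun J hJ => by rw [hmax _ (by lia), mul_zero],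
        hmax (D + _) (by lia), mul_zero, Nat.add_sub_cancel, add_sub_cancel_right] at e
      exact (mul_eq_zero.mp e).resolve_right hD
    obtain ⟨h1, h2⟩ := ih fun α => by
      rw [← h α, Finset.sum_range_succ _ (N + 1), htop, zero_mul, add_zero]
    refine ⟨fun J hJ hJN => ?_, h2⟩
    rcases hJN.eq_or_lt with rfl | hlt
    · exact htop
    · exact h1 J hJ (Nat.lt_succ_iff.mp hlt)

namespace IsIntertwiner

variable {r m l : ℕ} {t t' : ℕ → ℂ} {F : ℤ → ℤ → ℂ}

theorem periodic_mul (h : IsIntertwiner r m l t t' F) (α β : ℤ) (k : ℕ) :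
    F (α + m * k) (β + l * k) = F α β := by
  induction k with
  | zero => simp
  | succ k ih =>
    rw [← ih, ← h.periodic (α + m * k)]
    push_cast
    congr 1 <;> ring

/-- The transpose `e_α ↦ e_{-α}` exchanges the two blocks. -/
theorem transpose (h : IsIntertwiner r m l t t' F) :
    IsIntertwiner r l m (-t') (-t) fun α β => F (-β) (-α) where
  periodic α β := by
    rw [← h.periodic (-(β + m)) (-(α + l)), neg_add, neg_add, neg_add_cancel_right,
      neg_add_cancel_right]
  bounded := h.bounded.imp fun K hK α β hαβ => hK _ _ (by linarith)
  eqn α β := by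
    have e := h.eqn (-β) (-α)
    simp only [Pi.neg_apply, neg_mul, Finset.sum_neg_distrib, neg_sub, neg_add']
    simp only [neg_add_eq_sub] at e
    push_cast at e
    linear_combination e

theorem exists_leading (h : IsIntertwiner r m l t t' F) (hF : ∃ α β, F α β ≠ 0) :
    ∃ α β, F α β ≠ 0 ∧ ∀ α' β', α * l - β * m < α' * l - β' * m → F α' β' = 0 := by
  obtain ⟨K, hK⟩ := h.bounded
  obtain ⟨w, ⟨α, β, hαβ, hw⟩, hmax⟩ := Int.exists_greatest_of_bdd
    (P := fun w => ∃ α β, F α β ≠ 0 ∧ α * l - β * m = w)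
    ⟨K, by
      rintro w ⟨α, β, h1, rfl⟩
      by_contra h2
      exact h1 (hK α β (not_le.mp h2))⟩
    (by obtain ⟨α, β, h1⟩ := hF; exact ⟨_, α, β, h1, rfl⟩)
  refine ⟨α, β, hαβ, fun α' β' h' => ?_⟩
  by_contra h2
  have := hmax _ ⟨α', β', h2, rfl⟩
  lia

theorem eigenvalue_eq (h : IsIntertwiner r m l t t' F) (hr : 1 ≤ r) (hm : 1 ≤ m) (hl : 1 ≤ l)
    {a a' : ℂ} (ht : t (r * m) = m * a) (ht' : t' (r * l) = l * a') (hF : ∃ α β, F α β ≠ 0) :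
    a = a' := by
  obtain ⟨α, β, h0, hmax⟩ := h.exists_leading hF
  have hpos : (0 : ℤ) < r * m * l := by positivity
  have e := h.eqn (α + m * r) β
  rw [sum_range_eq_last (Nat.succ_pos _) fun J hJ => ?left,
    sum_range_eq_last (Nat.succ_pos _) fun J hJ => ?right, hmax (α + m * r) β (by linarith)] at e
  case left =>
    have : (J : ℤ) < r * m := by exact_mod_cast Nat.lt_of_succ_lt_succ hJ
    rw [hmax _ _ (by nlinarith), mul_zero]
  case right =>
    have : (J : ℤ) < r * l := by exact_mod_cast Nat.lt_of_succ_lt_succ hJ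
    rw [hmax _ _ (by nlinarith), mul_zero]
  simp only [Nat.succ_sub_one] at e
  rw [show β + ((r * l : ℕ) : ℤ) = β + l * r by push_cast; ring, h.periodic_mul α β r, ht, ht',
    show α + (m : ℤ) * r - ((r * m : ℕ) : ℤ) = α by push_cast; ring] at e
  have hm' : (m : ℂ) ≠ 0 := Nat.cast_ne_zero.mpr (by lia)
  have hl' : (l : ℂ) ≠ 0 := Nat.cast_ne_zero.mpr (by lia)
  have : (m * l * F α β : ℂ) * (a - a') = 0 := by linear_combination e
  exact sub_eq_zero.mp ((mul_eq_zero.mp this).resolve_left (mul_ne_zero (mul_ne_zero hm' hl') h0))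

theorem eqn_of_eigenvalue_eq (h : IsIntertwiner r m l t t' F) {a : ℂ} (ht : t (r * m) = m * a)
    (ht' : t' (r * l) = l * a) (α β : ℤ) :
    l * ∑ J ∈ Finset.range (r * m), t J * F (α - J) β -
      m * ∑ J ∈ Finset.range (r * l), t' J * F α (β + J) = (α * l - β * m) * F α β := by
  have e := h.eqn α β
  have p := h.periodic_mul (α - m * r) β r
  rw [sub_add_cancel] at p
  rw [Finset.sum_range_succ, Finset.sum_range_succ, ht, ht',
    show β + ((r * l : ℕ) : ℤ) = β + l * r by push_cast; ring, p,
    show α - ((r * m : ℕ) : ℤ) = α - m * r by push_cast; ring] at e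
  linear_combination e

theorem size_le (h : IsIntertwiner r m l t t' F) (hr : 1 ≤ r) (hl : 1 ≤ l) {a : ℂ}
    (ht : t (r * m) = m * a) (ht' : t' (r * l) = l * a) (h1 : 2 ≤ m → t (r * m - 1) ≠ 0)
    (hF : ∃ α β, F α β ≠ 0) : m ≤ l := by
  by_contra! hlm
  obtain ⟨α, β, h0, hmax⟩ := h.exists_leading hF
  have hrm : 1 < r * m := by nlinarith
  have htop : ((r * m - 1 : ℕ) : ℤ) = r * m - 1 := by push_cast [hrm.le]; ring
  have : (1 : ℤ) < r * m := by exact_mod_cast hrm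
  have : (1 : ℤ) ≤ l := by exact_mod_cast hl
  have : (l : ℤ) < m := by exact_mod_cast hlm
  have e := h.eqn_of_eigenvalue_eq ht ht' (α + (r * m - 1 : ℕ)) β
  rw [sum_range_eq_last (by lia) fun J hJ => ?left, Finset.sum_eq_zero fun J hJ => ?right,
    hmax (α + _) β (by rw [htop]; nlinarith), add_sub_cancel_right] at e
  case left => rw [hmax _ _ (by nlinarith [show (J : ℤ) < (r * m - 1 : ℕ) by lia]), mul_zero]
  case right =>
    have hJ' : (J : ℤ) < r * l := by exact_mod_cast Finset.mem_range.mp hJ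
    rw [hmax _ _ (by rw [htop]; nlinarith), mul_zero]
  rw [mul_zero, mul_zero, sub_zero] at e
  exact mul_ne_zero (Nat.cast_ne_zero.mpr (by lia)) (mul_ne_zero (h1 (by lia)) h0) e

theorem le_size (h : IsIntertwiner r m l t t' F) (hr : 1 ≤ r) (hm : 1 ≤ m) {a : ℂ}
    (ht : t (r * m) = m * a) (ht' : t' (r * l) = l * a) (h1 : 2 ≤ l → t' (r * l - 1) ≠ 0)
    (hF : ∃ α β, F α β ≠ 0) : l ≤ m := by
  obtain ⟨α, β, h0⟩ := hF
  refine h.transpose.size_le hr hm (a := -a) (by simp [ht']) (by simp [ht])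
    (fun hl => neg_ne_zero.mpr (h1 hl)) ⟨-β, -α, ?_⟩
  rwa [neg_neg, neg_neg]

theorem sub_shift (h : IsIntertwiner r m m t t' F) (ζ : ℂ) :
    IsIntertwiner r m m t t' fun α β => F α β - ζ * F (α - 1) (β - 1) where
  periodic α β := by
    rw [h.periodic, add_sub_right_comm α, add_sub_right_comm β, h.periodic]
  bounded := by
    obtain ⟨K, hK⟩ := h.bounded
    refine ⟨K, fun α β h' => ?_⟩
    rw [hK α β h', hK (α - 1) (β - 1) (by linarith), mul_zero, sub_zero]
  eqn α β := by
    have e₁ := h.eqn α β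
    have e₂ := h.eqn (α - 1) (β - 1)
    simp only [mul_sub, mul_left_comm _ ζ, Finset.sum_sub_distrib, ← Finset.mul_sum]
    simp only [fun J : ℕ => sub_right_comm α (J : ℤ) 1, add_sub_right_comm β]
    push_cast at e₂
    linear_combination e₁ - ζ * e₂

theorem exists_leading_diagonal (h : IsIntertwiner r m m t t' F) (hm : 1 ≤ m)
    (hF : ∃ α β, F α β ≠ 0) :
    ∃ δ, (∃ β, F (β + δ) β ≠ 0) ∧ ∀ α β, δ < α - β → F α β = 0 := by
  obtain ⟨α, β, h0, hmax⟩ := h.exists_leading hF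
  refine ⟨α - β, ⟨β, by rwa [add_sub_cancel]⟩, fun α' β' h' => hmax α' β' ?_⟩
  rw [← sub_mul, ← sub_mul]
  exact mul_lt_mul_of_pos_right h' (by lia)

theorem diagonal_periodic (h : IsIntertwiner r m m t t' F) (δ β : ℤ) :
    F (β + m + δ) (β + m) = F (β + δ) β := by
  rw [add_right_comm, h.periodic]

theorem leading_diagonal (h : IsIntertwiner r m m t t' F) (hr : 1 ≤ r) (hm : 2 ≤ m) {a : ℂ}
    (ht : t (r * m) = m * a) (ht' : t' (r * m) = m * a) (h1 : t (r * m - 1) ≠ 0) {δ : ℤ}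
    (hmax : ∀ α β, δ < α - β → F α β = 0) (β : ℤ) :
    F (β + δ) β = t' (r * m - 1) / t (r * m - 1) * F (β - 1 + δ) (β - 1) := by
  have hrm : 1 < r * m := by nlinarith
  have htop : ((r * m - 1 : ℕ) : ℤ) = m * r - 1 := by push_cast [hrm.le]; ring
  have e := h.eqn_of_eigenvalue_eq ht ht' (β + δ + (r * m - 1 : ℕ)) β
  rw [sum_range_eq_last (by lia) fun J hJ => by rw [hmax _ _ (by lia), mul_zero],
    sum_range_eq_last (by lia) fun J hJ => by rw [hmax _ _ (by lia), mul_zero],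
    hmax (β + δ + _) β (by lia), add_sub_cancel_right, htop,
    show β + δ + (m * r - 1 : ℤ) = β - 1 + δ + m * r by ring,
    show β + (m * r - 1 : ℤ) = β - 1 + m * r by ring, h.periodic_mul, mul_zero, ← mul_sub] at e
  have hm' : (m : ℂ) ≠ 0 := Nat.cast_ne_zero.mpr (by lia)
  rw [div_mul_eq_mul_div, eq_div_iff h1]
  linear_combination (mul_eq_zero.mp e).resolve_left hm'

/-- The leading diagonals of `F` and of its twisted differences are geometric with the same ratio,
so the twisted difference vanishes by periodicity. -/
theorem exists_geometric (h : IsIntertwiner r m m t t' F) (hr : 1 ≤ r) (hm : 1 ≤ m) {a : ℂ}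
    (ht : t (r * m) = m * a) (ht' : t' (r * m) = m * a) (h1 : 2 ≤ m → t (r * m - 1) ≠ 0)
    (hF : ∃ α β, F α β ≠ 0) :
    ∃ ζ : ℂ, ζ ^ m = 1 ∧ ∀ α β, F α β = ζ * F (α - 1) (β - 1) := by
  obtain rfl | hm2 : m = 1 ∨ 2 ≤ m := by lia
  · refine ⟨1, one_pow _, fun α β => ?_⟩
    rw [one_mul, ← h.periodic (α - 1) (β - 1), Nat.cast_one, sub_add_cancel, sub_add_cancel]
  set ζ := t' (r * m - 1) / t (r * m - 1) with hζ
  have hζm : ζ ^ m = 1 := by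
    obtain ⟨δ, ⟨β, h0⟩, hmax⟩ := h.exists_leading_diagonal hm hF
    have hg := eq_pow_mul_of_eq_mul_sub_one (g := fun β => F (β + δ) β)
      (h.leading_diagonal hr hm2 ht ht' (h1 hm2) hmax) β m
    rw [h.diagonal_periodic] at hg
    exact (mul_right_cancel₀ h0 ((one_mul _).trans hg)).symm
  refine ⟨ζ, hζm, ?_⟩
  by_contra! hne
  obtain ⟨α', β', hne⟩ := hne
  obtain ⟨δ, ⟨β, h0⟩, hmax⟩ :=
    (h.sub_shift ζ).exists_leading_diagonal hm ⟨α', β', sub_ne_zero.mpr hne⟩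
  have hg := (h.sub_shift ζ).leading_diagonal hr hm2 ht ht' (h1 hm2) hmax
  simp only [add_sub_right_comm _ δ, ← hζ] at hg
  refine h0 (sub_eq_zero.mpr ?_)
  rw [add_sub_right_comm]
  exact eq_mul_sub_one_of_periodic (by lia) hζm (f := fun β => F (β + δ) β)
    (h.diagonal_periodic δ) hg β

theorem sum_sub_mul_of_geometric (h : IsIntertwiner r m m t t' F) (hm : 1 ≤ m) {ζ : ℂ}
    (hcol : ∀ α (β : ℕ), F α β = ζ ^ β * F (α - β) 0) (α : ℤ) :
    ∑ J ∈ Finset.range (r * m + 1), (t J - ζ ^ J * t' J) * F (α - J) 0 = α * F α 0 := by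
  have e := h.eqn α 0
  have hsum : ∑ J ∈ Finset.range (r * m + 1), t' J * F α (0 + J) =
      ∑ J ∈ Finset.range (r * m + 1), ζ ^ J * t' J * F (α - J) 0 :=
    Finset.sum_congr rfl fun J _ => by rw [zero_add, hcol]; ring
  rw [hsum, Int.cast_zero, zero_mul, sub_zero] at e
  simp only [sub_mul, Finset.sum_sub_distrib]
  refine mul_left_cancel₀ (Nat.cast_ne_zero.mpr (by lia : m ≠ 0)) ?_
  linear_combination e

theorem eq_monomial (h : IsIntertwiner r m m t t' F) (hr : 1 ≤ r) (hm : 1 ≤ m) {a : ℂ}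
    (ht : t (r * m) = m * a) (ht' : t' (r * m) = m * a) (h1 : 2 ≤ m → t (r * m - 1) ≠ 0)
    (hF : ∃ α β, F α β ≠ 0) :
    ∃ (ζ c : ℂ) (δ : ℤ), ζ ^ m = 1 ∧ c ≠ 0 ∧
      (∀ α (β : ℕ), F α β = if α - β = δ then c * ζ ^ β else 0) ∧
      (∀ J, 1 ≤ J → J ≤ r * m → t J = ζ ^ J * t' J) ∧ t 0 - t' 0 = δ := by
  obtain ⟨ζ, hζ, hgeo⟩ := h.exists_geometric hr hm ht ht' h1 hF
  have hζ0 : ζ ≠ 0 := (IsUnit.of_pow_eq_one hζ (by lia)).ne_zero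
  have hdiag : ∀ δ β (k : ℕ), F (β + k + δ) (β + k) = ζ ^ k * F (β + δ) β := fun δ =>
    eq_pow_mul_of_eq_mul_sub_one (g := fun β => F (β + δ) β) fun β => by
      rw [hgeo (β + δ) β, add_sub_right_comm]
  have hcol : ∀ α (β : ℕ), F α β = ζ ^ β * F (α - β) 0 := fun α β => by
    have := hdiag (α - β) 0 β
    rwa [zero_add, zero_add, add_sub_cancel] at this
  obtain ⟨δ, ⟨β, h0⟩, hmax⟩ := h.exists_leading_diagonal hm hF
  have hδ : F δ 0 ≠ 0 := by
    obtain ⟨k, rfl | rfl⟩ := β.eq_nat_or_neg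
    · rw [hcol, add_sub_cancel_left] at h0
      exact right_ne_zero_of_mul h0
    · have := hdiag δ (-k) k
      rw [neg_add_cancel, zero_add] at this
      exact this ▸ mul_ne_zero (pow_ne_zero _ hζ0) h0
  obtain ⟨hpos, hzero, hsupp⟩ := eq_zero_of_sum_mul_sub_eq (φ := (F · 0)) (D := δ) hδ
    (fun α hα => hmax α 0 (by simpa using hα)) (h.sum_sub_mul_of_geometric hm hcol)
  refine ⟨ζ, F δ 0, δ, hζ, hδ, fun α β => ?_, fun J hJ hJ' => sub_eq_zero.mp (hpos J hJ hJ'), ?_⟩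
  · rw [hcol]
    split_ifs with hαβ
    · rw [hαβ, mul_comm]
    · rw [hsupp _ hαβ, mul_zero]
  · simpa using hzero

end IsIntertwiner

end Intertwiners

/-! ### Gauge transformations -/

section Gauge

open FormalSeries Matrix

section

variable {ι : Type*}

theorem xcoeff_ofPowerSeries (f : PowerSeries ℂ) (k : ℕ) :
    xcoeff (HahnSeries.ofPowerSeries ℤ ℂ f) (-(k : ℤ)) = PowerSeries.coeff k f := by
  rw [xcoeff, neg_neg, HahnSeries.ofPowerSeries_apply_coeff]

theorem xcoeff_ofPowerSeries_of_pos (f : PowerSeries ℂ) {k : ℤ} (hk : 0 < k) :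
    xcoeff (HahnSeries.ofPowerSeries ℤ ℂ f) k = 0 := by
  rw [xcoeff, HahnSeries.ofPowerSeries_apply]
  refine HahnSeries.embDomain_of_notMem_range ?_
  rintro ⟨m, hm⟩
  have : (m : ℤ) = -k := hm
  lia

theorem exists_ofPowerSeries {f : FormalSeries} (hf : ∀ k : ℤ, 0 < k → xcoeff f k = 0) :
    ∃ g : PowerSeries ℂ, f = HahnSeries.ofPowerSeries ℤ ℂ g := by
  refine ⟨PowerSeries.mk fun k => xcoeff f (-(k : ℤ)), xcoeff_ext fun k => ?_⟩
  rcases lt_or_ge 0 k with h | h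
  · rw [hf k h, xcoeff_ofPowerSeries_of_pos _ h]
  · obtain ⟨m, rfl⟩ : ∃ m : ℕ, k = -(m : ℤ) := ⟨(-k).toNat, by lia⟩
    rw [xcoeff_ofPowerSeries, PowerSeries.coeff_mk]

theorem coeffMatrix_ofPowerSeries (Y : Matrix ι ι (PowerSeries ℂ)) :
    coeffMatrix (Y.map (HahnSeries.ofPowerSeries ℤ ℂ)) 0 = Y.map PowerSeries.constantCoeff := by
  ext i j
  simpa [coeffMatrix] using xcoeff_ofPowerSeries (Y i j) 0

theorem map_ddx_mul [Fintype ι] (Y Z : Matrix ι ι FormalSeries) :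
    (Y * Z).map ddx = Y.map ddx * Z + Y * Z.map ddx := by
  have hsum (f : ι → FormalSeries) : ddx (∑ i, f i) = ∑ i, ddx (f i) :=
    map_sum (AddMonoidHom.mk' ddx ddx_add) f _
  ext i j : 1
  simp only [map_apply, mul_apply, Matrix.add_apply, hsum, ddx_mul, Finset.sum_add_distrib]

variable [Fintype ι] [DecidableEq ι] {Y Y' A D D' : Matrix ι ι FormalSeries}

theorem det_coeffMatrix_ofPowerSeries_ne_zero (Z : Matrix ι ι (PowerSeries ℂ)) :
    (coeffMatrix (Z.map (HahnSeries.ofPowerSeries ℤ ℂ)) 0).det ≠ 0 ↔ IsUnit Z.det := by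
  rw [coeffMatrix_ofPowerSeries, PowerSeries.isUnit_iff_constantCoeff, RingHom.map_det,
    isUnit_iff_ne_zero, RingHom.mapMatrix_apply]

theorem isFormalGauge_iff :
    IsFormalGauge Y ↔ ∃ Z : Matrix ι ι (PowerSeries ℂ),
      Y = Z.map (HahnSeries.ofPowerSeries ℤ ℂ) ∧ IsUnit Z.det := by
  constructor
  · rintro ⟨hpos, hdet⟩
    choose Z hZ using fun i j => exists_ofPowerSeries (f := Y i j)
      fun k hk => congrFun (congrFun (hpos k hk) i) j
    have hY : Y = (of Z).map (HahnSeries.ofPowerSeries ℤ ℂ) := Matrix.ext hZ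
    exact ⟨of Z, hY, (det_coeffMatrix_ofPowerSeries_ne_zero _).mp (hY ▸ hdet)⟩
  · rintro ⟨Z, rfl, hZ⟩
    exact ⟨fun k hk => Matrix.ext fun i j => xcoeff_ofPowerSeries_of_pos _ hk,
      (det_coeffMatrix_ofPowerSeries_ne_zero Z).mpr hZ⟩

theorem IsFormalGauge.isUnit_det (h : IsFormalGauge Y) : IsUnit Y.det := by
  obtain ⟨Z, rfl, hZ⟩ := isFormalGauge_iff.mp h
  rw [← RingHom.mapMatrix_apply, ← RingHom.map_det]
  exact hZ.map _

theorem IsFormalGauge.inv_mul (h : IsFormalGauge Y) (h' : IsFormalGauge Y') :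
    IsFormalGauge (Y⁻¹ * Y') := by
  obtain ⟨Z, hY, hZ⟩ := isFormalGauge_iff.mp h
  obtain ⟨Z', rfl, hZ'⟩ := isFormalGauge_iff.mp h'
  have hinv : Y⁻¹ = Z⁻¹.map (HahnSeries.ofPowerSeries ℤ ℂ) := by
    refine inv_eq_left_inv ?_
    rw [hY, ← Matrix.map_mul, nonsing_inv_mul _ hZ, Matrix.map_one _ (map_zero _) (map_one _)]
  refine isFormalGauge_iff.mpr ⟨Z⁻¹ * Z', by rw [hinv, Matrix.map_mul], ?_⟩
  rw [det_mul]
  exact (isUnit_nonsing_inv_det _ hZ).mul hZ'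

theorem gauge_eq_iff (h : IsUnit Y.det) :
    Y⁻¹ * A * Y - Y⁻¹ * Y.map ddx = D ↔ A * Y - Y.map ddx = Y * D := by
  rw [Matrix.mul_assoc, ← Matrix.mul_sub]
  constructor
  · rintro rfl
    rw [mul_nonsing_inv_cancel_left _ _ h]
  · intro h'
    rw [h', nonsing_inv_mul_cancel_left _ _ h]

theorem gauge_intertwine (h : IsUnit Y.det) (hD : A * Y - Y.map ddx = Y * D)
    (hD' : A * Y' - Y'.map ddx = Y' * D') :
    D * (Y⁻¹ * Y') - (Y⁻¹ * Y').map ddx = (Y⁻¹ * Y') * D' := by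
  generalize hW : Y⁻¹ * Y' = W
  have hY' : Y' = Y * W := by rw [← hW, mul_nonsing_inv_cancel_left _ _ h]
  rw [hY', map_ddx_mul] at hD'
  have hYW : Y * (D * W - W.map ddx) = Y * (W * D') := by
    rw [Matrix.mul_sub, ← Matrix.mul_assoc, ← hD, ← Matrix.mul_assoc, ← hD', Matrix.sub_mul,
      Matrix.mul_assoc A]
    abel
  rw [← nonsing_inv_mul_cancel_left Y (D * W - W.map ddx) h, hYW,
    nonsing_inv_mul_cancel_left _ _ h]

end

variable {s r : ℕ} {n : Fin s → ℕ} {lam : Fin s → ℂ}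

section

variable {A Y Y' : Matrix (BlockIndex n) (BlockIndex n) FormalSeries} {t t' : Fin s → ℕ → ℂ}

theorem IsNormalizingGauge.eqn (h : IsNormalizingGauge r n lam A Y t) :
    A * Y - Y.map ddx = Y * normalForm r n t :=
  (gauge_eq_iff h.1.isUnit_det).mp h.2.2

theorem IsNormalizingGauge.intertwine (h : IsNormalizingGauge r n lam A Y t)
    (h' : IsNormalizingGauge r n lam A Y' t') :
    normalForm r n t * (Y⁻¹ * Y') - (Y⁻¹ * Y').map ddx = (Y⁻¹ * Y') * normalForm r n t' :=
  gauge_intertwine h.1.isUnit_det h.eqn h'.eqn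

end

section

variable {α κ ι : Type*} {m : ι → Type*} [NonUnitalNonAssocSemiring α] [Fintype ι] [DecidableEq ι]
  [∀ i, Fintype (m i)]

theorem blockDiagonal'_mulVec_apply (M : ∀ i, Matrix (m i) (m i) α) (v : (Σ i, m i) → α) (i : ι)
    (a : m i) : (blockDiagonal' M *ᵥ v) ⟨i, a⟩ = (M i *ᵥ fun b => v ⟨i, b⟩) a := by
  simp only [mulVec, dotProduct, Fintype.sum_sigma]
  rw [Finset.sum_eq_single_of_mem i (Finset.mem_univ i)]
  · simp only [blockDiagonal'_apply_eq]
  · exact fun k _ hk => Finset.sum_eq_zero fun b _ => by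
      rw [blockDiagonal'_apply_ne _ _ _ hk.symm, zero_mul]

theorem blockDiagonal'_mul_apply (M : ∀ i, Matrix (m i) (m i) α) (W : Matrix (Σ i, m i) κ α)
    (i : ι) (a : m i) (q : κ) :
    (blockDiagonal' M * W) ⟨i, a⟩ q = (M i *ᵥ fun b => W ⟨i, b⟩ q) a :=
  blockDiagonal'_mulVec_apply M (fun p => W p q) i a

theorem mul_blockDiagonal'_apply (W : Matrix κ (Σ i, m i) α) (M : ∀ i, Matrix (m i) (m i) α)
    (p : κ) (j : ι) (b : m j) :
    (W * blockDiagonal' M) p ⟨j, b⟩ = ((fun a => W p ⟨j, a⟩) ᵥ* M j) b := by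
  rw [mul_apply, Fintype.sum_sigma, Finset.sum_eq_single_of_mem j (Finset.mem_univ j)]
  · simp only [blockDiagonal'_apply_eq, vecMul, dotProduct]
  · exact fun k _ hk => Finset.sum_eq_zero fun b _ => by
      rw [blockDiagonal'_apply_ne _ _ _ hk, mul_zero]

end

theorem normalForm_mul_apply (hn : ∀ j, 1 ≤ n j) (t : Fin s → ℕ → ℂ)
    (W : Matrix (BlockIndex n) (BlockIndex n) FormalSeries) (i : Fin s) (a : Fin (n i))
    (q : BlockIndex n) :
    (n i : FormalSeries) * x * (normalForm r n t * W) ⟨i, a⟩ q =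
      ∑ J ∈ Finset.range (r * n i + 1), HahnSeries.C (t i J) *
        rowExt (hn i) (fun a => W ⟨i, a⟩ q) ((a : ℕ) - (J : ℕ)) - (a : ℕ) * W ⟨i, a⟩ q := by
  rw [← normalBlock_mulVec (hn i)]
  rw [normalForm, blockDiagonal'_mul_apply]

theorem mul_normalForm_apply {ι : Type*} (hn : ∀ j, 1 ≤ n j) (t : Fin s → ℕ → ℂ)
    (W : Matrix ι (BlockIndex n) FormalSeries) (p : ι) (j : Fin s) (b : Fin (n j)) :
    (n j : FormalSeries) * x * (W * normalForm r n t) p ⟨j, b⟩ =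
      ∑ J ∈ Finset.range (r * n j + 1), HahnSeries.C (t j J) *
        colExt (hn j) (fun b => W p ⟨j, b⟩) ((b : ℕ) + (J : ℕ)) - (b : ℕ) * W p ⟨j, b⟩ := by
  rw [← vecMul_normalBlock (hn j) r (t j) (fun b => W p ⟨j, b⟩)]
  rw [normalForm, mul_blockDiagonal'_apply]

theorem xcoeff_rowExt {m : ℕ} (hm : 1 ≤ m) (y : Fin m → FormalSeries) (α k : ℤ) :
    xcoeff (rowExt hm y α) k = xcoeff (y (residue hm α)) (k + α / m) := by
  rw [rowExt, xcoeff_zpow_mul, sub_neg_eq_add]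

theorem xcoeff_colExt {m : ℕ} (hm : 1 ≤ m) (y : Fin m → FormalSeries) (β k : ℤ) :
    xcoeff (colExt hm y β) k = xcoeff (y (residue hm β)) (k - β / m) := by
  rw [colExt, xcoeff_zpow_mul]

/-- The coefficients `F α β` of the `(i, j)` block of `W` in the bases `e_α` (`α ∈ ℤ`) of the two
blocks, which extend the standard bases by `e_{α + n i} = x e_α`. -/
def blockCoeff (hn : ∀ j, 1 ≤ n j) (W : Matrix (BlockIndex n) (BlockIndex n) FormalSeries)
    (i j : Fin s) (α β : ℤ) : ℂ :=
  xcoeff (W ⟨i, residue (hn i) α⟩ ⟨j, residue (hn j) β⟩) (α / n i - β / n j)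

section BlockCoeff

variable (hn : ∀ j, 1 ≤ n j) (W : Matrix (BlockIndex n) (BlockIndex n) FormalSeries) (i j : Fin s)

theorem blockCoeff_apply (a : Fin (n i)) (b : Fin (n j)) (k : ℤ) :
    blockCoeff hn W i j ((a : ℕ) + n i * k) (b : ℕ) = xcoeff (W ⟨i, a⟩ ⟨j, b⟩) k := by
  have hi := hn i
  rw [blockCoeff, residue_add_mul, residue_natCast, residue_natCast,
    Int.add_mul_ediv_left _ _ (by lia), Int.ediv_eq_zero_of_lt (by lia) (by have := a.2; lia),
    Int.ediv_eq_zero_of_lt (by lia) (by have := b.2; lia), zero_add, sub_zero]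

theorem blockCoeff_add_left (α β k : ℤ) :
    blockCoeff hn W i j (α + n i * k) β =
      xcoeff (W ⟨i, residue (hn i) α⟩ ⟨j, residue (hn j) β⟩) (α / n i + k - β / n j) := by
  have hi := hn i
  rw [blockCoeff, residue_add_mul, Int.add_mul_ediv_left _ _ (by lia)]

theorem blockCoeff_add_right (α β k : ℤ) :
    blockCoeff hn W i j α (β + n j * k) =
      xcoeff (W ⟨i, residue (hn i) α⟩ ⟨j, residue (hn j) β⟩) (α / n i - (β / n j + k)) := by
  have hj := hn j
  rw [blockCoeff, residue_add_mul, Int.add_mul_ediv_left _ _ (by lia)]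

theorem blockCoeff_periodic (α β : ℤ) :
    blockCoeff hn W i j (α + n i) (β + n j) = blockCoeff hn W i j α β := by
  have hi := blockCoeff_add_left hn W i j α (β + n j * 1) 1
  have hj := hn j
  rw [residue_add_mul, Int.add_mul_ediv_left _ _ (by lia), add_sub_add_right_eq_sub, mul_one,
    mul_one] at hi
  exact hi

theorem xcoeff_rowExt_residue (α β : ℤ) (J : ℕ) :
    xcoeff (rowExt (hn i) (fun a => W ⟨i, a⟩ ⟨j, residue (hn j) β⟩)
        ((residue (hn i) α : ℕ) - (J : ℕ))) (α / n i - β / n j) =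
      blockCoeff hn W i j (α - J) β := by
  have hα : α - J = ((residue (hn i) α : ℕ) - (J : ℕ)) + n i * (α / n i) := by
    linarith [residue_add_ediv (hn i) α]
  rw [hα, blockCoeff_add_left, xcoeff_rowExt]
  congr 1
  ring

theorem xcoeff_colExt_residue (α β : ℤ) (J : ℕ) :
    xcoeff (colExt (hn j) (fun b => W ⟨i, residue (hn i) α⟩ ⟨j, b⟩)
        ((residue (hn j) β : ℕ) + (J : ℕ))) (α / n i - β / n j) =
      blockCoeff hn W i j α (β + J) := by
  have hβ : β + J = ((residue (hn j) β : ℕ) + (J : ℕ)) + n j * (β / n j) := by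
    linarith [residue_add_ediv (hn j) β]
  rw [hβ, blockCoeff_add_right, xcoeff_colExt]
  congr 1
  ring

variable {hn W}

theorem blockCoeff_eq_zero (hpos : ∀ k : ℤ, 0 < k → coeffMatrix W k = 0) {α β : ℤ}
    (h : (n i * n j : ℤ) < α * n j - β * n i) : blockCoeff hn W i j α β = 0 := by
  refine congrFun (congrFun (hpos (α / n i - β / n j) ?_) _) _
  have hi : (0 : ℤ) < n i := by exact_mod_cast hn i
  have hj : (0 : ℤ) < n j := by exact_mod_cast hn j
  have hα : α < (α / n i + 1) * n i := Int.lt_ediv_add_one_mul_self α hi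
  have hβ : n j * (β / n j) ≤ β := Int.mul_ediv_self_le hj.ne'
  by_contra! hle
  nlinarith [mul_pos hi hj, mul_lt_mul_of_pos_right hα hj, mul_le_mul_of_nonneg_right hβ hi.le]

theorem blockCoeff_eqn {t t' : Fin s → ℕ → ℂ}
    (heq : normalForm r n t * W - W.map ddx = W * normalForm r n t') (α β : ℤ) :
    (n j : ℂ) * ∑ J ∈ Finset.range (r * n i + 1), t i J * blockCoeff hn W i j (α - J) β -
        (n i : ℂ) * ∑ J ∈ Finset.range (r * n j + 1), t' j J * blockCoeff hn W i j α (β + J) =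
      ((α : ℂ) * n j - β * n i) * blockCoeff hn W i j α β := by
  obtain ⟨a, ha⟩ : ∃ a, a = residue (hn i) α := ⟨_, rfl⟩
  obtain ⟨b, hb⟩ : ∃ b, b = residue (hn j) β := ⟨_, rfl⟩
  have entry := congrFun (congrFun heq ⟨i, a⟩) ⟨j, b⟩
  rw [Matrix.sub_apply, map_apply] at entry
  have series : (n j : FormalSeries) * (∑ J ∈ Finset.range (r * n i + 1), HahnSeries.C (t i J) *
      rowExt (hn i) (fun a => W ⟨i, a⟩ ⟨j, b⟩) ((a : ℕ) - (J : ℕ)) - (a : ℕ) * W ⟨i, a⟩ ⟨j, b⟩)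
      - (n i : FormalSeries) * ((n j : FormalSeries) * (x * ddx (W ⟨i, a⟩ ⟨j, b⟩))) =
      (n i : FormalSeries) * (∑ J ∈ Finset.range (r * n j + 1), HahnSeries.C (t' j J) *
      colExt (hn j) (fun b => W ⟨i, a⟩ ⟨j, b⟩) ((b : ℕ) + (J : ℕ)) -
        (b : ℕ) * W ⟨i, a⟩ ⟨j, b⟩) := by
    rw [← normalForm_mul_apply, ← mul_normalForm_apply, ← entry]
    ring
  have coeffs := congrArg (fun f => xcoeff f (α / n i - β / n j)) series
  have hW : xcoeff (W ⟨i, a⟩ ⟨j, b⟩) (α / n i - β / n j) = blockCoeff hn W i j α β := by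
    rw [ha, hb, blockCoeff]
  simp only [xcoeff_sub, xcoeff_natCast_mul, xcoeff_sum, xcoeff_C_mul, xcoeff_x_mul_ddx,
    hW] at coeffs
  simp only [ha, hb, xcoeff_rowExt_residue, xcoeff_colExt_residue] at coeffs
  have hα : (α : ℂ) = (residue (hn i) α : ℕ) + n i * ((α / n i : ℤ) : ℂ) := by
    exact_mod_cast (residue_add_ediv (hn i) α).symm
  have hβ : (β : ℂ) = (residue (hn j) β : ℕ) + n j * ((β / n j : ℤ) : ℂ) := by
    exact_mod_cast (residue_add_ediv (hn j) β).symm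
  push_cast at coeffs
  linear_combination coeffs - n j * blockCoeff hn W i j α β * hα +
    n i * blockCoeff hn W i j α β * hβ

theorem isIntertwiner_blockCoeff {t t' : Fin s → ℕ → ℂ}
    (hpos : ∀ k : ℤ, 0 < k → coeffMatrix W k = 0)
    (heq : normalForm r n t * W - W.map ddx = W * normalForm r n t') :
    IsIntertwiner r (n i) (n j) (t i) (t' j) (blockCoeff hn W i j) where
  periodic := blockCoeff_periodic hn W i j
  bounded := ⟨n i * n j, fun _ _ => blockCoeff_eq_zero i j hpos⟩
  eqn := blockCoeff_eqn i j heq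

end BlockCoeff

end Gauge

/-! ### Automorphisms of ramified normal forms -/

section Automorphism

open FormalSeries Matrix

variable {s r : ℕ} {n : Fin s → ℕ} {lam : Fin s → ℂ}

/-- The parameters of a normal form with eigenvalues `lam` in which every block of size at least
two is maximally ramified, so that it remains indecomposable over `ℂ((x⁻¹))`. -/
structure IsRamified (r : ℕ) (n : Fin s → ℕ) (lam : Fin s → ℂ) (t : Fin s → ℕ → ℂ) : Prop where
  leading : ∀ j, t j (r * n j) = n j * lam j
  ne_zero : ∀ j, 2 ≤ n j → t j (r * n j - 1) ≠ 0

/-- Ramified parameters in which no two blocks are equivalent. The case `r * n j = 1` is apart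
because the subleading parameter is then the residue, which matters only modulo `ℤ`. -/
structure IsNonresonant (r : ℕ) (n : Fin s → ℕ) (lam : Fin s → ℂ) (t : Fin s → ℕ → ℂ) : Prop
    extends IsRamified r n lam t where
  eq_of_int : ∀ i j, lam i = lam j → n i = n j → r * n j = 1 →
    ∀ k : ℤ, t i 0 - t j 0 = k → i = j
  eq_of_pow : ∀ i j, lam i = lam j → n i = n j → r * n j ≠ 1 →
    t i (r * n j - 1) ^ n j = t j (r * n j - 1) ^ n j → i = j

variable {t t' : Fin s → ℕ → ℂ} {i i' j : Fin s} {F F' : ℤ → ℤ → ℂ}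

theorem IsRamified.eq_of_intertwiner (ht : IsRamified r n lam t) (ht' : IsRamified r n lam t')
    (hr : 1 ≤ r) (hn : ∀ j, 1 ≤ n j) (hF : IsIntertwiner r (n i) (n j) (t i) (t' j) F)
    (h0 : ∃ α β, F α β ≠ 0) : lam i = lam j ∧ n i = n j := by
  have hlam : lam i = lam j :=
    hF.eigenvalue_eq hr (hn i) (hn j) (ht.leading i) (ht'.leading j) h0
  have hj := ht'.leading j
  rw [← hlam] at hj
  exact ⟨hlam, le_antisymm
    (hF.size_le hr (hn j) (ht.leading i) hj (ht.ne_zero i) h0)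
    (hF.le_size hr (hn i) (ht.leading i) hj (ht'.ne_zero j) h0)⟩

theorem IsRamified.eq_monomial (ht : IsRamified r n lam t) (ht' : IsRamified r n lam t')
    (hr : 1 ≤ r) (hn : ∀ j, 1 ≤ n j) (hF : IsIntertwiner r (n i) (n j) (t i) (t' j) F)
    (h0 : ∃ α β, F α β ≠ 0) :
    ∃ (ζ c : ℂ) (δ : ℤ), ζ ^ n j = 1 ∧ c ≠ 0 ∧
      (∀ α (β : ℕ), F α β = if α - β = δ then c * ζ ^ β else 0) ∧
      (∀ J, 1 ≤ J → J ≤ r * n j → t i J = ζ ^ J * t' j J) ∧ t i 0 - t' j 0 = δ := by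
  obtain ⟨hlam, hsize⟩ := ht.eq_of_intertwiner ht' hr hn hF h0
  have hi := ht.leading i
  have hi1 := ht.ne_zero i
  rw [hsize] at hF hi hi1
  rw [hlam] at hi
  exact hF.eq_monomial hr (hn j) hi (ht'.leading j) hi1 h0

theorem IsNonresonant.eq_of_intertwiners (ht : IsNonresonant r n lam t)
    (ht' : IsRamified r n lam t') (hr : 1 ≤ r) (hn : ∀ j, 1 ≤ n j)
    (hF : IsIntertwiner r (n i) (n j) (t i) (t' j) F) (h0 : ∃ α β, F α β ≠ 0)
    (hF' : IsIntertwiner r (n i') (n j) (t i') (t' j) F') (h0' : ∃ α β, F' α β ≠ 0) : i = i' := by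
  obtain ⟨hlam, hsize⟩ := ht.eq_of_intertwiner ht' hr hn hF h0
  obtain ⟨hlam', hsize'⟩ := ht.eq_of_intertwiner ht' hr hn hF' h0'
  obtain ⟨ζ, -, δ, hζ, -, -, hpos, hzero⟩ := ht.eq_monomial ht' hr hn hF h0
  obtain ⟨ζ', -, δ', hζ', -, -, hpos', hzero'⟩ := ht.eq_monomial ht' hr hn hF' h0'
  have hl := hlam.trans hlam'.symm
  have hs := hsize.trans hsize'.symm
  have h1 : 1 ≤ r * n j := Nat.mul_pos hr (hn j)
  by_cases hrn : r * n j = 1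
  · refine ht.eq_of_int i i' hl hs (hsize'.symm ▸ hrn) (δ - δ') ?_
    rw [Int.cast_sub, ← hzero, ← hzero', sub_sub_sub_cancel_right]
  · refine ht.eq_of_pow i i' hl hs (hsize'.symm ▸ hrn) ?_
    have root_pow {ξ : ℂ} (hξ : ξ ^ n j = 1) (k : ℕ) : (ξ ^ k) ^ n j = 1 := by
      rw [pow_right_comm, hξ, one_pow]
    rw [hsize', hpos _ (by lia) (by lia), hpos' _ (by lia) (by lia), mul_pow, mul_pow,
      root_pow hζ, root_pow hζ']

section Gauge

variable (hn : ∀ j, 1 ≤ n j) {W : Matrix (BlockIndex n) (BlockIndex n) FormalSeries}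

theorem blockCoeff_eq_coeffMatrix (a : Fin (n i)) (b : Fin (n j)) :
    blockCoeff hn W i j (a : ℕ) (b : ℕ) = coeffMatrix W 0 ⟨i, a⟩ ⟨j, b⟩ := by
  have := blockCoeff_apply hn W i j a b 0
  rwa [mul_zero, add_zero] at this

theorem IsFormalGauge.exists_blockCoeff_ne_zero (hW : IsFormalGauge W) (j : Fin s) :
    ∃ i, ∃ a : Fin (n i), blockCoeff hn W i j (a : ℕ) 0 ≠ 0 := by
  by_contra! h
  refine hW.2 (det_eq_zero_of_column_eq_zero ⟨j, ⟨0, hn j⟩⟩ ?_)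
  rintro ⟨i, a⟩
  rw [← blockCoeff_eq_coeffMatrix hn]
  exact h i a

variable {hn}

theorem offset_eq_zero (hpos : ∀ k : ℤ, 0 < k → coeffMatrix W k = 0) (hsize : n i = n j)
    {ζ c : ℂ} {δ : ℤ} (hζ : ζ ^ n j = 1) (hc : c ≠ 0)
    (hcoeff : ∀ α (β : ℕ), blockCoeff hn W i j α β = if α - β = δ then c * ζ ^ β else 0)
    {a : Fin (n i)} (ha : blockCoeff hn W i j (a : ℕ) 0 ≠ 0) : δ = 0 := by
  have hnj := hn j
  have hδ : ((a : ℕ) : ℤ) = δ := by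
    by_contra h
    exact ha ((hcoeff (a : ℕ) 0).trans (if_neg (by rwa [Nat.cast_zero, sub_zero])))
  refine le_antisymm (not_lt.mp fun hlt => ?_) (by lia)
  have hlast : blockCoeff hn W i j ((n j - 1 : ℕ) + δ) (n j - 1 : ℕ) ≠ 0 := by
    rw [hcoeff, if_pos (by ring)]
    exact mul_ne_zero hc (pow_ne_zero _ (IsUnit.of_pow_eq_one hζ (by lia)).ne_zero)
  have hquot : 1 ≤ (((n j - 1 : ℕ) : ℤ) + δ) / n i := by
    rw [Int.le_ediv_iff_mul_le (by lia)]
    lia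
  refine hlast (congrFun (congrFun (hpos _ ?_) _) _)
  rw [Int.ediv_eq_zero_of_lt (b := n j) (by lia) (by lia), sub_zero]
  exact hquot

theorem exists_monomial_blocks (hr : 1 ≤ r) (hW : IsFormalGauge W)
    (heq : normalForm r n t * W - W.map ddx = W * normalForm r n t')
    (ht : IsNonresonant r n lam t) (ht' : IsRamified r n lam t') :
    ∃ (σ : Fin s → Fin s) (ζ c : Fin s → ℂ),
      (∀ j, n (σ j) = n j ∧ lam (σ j) = lam j ∧ ζ j ^ n j = 1 ∧ c j ≠ 0) ∧
      (∀ j, ∀ J ≤ r * n j, t (σ j) J = ζ j ^ J * t' j J) ∧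
      ∀ i j α (β : ℕ),
        blockCoeff hn W i j α β = if i = σ j ∧ α = β then c j * ζ j ^ β else 0 := by
  have hF := fun i j => isIntertwiner_blockCoeff (hn := hn) i j hW.1 heq
  choose σ a ha using hW.exists_blockCoeff_ne_zero hn
  have hex : ∀ j, ∃ α β, blockCoeff hn W (σ j) j α β ≠ 0 := fun j => ⟨_, _, ha j⟩
  have hblock := fun j => ht.eq_of_intertwiner ht' hr hn (hF (σ j) j) (hex j)
  choose ζ c δ hζ hc hcoeff hpos hzero using fun j =>
    ht.eq_monomial ht' hr hn (hF (σ j) j) (hex j)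
  have hδ : ∀ j, δ j = 0 := fun j =>
    offset_eq_zero hW.1 (hblock j).2 (hζ j) (hc j) (hcoeff j) (ha j)
  refine ⟨σ, ζ, c, fun j => ⟨(hblock j).2, (hblock j).1, hζ j, hc j⟩, fun j J hJ => ?_,
    fun i j α β => ?_⟩
  · rcases Nat.eq_zero_or_pos J with rfl | hJ0
    · rw [pow_zero, one_mul, ← sub_eq_zero, hzero, hδ, Int.cast_zero]
    · exact hpos j J hJ0 hJ
  · by_cases h : i = σ j
    · subst h
      simp only [hcoeff, hδ, sub_eq_zero, true_and]
    · rw [if_neg fun h' => h h'.1]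
      by_contra h0
      exact h (ht.eq_of_intertwiners ht' hr hn (hF i j) ⟨_, _, h0⟩ (hF (σ j) j) (hex j))

section

variable {σ : Fin s → Fin s} {ζ c : Fin s → ℂ}
  (hcoeff : ∀ i j α (β : ℕ),
    blockCoeff hn W i j α β = if i = σ j ∧ α = β then c j * ζ j ^ β else 0)

include hcoeff

theorem IsFormalGauge.surjective_of_monomial (hW : IsFormalGauge W) :
    Function.Surjective σ := by
  intro i
  by_contra! hi
  refine hW.2 (det_eq_zero_of_row_eq_zero ⟨i, ⟨0, hn i⟩⟩ ?_)
  rintro ⟨j, b⟩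
  rw [← blockCoeff_eq_coeffMatrix hn, hcoeff, if_neg fun h => hi j h.1.symm]

theorem apply_eq_of_monomial (hsize : ∀ j, n (σ j) = n j) (a : Fin (n i)) (b : Fin (n j)) :
    W ⟨i, a⟩ ⟨j, b⟩ =
      if i = σ j ∧ (a : ℕ) = b then HahnSeries.C (c j * ζ j ^ (b : ℕ)) else 0 := by
  refine xcoeff_ext fun k => ?_
  rw [← blockCoeff_apply hn, hcoeff]
  by_cases h : i = σ j
  · have hs : n i = n j := h ▸ hsize j
    have hk : ((a : ℕ) : ℤ) + n i * k = (b : ℕ) ↔ k = 0 ∧ (a : ℕ) = b := by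
      constructor
      · intro hab
        have : |(n i : ℤ) * k| < n i * 1 := by
          rw [abs_lt, show (n i : ℤ) * k = (b : ℕ) - (a : ℕ) by linarith]
          have := a.2
          have := b.2
          omega
        have hni := hn i
        rw [abs_mul, Nat.abs_cast, mul_lt_mul_iff_right₀ (by lia), Int.abs_lt_one_iff] at this
        subst this
        exact ⟨rfl, by simpa using hab⟩
      · rintro ⟨rfl, hab⟩
        lia
    simp only [hk, eq_true h, true_and]
    by_cases hab : (a : ℕ) = b
    · simp only [hab, and_true, if_true, xcoeff, HahnSeries.C_apply, HahnSeries.coeff_single,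
        neg_eq_zero]
    · rw [if_neg fun h' => hab h'.2, if_neg hab, xcoeff_zero]
  · rw [if_neg fun h' => h h'.1, if_neg fun h' => h h'.1, xcoeff_zero]

end

theorem exists_eq_monomialMatrix (hn : ∀ j, 1 ≤ n j) (hr : 1 ≤ r) (hW : IsFormalGauge W)
    (heq : normalForm r n t * W - W.map ddx = W * normalForm r n t')
    (ht : IsNonresonant r n lam t) (ht' : IsRamified r n lam t') :
    ∃ (σ : Equiv.Perm (Fin s)) (ζ c : Fin s → ℂ),
      (∀ j, n (σ j) = n j ∧ lam (σ j) = lam j ∧ ζ j ^ n j = 1 ∧ c j ≠ 0) ∧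
      (∀ j, ∀ J ≤ r * n j, t (σ j) J = ζ j ^ J * t' j J) ∧ W = monomialMatrix n σ ζ c := by
  obtain ⟨σ, ζ, c, hσ, hts, hcoeff⟩ := exists_monomial_blocks (hn := hn) hr hW heq ht ht'
  refine ⟨Equiv.ofBijective σ (Finite.surjective_iff_bijective.mp
    (hW.surjective_of_monomial hcoeff)), ζ, c, hσ, hts, Matrix.ext ?_⟩
  rintro ⟨i, a⟩ ⟨j, b⟩
  exact apply_eq_of_monomial hcoeff (fun j => (hσ j).1) a b

end Gauge

end Automorphism

/-! ### Uniqueness -/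

section Uniqueness

open FormalSeries Matrix

theorem card_le_card_of_det_ne_zero {K ι : Type*} [Field K] [Fintype ι] [DecidableEq ι]
    {M : Matrix ι ι K} (hM : M.det ≠ 0) {S T : Finset ι}
    (h : ∀ q ∈ T, ∀ p, M p q ≠ 0 → p ∈ S) : T.card ≤ S.card := by
  classical
  have hli : LinearIndependent K fun q : T => M.col q :=
    (linearIndependent_cols_of_det_ne_zero hM).comp _ Subtype.val_injective
  have hspan : Set.range (fun q : T => M.col q) ≤
      Submodule.span K (S.image fun p => Pi.single (M := fun _ : ι => K) p 1 : Set (ι → K)) := by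
    rintro _ ⟨⟨q, hq⟩, rfl⟩
    change M.col q ∈ Submodule.span K _
    rw [pi_eq_sum_univ' (M.col q)]
    refine Submodule.sum_mem _ fun p _ => ?_
    by_cases hp : M p q = 0
    · simp only [col_apply, hp, zero_smul, Submodule.zero_mem]
    · refine Submodule.smul_mem _ _ (Submodule.subset_span ?_)
      rw [Finset.coe_image]
      exact ⟨p, h q hq p hp, by ext; simp [Pi.single_apply]⟩
  calc T.card = Fintype.card T := (Fintype.card_coe T).symm
    _ ≤ (S.image fun p => Pi.single (M := fun _ : ι => K) p 1).card := by
        simpa only [Finset.coe_sort_coe, Fintype.card_coe] using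
          linearIndependent_le_span_aux' _ hli _ hspan
    _ ≤ S.card := Finset.card_image_le

namespace FormalSeries

theorem exists_zpow_mul_ofPowerSeries {f : FormalSeries} {K : ℤ}
    (hf : ∀ k : ℤ, K < k → xcoeff f k = 0) :
    ∃ g : PowerSeries ℂ, f = x ^ K * HahnSeries.ofPowerSeries ℤ ℂ g := by
  obtain ⟨g, hg⟩ := exists_ofPowerSeries (f := x ^ (-K) * f) fun k hk => by
    rw [xcoeff_zpow_mul]
    exact hf _ (by lia)
  refine ⟨g, ?_⟩
  rw [← hg, ← mul_assoc, ← zpow_add₀ x_ne_zero, add_neg_cancel, zpow_zero, one_mul]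

theorem xcoeff_zpow_mul_ofPowerSeries (K : ℤ) (g : PowerSeries ℂ) :
    xcoeff (x ^ K * HahnSeries.ofPowerSeries ℤ ℂ g) K = PowerSeries.constantCoeff g := by
  simpa [xcoeff_zpow_mul] using xcoeff_ofPowerSeries g 0

theorem xcoeff_mul_leading {f g : FormalSeries} {K : ℤ} (hf : ∀ k : ℤ, K < k → xcoeff f k = 0)
    (hg : ∀ k : ℤ, 0 < k → xcoeff g k = 0) : xcoeff (f * g) K = xcoeff f K * xcoeff g 0 := by
  obtain ⟨f', rfl⟩ := exists_zpow_mul_ofPowerSeries hf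
  obtain ⟨g', rfl⟩ := exists_ofPowerSeries hg
  have hg0 := xcoeff_zpow_mul_ofPowerSeries 0 g'
  rw [zpow_zero, one_mul] at hg0
  rw [mul_assoc, ← map_mul, xcoeff_zpow_mul_ofPowerSeries, xcoeff_zpow_mul_ofPowerSeries, hg0,
    map_mul]

end FormalSeries

variable {s r : ℕ} {n : Fin s → ℕ} {lam : Fin s → ℂ}

section Jordan

theorem jordanCell_mulVec {m : ℕ} (c : ℂ) (v : Fin m → ℂ) (a : Fin m) :
    (jordanCell c m *ᵥ v) a =
      c * v a + if h : (a : ℕ) + 1 < m then v ⟨a + 1, h⟩ else 0 := by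
  have hsum : (jordanCell c m *ᵥ v) a =
      ∑ b : Fin m, ((if a = b then c * v b else 0) + if (b : ℕ) = a + 1 then v b else 0) := by
    rw [mulVec, dotProduct]
    refine Finset.sum_congr rfl fun b _ => ?_
    rw [jordanCell, of_apply]
    split_ifs with h1 h2 <;> first | (subst h1; lia) | ring
  rw [hsum, Finset.sum_add_distrib, Finset.sum_ite_eq, if_pos (Finset.mem_univ a)]
  congr 1
  split_ifs with h
  · rw [Finset.sum_eq_single_of_mem ⟨a + 1, h⟩ (Finset.mem_univ _)
      fun b _ hb => if_neg fun hab => hb (Fin.ext hab), if_pos rfl]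
  · exact Finset.sum_eq_zero fun b _ => if_neg fun hab => h (by rw [← hab]; exact b.2)

theorem jordan_mulVec (v : BlockIndex n → ℂ) (i : Fin s) (a : Fin (n i)) :
    (blockDiagonal' (fun j => jordanCell (lam j) (n j)) *ᵥ v) ⟨i, a⟩ =
      lam i * v ⟨i, a⟩ + if h : (a : ℕ) + 1 < n i then v ⟨i, ⟨a + 1, h⟩⟩ else 0 := by
  rw [blockDiagonal'_mulVec_apply, jordanCell_mulVec]

theorem eq_zero_of_shift_eq_mul {K : Type*} [MulZeroClass K] [NoZeroDivisors K] {m : ℕ}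
    {w : Fin m → K} {γ : K} (hγ : γ ≠ 0)
    (h : ∀ a : Fin m, (if h : (a : ℕ) + 1 < m then w ⟨a + 1, h⟩ else 0) = γ * w a)
    (a : Fin m) : w a = 0 := by
  have vanish (k : ℕ) : ∀ b : Fin m, m - b ≤ k → w b = 0 := by
    induction k with
    | zero =>
      intro b hb
      have := b.2
      lia
    | succ k ih =>
      intro b hb
      have e := h b
      rw [dite_eq_right_iff.mpr fun _ => ih _ (by simp only; lia)] at e
      exact (mul_eq_zero.mp e.symm).resolve_left hγ
  exact vanish _ a le_rfl

theorem jordan_eigenvector_support {v : BlockIndex n → ℂ} {c : ℂ}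
    (h : blockDiagonal' (fun j => jordanCell (lam j) (n j)) *ᵥ v = c • v)
    {i : Fin s} {a : Fin (n i)} (hv : v ⟨i, a⟩ ≠ 0) : lam i = c ∧ (a : ℕ) = 0 := by
  have entry (b : Fin (n i)) :
      (if h : (b : ℕ) + 1 < n i then v ⟨i, ⟨b + 1, h⟩⟩ else 0) = (c - lam i) * v ⟨i, b⟩ := by
    have := congrFun h ⟨i, b⟩
    rw [jordan_mulVec, Pi.smul_apply, smul_eq_mul] at this
    linear_combination this
  have hlam : lam i = c := by
    by_contra hc
    exact hv (eq_zero_of_shift_eq_mul (w := fun b => v ⟨i, b⟩) (sub_ne_zero.mpr (Ne.symm hc))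
      entry a)
  refine ⟨hlam, ?_⟩
  obtain ⟨a, ha⟩ := a
  cases a with
  | zero => rfl
  | succ a =>
    have e := entry ⟨a, by lia⟩
    rw [hlam, sub_self, zero_mul, dif_pos ha] at e
    exact absurd e hv

end Jordan

variable {A Y Y' : Matrix (BlockIndex n) (BlockIndex n) FormalSeries} {t t' : Fin s → ℕ → ℂ}

theorem root_pow_mul_pow {m : ℕ} {ζ : ℂ} (hζ : ζ ^ m = 1) (J : ℕ) (z : ℂ) :
    (ζ ^ J * z) ^ m = z ^ m := by
  rw [mul_pow, pow_right_comm, hζ, one_pow, one_mul]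

section

variable {σ : Equiv.Perm (Fin s)} {ζ : Fin s → ℂ}
  (hσ : ∀ j, n (σ j) = n j ∧ lam (σ j) = lam j ∧ ζ j ^ n j = 1)
  (hts : ∀ j, ∀ J ≤ r * n j, t (σ j) J = ζ j ^ J * t' j J)

include hσ hts

theorem IsNonresonant.of_perm (hres : IsNonresonant r n lam t) (ht' : IsRamified r n lam t') :
    IsNonresonant r n lam t' where
  toIsRamified := ht'
  eq_of_int i j hl hs hrn k hk := by
    refine σ.injective (hres.eq_of_int (σ i) (σ j) ?_ ?_ ?_ k ?_)
    · rw [(hσ i).2.1, (hσ j).2.1, hl]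
    · rw [(hσ i).1, (hσ j).1, hs]
    · rw [(hσ j).1, hrn]
    · rw [hts i 0 (Nat.zero_le _), hts j 0 (Nat.zero_le _), pow_zero, pow_zero, one_mul, one_mul,
        hk]
  eq_of_pow i j hl hs hrn hp := by
    refine σ.injective (hres.eq_of_pow (σ i) (σ j) ?_ ?_ ?_ ?_)
    · rw [(hσ i).2.1, (hσ j).2.1, hl]
    · rw [(hσ i).1, (hσ j).1, hs]
    · rwa [(hσ j).1]
    · rw [(hσ j).1, hts i _ (by rw [hs]; lia), hts j _ (by lia),
        root_pow_mul_pow (hs ▸ (hσ i).2.2), root_pow_mul_pow (hσ j).2.2, hp]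

end

section

variable {σ : Equiv.Perm (Fin s)} {ζ : Fin s → ℂ}
  (hσ : ∀ j, n (σ j) = n j ∧ lam (σ j) = lam j ∧ ζ j ^ n j = 1)
  (hts : ∀ j, ∀ J ≤ r * n j, t (σ j) J = ζ j ^ J * t j J)

include hσ hts

theorem IsNonresonant.perm_eq_one (hres : IsNonresonant r n lam t) : σ = 1 := by
  ext j : 1
  rw [Equiv.Perm.one_apply]
  by_cases hrn : r * n j = 1
  · refine hres.eq_of_int _ _ (hσ j).2.1 (hσ j).1 hrn 0 ?_
    rw [hts j 0 (Nat.zero_le _), pow_zero, one_mul, sub_self, Int.cast_zero]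
  · refine hres.eq_of_pow _ _ (hσ j).2.1 (hσ j).1 hrn ?_
    rw [hts j _ (by lia), root_pow_mul_pow (hσ j).2.2]

theorem IsNonresonant.root_eq_one (hr : 1 ≤ r) (hn : ∀ j, 1 ≤ n j)
    (hres : IsNonresonant r n lam t) (j : Fin s) : ζ j = 1 := by
  have hroot := (hσ j).2.2
  rcases (hn j).eq_or_lt with hnj | hnj
  · rwa [← hnj, pow_one] at hroot
  · have e := hts j (r * n j - 1) (by lia)
    rw [hres.perm_eq_one hσ hts, Equiv.Perm.one_apply, eq_comm,
      mul_eq_right₀ (hres.ne_zero j hnj)] at e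
    have hrn : 1 ≤ r * n j := Nat.mul_pos hr (hn j)
    calc ζ j = ζ j ^ (r * n j - 1) * ζ j := by rw [e, one_mul]
      _ = ζ j ^ (r * n j) := by rw [← pow_succ, Nat.sub_add_cancel hrn]
      _ = 1 := by rw [mul_comm, pow_mul, hroot, one_pow]

end

theorem monomialMatrix_one (c : Fin s → ℂ) :
    monomialMatrix n 1 1 c = diagonal fun p => HahnSeries.C (c p.1) := by
  ext ⟨i, a⟩ ⟨j, b⟩ : 1
  simp only [monomialMatrix, of_apply, Equiv.Perm.one_apply, Pi.one_apply, one_pow, mul_one,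
    diagonal_apply]
  split_ifs with h1 h2 h2
  · rw [h1.1]
  · exact absurd (Sigma.ext h1.1 (by obtain ⟨rfl, h⟩ := h1; exact heq_of_eq (Fin.ext h))) h2
  · obtain ⟨rfl, rfl⟩ := h2
    exact absurd ⟨rfl, rfl⟩ h1
  · rfl

theorem IsNormalizingGauge.leading_eqn (hr : 1 ≤ r) (hn : ∀ j, 1 ≤ n j)
    (hdeg : ∀ k : ℤ, (r : ℤ) - 1 < k → coeffMatrix A k = 0)
    (h : IsNormalizingGauge r n lam A Y t) (p : BlockIndex n) (j : Fin s) (b : Fin (n j)) :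
    n j * (coeffMatrix A ((r : ℤ) - 1) * coeffMatrix Y 0) p ⟨j, b⟩ =
      ∑ J ∈ Finset.range (r * n j + 1), t j J *
        xcoeff (Y p ⟨j, residue (hn j) ((b : ℕ) + (J : ℕ))⟩)
          (r - ((b : ℕ) + (J : ℕ) : ℤ) / n j) := by
  have hY (p q) (k : ℤ) (hk : 0 < k) : xcoeff (Y p q) k = 0 :=
    congrFun (congrFun (h.1.1 k hk) p) q
  have series := mul_normalForm_apply (r := r) hn t Y p j b
  rw [← h.eqn, Matrix.sub_apply, map_apply, mul_assoc, mul_sub] at series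
  have coeffs := congrArg (fun f => xcoeff f r) series
  simp only [xcoeff_natCast_mul, xcoeff_sub, xcoeff_sum, xcoeff_C_mul, xcoeff_colExt,
    xcoeff_x_mul_ddx] at coeffs
  rw [hY p _ r (by lia), mul_zero, mul_zero, sub_zero, sub_zero, xcoeff_x_mul, mul_apply,
    xcoeff_sum] at coeffs
  rw [← coeffs, mul_apply]
  congr 1
  refine Finset.sum_congr rfl fun q _ => ?_
  rw [xcoeff_mul_leading (fun k hk => congrFun (congrFun (hdeg k hk) p) q) (hY q _)]
  rfl

-- Column `b` of `A_r Y_0` involves `t J` only for `J ≥ r * n j - b`, since `Y` has no positive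
-- powers of `x`.
theorem IsNormalizingGauge.leading_col (hr : 1 ≤ r) (hn : ∀ j, 1 ≤ n j)
    (hdeg : ∀ k : ℤ, (r : ℤ) - 1 < k → coeffMatrix A k = 0)
    (h : IsNormalizingGauge r n lam A Y t) {j : Fin s} {b : Fin (n j)}
    (ht : ∀ J, r * n j ≤ b + J → J < r * n j → t j J = 0) :
    coeffMatrix A ((r : ℤ) - 1) *ᵥ (coeffMatrix Y 0).col ⟨j, b⟩ =
      lam j • (coeffMatrix Y 0).col ⟨j, b⟩ := by
  funext p
  have hnj := hn j
  have := b.2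
  have hn0 : (n j : ℂ) ≠ 0 := Nat.cast_ne_zero.mpr (by lia)
  have e := h.leading_eqn hr hn hdeg p j b
  rw [sum_range_eq_last (Nat.succ_pos _) fun J hJ => ?_, Nat.succ_sub_one,
    show ((b : ℕ) : ℤ) + ((r * n j : ℕ) : ℤ) = (b : ℕ) + n j * r by push_cast; ring,
    residue_add_mul, residue_natCast, Int.add_mul_ediv_left _ _ (by lia),
    Int.ediv_eq_zero_of_lt (by lia) (by lia), zero_add, sub_self, h.2.1 j, mul_assoc] at e
  · exact mul_left_cancel₀ hn0 e
  · have hJ' : J < r * n j := Nat.lt_of_succ_lt_succ hJ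
    by_cases hbJ : r * n j ≤ b + J
    · rw [ht J hbJ hJ', zero_mul]
    · have : (((b : ℕ) + (J : ℕ) : ℤ)) / n j < r := by
        rw [Int.ediv_lt_iff_lt_mul (by lia)]
        exact_mod_cast not_le.mp hbJ
      rw [show xcoeff (Y p ⟨j, _⟩) _ = 0 from congrFun (congrFun (h.1.1 _ (by lia)) p) _, mul_zero]

section

variable (hr : 1 ≤ r) (hn : ∀ j, 1 ≤ n j)
  (hdeg : ∀ k : ℤ, (r : ℤ) - 1 < k → coeffMatrix A k = 0)
  (hlead : coeffMatrix A ((r : ℤ) - 1) = blockDiagonal' fun j => jordanCell (lam j) (n j))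

include hr hn hdeg hlead

-- Otherwise the second column of block `j` of `Y_0` is one more eigenvector of the Jordan matrix,
-- besides the first columns of the blocks with eigenvalue `lam j`.
theorem IsNormalizingGauge.isRamified (h : IsNormalizingGauge r n lam A Y t) :
    IsRamified r n lam t := by
  classical
  refine ⟨h.2.1, fun j hj h0 => ?_⟩
  let second : BlockIndex n := ⟨j, ⟨1, hj⟩⟩
  let S : Finset (BlockIndex n) := {p | lam p.1 = lam j ∧ (p.2 : ℕ) = 0}
  have hsecond : second ∉ S := by simp [S, second]
  have hcol : ∀ q ∈ insert second S, ∀ p, coeffMatrix Y 0 p q ≠ 0 → p ∈ S := by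
    rintro ⟨k, b⟩ hq ⟨i, a⟩ hp
    have hb : lam k = lam j ∧ ∀ J, r * n k ≤ b + J → J < r * n k → t k J = 0 := by
      rcases Finset.mem_insert.mp hq with hq | hq
      · obtain ⟨rfl, hb⟩ := Sigma.mk.inj_iff.mp hq
        obtain rfl := eq_of_heq hb
        refine ⟨rfl, fun J hJ hJ' => ?_⟩
        rwa [show J = r * n k - 1 by simp only at hJ; lia]
      · obtain ⟨hk, hb⟩ := (Finset.mem_filter.mp hq).2
        replace hb : (b : ℕ) = 0 := hb
        exact ⟨hk, fun J hJ hJ' => by lia⟩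
    have heig := h.leading_col hr hn hdeg hb.2
    rw [hlead, hb.1] at heig
    exact Finset.mem_filter.mpr ⟨Finset.mem_univ _, jordan_eigenvector_support heig hp⟩
  have := card_le_card_of_det_ne_zero h.1.2 hcol
  rw [Finset.card_insert_of_notMem hsecond] at this
  lia

theorem IsNormalizingGauge.exists_monomialMatrix (h : IsNormalizingGauge r n lam A Y t)
    (hres : IsNonresonant r n lam t) (h' : IsNormalizingGauge r n lam A Y' t') :
    ∃ (σ : Equiv.Perm (Fin s)) (ζ c : Fin s → ℂ),
      (∀ j, n (σ j) = n j ∧ lam (σ j) = lam j ∧ ζ j ^ n j = 1 ∧ c j ≠ 0) ∧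
      (∀ j, ∀ J ≤ r * n j, t (σ j) J = ζ j ^ J * t' j J) ∧ Y' = Y * monomialMatrix n σ ζ c := by
  obtain ⟨σ, ζ, c, hσ, hts, hW⟩ := exists_eq_monomialMatrix hn hr (h.1.inv_mul h'.1)
    (h.intertwine h') hres (h'.isRamified hr hn hdeg hlead)
  refine ⟨σ, ζ, c, hσ, hts, ?_⟩
  rw [← hW, mul_nonsing_inv_cancel_left _ _ h.1.isUnit_det]

theorem IsNormalizingGauge.isNonresonant (h : IsNormalizingGauge r n lam A Y t)
    (hres : IsNonresonant r n lam t) (h' : IsNormalizingGauge r n lam A Y' t') :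
    IsNonresonant r n lam t' := by
  obtain ⟨σ, ζ, c, hσ, hts, -⟩ := h.exists_monomialMatrix hr hn hdeg hlead hres h'
  exact hres.of_perm (fun j => ⟨(hσ j).1, (hσ j).2.1, (hσ j).2.2.1⟩) hts
    (h'.isRamified hr hn hdeg hlead)

theorem IsNormalizingGauge.exists_diagonal (h : IsNormalizingGauge r n lam A Y t)
    (hres : IsNonresonant r n lam t) (h' : IsNormalizingGauge r n lam A Y' t) :
    ∃ c : Fin s → ℂ, (∀ j, c j ≠ 0) ∧ Y' = Y * diagonal fun p => HahnSeries.C (c p.1) := by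
  obtain ⟨σ, ζ, c, hσ, hts, hY'⟩ := h.exists_monomialMatrix hr hn hdeg hlead hres h'
  have hσ' : ∀ j, n (σ j) = n j ∧ lam (σ j) = lam j ∧ ζ j ^ n j = 1 :=
    fun j => ⟨(hσ j).1, (hσ j).2.1, (hσ j).2.2.1⟩
  obtain rfl : ζ = 1 := funext (hres.root_eq_one hσ' hts hr hn)
  obtain rfl : σ = 1 := hres.perm_eq_one hσ' hts
  exact ⟨c, fun j => (hσ j).2.2.2, hY'.trans (by rw [monomialMatrix_one])⟩

end

end Uniqueness

/-! ### The leading equations of a ramified eigenvector -/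

section LinearEquations

open Matrix

theorem exists_mulVec_sub_smul_eq {K ι : Type*} [Field K] [Fintype ι] {M : Matrix ι ι K}
    {v w₀ : ι → K} (h : ∀ (w : ι → K) (b : K), M *ᵥ w = b • v → b = 0 ∧ ∃ β : K, w = β • w₀)
    (R : ι → K) : ∃ (a : ι → K) (b : K), M *ᵥ a - b • v = R := by
  let T := M.mulVecLin.coprod (-LinearMap.toSpanSingleton K (ι → K) v)
  have hT (w : ι → K) (b : K) : T (w, b) = M *ᵥ w - b • v := by
    simp [T, sub_eq_add_neg]
  have hker : LinearMap.ker T ≤ K ∙ ((w₀, 0) : (ι → K) × K) := by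
    rintro ⟨w, b⟩ hwb
    rw [LinearMap.mem_ker, hT, sub_eq_zero] at hwb
    obtain ⟨rfl, β, rfl⟩ := h w b hwb
    exact Submodule.mem_span_singleton.mpr ⟨β, by simp⟩
  have hsurj : Function.Surjective T := by
    rw [← LinearMap.range_eq_top]
    apply Submodule.eq_top_of_finrank_eq
    have rank_nullity := LinearMap.finrank_range_add_finrank_ker T
    have hle := (Submodule.finrank_mono hker).trans (finrank_span_le_card _)
    have := Submodule.finrank_le (LinearMap.range T)
    rw [Module.finrank_prod, Module.finrank_self] at rank_nullity
    rw [Set.toFinset_singleton, Finset.card_singleton] at hle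
    lia
  obtain ⟨⟨a, b⟩, hab⟩ := hsurj R
  exact ⟨a, b, (hT a b).symm.trans hab⟩

variable {s : ℕ} {n : Fin s → ℕ}

/-- The order in `z = x ^ (-1 / n j)` of the `p`-th coordinate of the formal eigenvector attached to
the `j`-th cell. -/
def colOrder (lam : Fin s → ℂ) (j : Fin s) (p : BlockIndex n) : ℕ :=
  if lam p.1 = lam j then min p.2 (n j) else 0

/-- The order in `z = x ^ (-1 / n j)` of the `p`-th row of the equation satisfied by the formal
eigenvector attached to the `j`-th cell. -/
def rowOrder (lam : Fin s → ℂ) (j : Fin s) (p : BlockIndex n) : ℕ :=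
  if lam p.1 = lam j then min (p.2 + 1) (n j) else 0

/-- The rows whose leading part involves the formal eigenvalue of the `j`-th cell. -/
abbrev Active (lam : Fin s → ℂ) (j : Fin s) (p : BlockIndex n) : Prop :=
  lam p.1 = lam j ∧ (p.2 : ℕ) < n j

theorem rowOrder_eq (lam : Fin s → ℂ) (j : Fin s) (p : BlockIndex n) :
    rowOrder lam j p = colOrder lam j p + if Active lam j p then 1 else 0 := by
  unfold rowOrder colOrder
  split_ifs <;> lia

theorem colOrder_zero (lam : Fin s → ℂ) (j i : Fin s) (hi : 0 < n i) :
    colOrder lam j (⟨i, ⟨0, hi⟩⟩ : BlockIndex n) = 0 := by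
  simp [colOrder]

theorem rowOrder_le (lam : Fin s → ℂ) (j : Fin s) (p : BlockIndex n) : rowOrder lam j p ≤ n j := by
  unfold rowOrder
  split_ifs <;> lia

theorem rowOrder_eq_size_iff {lam : Fin s → ℂ} {j : Fin s} (hn : 1 ≤ n j) (p : BlockIndex n) :
    rowOrder lam j p = n j ↔ lam p.1 = lam j ∧ n j ≤ p.2 + 1 := by
  unfold rowOrder
  split_ifs <;> lia

/-- The leading matrix of the equation of the formal eigenvector attached to the `j`-th cell, once
its rows and columns are rescaled by `z ^ (-rowOrder)` and `z ^ colOrder`. It only sees the leading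
coefficient of the connection, of eigenvalues `lam`, and the next coefficient `B`. -/
def principalMatrix (lam : Fin s → ℂ) (B : Matrix (BlockIndex n) (BlockIndex n) ℂ) (j : Fin s) :
    Matrix (BlockIndex n) (BlockIndex n) ℂ :=
  blockDiagonal' (fun i => jordanCell (lam i - lam j) (n i)) +
    of fun p q => if rowOrder lam j p = n j ∧ colOrder lam j q = 0 then B p q else 0

/-- The leading part of the formal eigenvector attached to the `j`-th cell: its components at the
beginning of the cells above the `j`-th one are those of `U`, and its leading eigenvalue is `μ`. -/
def leadingVector (hn : ∀ j, 1 ≤ n j) (lam : Fin s → ℂ)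
    (B : Matrix (BlockIndex n) (BlockIndex n) ℂ) (j : Fin s) (U : Fin s → ℂ) (μ : ℂ)
    (p : BlockIndex n) : ℂ :=
  if Above n lam j p.1 then
    if (p.2 : ℕ) < n j then μ ^ (p.2 : ℕ) * U p.1 else
      (if (p.2 : ℕ) = n j then μ ^ n j * U p.1 else 0) -
        ∑ k, B ⟨p.1, ⟨p.2 - 1, by have := p.2.2; lia⟩⟩ ⟨k, ⟨0, hn k⟩⟩ * U k
  else 0

/-- The components of a vector at the beginning of the cells above the `j`-th one. -/
def cellHead (hn : ∀ j, 1 ≤ n j) (lam : Fin s → ℂ) (j : Fin s) (w : BlockIndex n → ℂ)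
    (i : Fin s) : ℂ :=
  if Above n lam j i then w ⟨i, ⟨0, hn i⟩⟩ else 0

variable {hn : ∀ j, 1 ≤ n j} {lam : Fin s → ℂ} {B : Matrix (BlockIndex n) (BlockIndex n) ℂ}
  {ν : Fin s → ℂ} {U : Fin s → Fin s → ℂ} {u : Fin s → ℂ} {i j : Fin s} {μ b : ℂ}
  {w : BlockIndex n → ℂ}

theorem above_of_cellHead_ne_zero (h : cellHead hn lam j w i ≠ 0) : Above n lam j i := by
  by_contra hi
  exact h (if_neg hi)

theorem cellHead_sub_smul (v : BlockIndex n → ℂ) (c : ℂ) :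
    cellHead hn lam j (w - c • v) = cellHead hn lam j w - c • cellHead hn lam j v := by
  funext i
  simp only [cellHead, Pi.sub_apply, Pi.smul_apply, smul_eq_mul]
  split_ifs <;> ring

theorem principalMatrix_mulVec (w : BlockIndex n → ℂ) (i : Fin s) (a : Fin (n i)) :
    (principalMatrix lam B j *ᵥ w) ⟨i, a⟩ = (lam i - lam j) * w ⟨i, a⟩ +
      (if h : (a : ℕ) + 1 < n i then w ⟨i, ⟨a + 1, h⟩⟩ else 0) +
      if rowOrder lam j ⟨i, a⟩ = n j then
        ∑ q, (if colOrder lam j q = 0 then B ⟨i, a⟩ q * w q else 0) else 0 := by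
  rw [principalMatrix, add_mulVec, Pi.add_apply, jordan_mulVec]
  congr 1
  simp only [mulVec, dotProduct, of_apply, ite_mul, zero_mul]
  split_ifs with h <;> simp only [h, true_and, false_and, if_false, Finset.sum_const_zero]

theorem sum_colOrder_eq_zero (p : BlockIndex n)
    (hw : ∀ q : BlockIndex n, ¬ Above n lam j q.1 → w q = 0) :
    ∑ q, (if colOrder lam j q = 0 then B p q * w q else 0) =
      ∑ k, B p ⟨k, ⟨0, hn k⟩⟩ * cellHead hn lam j w k := by
  rw [Fintype.sum_sigma]
  refine Finset.sum_congr rfl fun k _ => ?_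
  by_cases h : Above n lam j k
  · rw [Finset.sum_eq_single_of_mem ⟨0, hn k⟩ (Finset.mem_univ _) fun b _ hb => ?_]
    · rw [cellHead, if_pos h, if_pos (by simp [colOrder])]
    · have : (b : ℕ) ≠ 0 := fun h' => hb (Fin.ext h')
      have := hn j
      rw [if_neg]
      simp only [colOrder, h.1, if_true]
      lia
  · rw [cellHead, if_neg h, mul_zero]
    exact Finset.sum_eq_zero fun b _ => by rw [hw ⟨k, b⟩ h, mul_zero, ite_self]

theorem principalMatrix_mulVec_of_not_above
    (hw : ∀ q : BlockIndex n, ¬ Above n lam j q.1 → w q = 0) (i : Fin s) (a : Fin (n i)) :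
    (principalMatrix lam B j *ᵥ w) ⟨i, a⟩ = (lam i - lam j) * w ⟨i, a⟩ +
      (if h : (a : ℕ) + 1 < n i then w ⟨i, ⟨a + 1, h⟩⟩ else 0) +
      if rowOrder lam j ⟨i, a⟩ = n j then
        ∑ k, B ⟨i, a⟩ ⟨k, ⟨0, hn k⟩⟩ * cellHead hn lam j w k else 0 := by
  rw [principalMatrix_mulVec, sum_colOrder_eq_zero (hn := hn) _ hw]

theorem leadingVector_of_not_above {q : BlockIndex n} (hq : ¬ Above n lam j q.1) :
    leadingVector hn lam B j u μ q = 0 :=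
  if_neg hq

theorem leadingVector_of_lt (hi : Above n lam j i) {a : ℕ} (ha : a < n i) (haj : a < n j) :
    leadingVector hn lam B j u μ ⟨i, ⟨a, ha⟩⟩ = μ ^ a * u i := by
  rw [leadingVector, if_pos hi, if_pos haj]

theorem leadingVector_of_le (hi : Above n lam j i) {a : ℕ} (ha : a + 1 < n i) (haj : n j ≤ a + 1) :
    leadingVector hn lam B j u μ ⟨i, ⟨a + 1, ha⟩⟩ = (if a + 1 = n j then μ ^ n j * u i else 0) -
      ∑ k, B ⟨i, ⟨a, by lia⟩⟩ ⟨k, ⟨0, hn k⟩⟩ * u k := by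
  rw [leadingVector, if_pos hi, if_neg (by simpa using haj)]
  simp only [Nat.add_sub_cancel]

theorem cellHead_leadingVector (hu : ∀ i, u i ≠ 0 → Above n lam j i) (μ : ℂ) :
    cellHead hn lam j (leadingVector hn lam B j u μ) = u := by
  funext i
  rw [cellHead]
  split_ifs with hi
  · rw [leadingVector_of_lt hi _ (hn j), pow_zero, one_mul]
  · exact (not_not.mp (mt (hu i) hi)).symm

theorem sum_last_row_eq_lidskii (hn : ∀ j, 1 ≤ n j) (u : Fin s → ℂ) {a : Fin (n i)}
    (ha : (a : ℕ) + 1 = n i) :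
    ∑ k, B ⟨i, a⟩ ⟨k, ⟨0, hn k⟩⟩ * u k = (lidskiiMatrix hn B *ᵥ u) i := by
  rw [show a = ⟨n i - 1, by lia⟩ from Fin.ext (by simp only; lia)]
  rfl

theorem principalMatrix_mulVec_leadingVector (hL : LidskiiBasis hn lam B ν U) (j : Fin s) {μ : ℂ}
    (hμ : μ ^ n j = ν j) (p : BlockIndex n) :
    (principalMatrix lam B j *ᵥ leadingVector hn lam B j (U j) μ) p =
      if Active lam j p then μ * leadingVector hn lam B j (U j) μ p else 0 := by
  obtain ⟨i, a, ha⟩ := p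
  rw [principalMatrix_mulVec_of_not_above (hn := hn) fun q hq => leadingVector_of_not_above hq,
    cellHead_leadingVector (hL.support j)]
  simp only [rowOrder_eq_size_iff (hn j), Active]
  by_cases hi : Above n lam j i
  · have := hi.2
    have hl := eq_true hi.1
    simp only [sub_eq_zero.mpr hi.1, zero_mul, zero_add, hl, true_and]
    rcases lt_or_ge (a + 1) (n j) with haj | haj
    · rw [dif_pos (by lia), if_neg (by lia), if_pos (by lia), leadingVector_of_lt hi _ haj,
        leadingVector_of_lt hi _ (by lia)]
      ring
    · have head : (if a < n j then μ * leadingVector hn lam B j (U j) μ ⟨i, ⟨a, ha⟩⟩ else 0) =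
          if a + 1 = n j then μ ^ n j * U j i else 0 := by
        by_cases haj' : a + 1 = n j
        · rw [if_pos (by lia), if_pos haj', leadingVector_of_lt hi _ (by lia), ← haj']
          ring
        · rw [if_neg (by lia), if_neg haj']
      rw [head, if_pos haj]
      by_cases hai : a + 1 < n i
      · rw [dif_pos hai, leadingVector_of_le hi hai haj, sub_add_cancel]
      · have hai' : a + 1 = n i := by lia
        rw [dif_neg hai, zero_add, sum_last_row_eq_lidskii hn _ hai', hL.eigen j i hi, hμ, hai']
  · have hrow : ¬ (lam i = lam j ∧ n j ≤ a + 1) := fun h => hi ⟨h.1, by lia⟩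
    simp only [leadingVector_of_not_above (q := ⟨i, _⟩) hi, hrow, if_false, mul_zero, ite_self,
      dite_eq_ite, add_zero]

section Kernel

theorem eq_zero_of_not_above (hμ : 2 ≤ n j → μ ≠ 0)
    (hw : ∀ p, (principalMatrix lam B j *ᵥ w) p = if Active lam j p then
      μ * w p + b * leadingVector hn lam B j u μ p else 0)
    (q : BlockIndex n) (hq : ¬ Above n lam j q.1) : w q = 0 := by
  obtain ⟨i, a⟩ := q
  have hi := hn i
  have hrow (a : Fin (n i)) : rowOrder lam j ⟨i, a⟩ ≠ n j := fun h =>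
    hq (((rowOrder_eq_size_iff (hn j) _).mp h).imp_right fun h => h.trans a.2)
  have eqn (a : Fin (n i)) := hw ⟨i, a⟩
  have hlead (a : Fin (n i)) : leadingVector hn lam B j u μ ⟨i, a⟩ = 0 :=
    leadingVector_of_not_above hq
  simp only [principalMatrix_mulVec, if_neg (hrow _), hlead, mul_zero, add_zero] at eqn
  by_cases hl : lam i = lam j
  · have hlt : n i < n j := by
      by_contra h
      exact hq ⟨hl, not_lt.mp h⟩
    refine eq_zero_of_shift_eq_mul (w := fun a => w ⟨i, a⟩) (hμ (by lia)) (fun a => ?_) a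
    have e := eqn a
    rwa [if_pos ⟨hl, a.2.trans hlt⟩, sub_eq_zero.mpr hl, zero_mul, zero_add] at e
  · refine eq_zero_of_shift_eq_mul (w := fun a => w ⟨i, a⟩) (sub_ne_zero.mpr (Ne.symm hl))
      (fun a => ?_) a
    have e := eqn a
    rw [if_neg fun h => hl h.1] at e
    linear_combination e

theorem kernel_apply_of_lt
    (hw : ∀ p, (principalMatrix lam B j *ᵥ w) p = if Active lam j p then
      μ * w p + b * leadingVector hn lam B j u μ p else 0)
    (hi : Above n lam j i) {a : ℕ} (ha : a < n i) (haj : a < n j) :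
    w ⟨i, ⟨a, ha⟩⟩ = μ ^ a * cellHead hn lam j w i + a * μ ^ (a - 1) * b * u i := by
  induction a with
  | zero => simp [cellHead, hi]
  | succ a ih =>
    have e := hw ⟨i, ⟨a, by lia⟩⟩
    rw [principalMatrix_mulVec, dif_pos ha, if_neg fun h => ?_, if_pos ⟨hi.1, by simp only; lia⟩,
      leadingVector_of_lt hi _ (by lia), ih (by lia) (by lia), sub_eq_zero.mpr hi.1, zero_mul,
      zero_add, add_zero] at e
    · rw [e, Nat.add_sub_cancel]
      cases a with
      | zero => simp
      | succ a =>
        push_cast [Nat.add_sub_cancel]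
        ring
    · have := ((rowOrder_eq_size_iff (hn j) _).mp h).2
      simp only at this
      lia

theorem lidskii_mulVec_cellHead (hμ : 2 ≤ n j → μ ≠ 0)
    (hw : ∀ p, (principalMatrix lam B j *ᵥ w) p = if Active lam j p then
      μ * w p + b * leadingVector hn lam B j u μ p else 0)
    (hi : Above n lam j i) :
    (lidskiiMatrix hn B *ᵥ cellHead hn lam j w) i =
      if n i = n j then μ ^ n j * cellHead hn lam j w i + (n j * μ ^ (n j - 1) * b) * u i
      else 0 := by
  have := hi.2
  have := hn i
  have e := hw ⟨i, ⟨n i - 1, by lia⟩⟩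
  rw [principalMatrix_mulVec_of_not_above (hn := hn) (eq_zero_of_not_above hμ hw),
    dif_neg (by simp only; lia),
    if_pos ((rowOrder_eq_size_iff (hn j) _).mpr ⟨hi.1, by simp only; lia⟩),
    sum_last_row_eq_lidskii hn _ (by simp only; lia), sub_eq_zero.mpr hi.1, zero_mul, zero_add,
    zero_add] at e
  rw [e]
  by_cases h : n i = n j
  · rw [if_pos h, if_pos ⟨hi.1, by simp only; lia⟩, leadingVector_of_lt hi _ (by lia),
      kernel_apply_of_lt hw hi _ (by lia), h]
    obtain ⟨m, hm⟩ : ∃ m, n j = m + 1 := ⟨n j - 1, by lia⟩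
    rw [hm, Nat.add_sub_cancel]
    cases m with
    | zero => simp
    | succ m =>
      push_cast [Nat.add_sub_cancel]
      ring
  · rw [if_neg h, if_neg fun h' => ?_]
    have := h'.2
    simp only at this
    lia

theorem eq_zero_of_cellHead_eq_zero (hμ : 2 ≤ n j → μ ≠ 0)
    (hw : ∀ p, (principalMatrix lam B j *ᵥ w) p = if Active lam j p then μ * w p else 0)
    (hhead : cellHead hn lam j w = 0) : w = 0 := by
  have hna := eq_zero_of_not_above (hn := hn) (u := 0) (b := 0) hμ (by simpa using hw)
  funext ⟨i, ⟨a, ha⟩⟩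
  by_cases hi : Above n lam j i
  · induction a with
    | zero =>
      have := congrFun hhead i
      rwa [cellHead, if_pos hi] at this
    | succ a ih =>
      have e := hw ⟨i, ⟨a, by lia⟩⟩
      rw [principalMatrix_mulVec_of_not_above (hn := hn) hna, dif_pos ha, hhead, ih (by lia)] at e
      simpa using e
  · exact hna ⟨i, ⟨a, ha⟩⟩ hi

theorem kernel_eq_smul_leadingVector (hL : LidskiiBasis hn lam B ν U) (hμ0 : μ ≠ 0)
    (hμ : μ ^ n j = ν j)
    (hw : ∀ p, (principalMatrix lam B j *ᵥ w) p = if Active lam j p then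
      μ * w p + b * leadingVector hn lam B j (U j) μ p else 0) :
    b = 0 ∧ ∃ β : ℂ, w = β • leadingVector hn lam B j (U j) μ := by
  obtain ⟨hb, β, hβ⟩ := hL.simple j (cellHead hn lam j w) (n j * μ ^ (n j - 1) * b)
    (fun i hi => above_of_cellHead_ne_zero hi)
    fun i hi => by rw [lidskii_mulVec_cellHead (fun _ => hμ0) hw hi, hμ]
  have hnj : (n j : ℂ) ≠ 0 := Nat.cast_ne_zero.mpr (Nat.one_le_iff_ne_zero.mp (hn j))
  have hb0 : b = 0 :=
    (mul_eq_zero.mp hb).resolve_left (mul_ne_zero hnj (pow_ne_zero _ hμ0))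
  refine ⟨hb0, β, sub_eq_zero.mp (eq_zero_of_cellHead_eq_zero (hn := hn) (lam := lam) (B := B)
    (j := j) (fun _ => hμ0) (fun p => ?_) ?_)⟩
  · rw [mulVec_sub, mulVec_smul, Pi.sub_apply, Pi.smul_apply, hw p,
      principalMatrix_mulVec_leadingVector hL j hμ, hb0]
    simp only [Pi.sub_apply, Pi.smul_apply, smul_eq_mul]
    split_ifs <;> ring
  · rw [cellHead_sub_smul, cellHead_leadingVector (hL.support j), hβ, sub_self]

end Kernel

theorem mulVec_sub_diagonal_active (w : BlockIndex n → ℂ) (p : BlockIndex n) :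
    ((principalMatrix lam B j - diagonal fun p => if Active lam j p then μ else 0) *ᵥ w) p =
      (principalMatrix lam B j *ᵥ w) p - if Active lam j p then μ * w p else 0 := by
  rw [sub_mulVec, Pi.sub_apply, mulVec_diagonal, ite_mul, zero_mul]

theorem exists_solution_of_simple (hL : LidskiiBasis hn lam B ν U) (hμ0 : μ ≠ 0)
    (hμ : μ ^ n j = ν j) (R : BlockIndex n → ℂ) :
    ∃ (a : BlockIndex n → ℂ) (b : ℂ), ∀ p, (principalMatrix lam B j *ᵥ a) p -
      (if Active lam j p then μ * a p + b * leadingVector hn lam B j (U j) μ p else 0) = R p := by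
  let M := principalMatrix lam B j - diagonal fun p => if Active lam j p then μ else 0
  let v : BlockIndex n → ℂ := fun p =>
    if Active lam j p then leadingVector hn lam B j (U j) μ p else 0
  have combine (a : BlockIndex n → ℂ) (b : ℂ) (p : BlockIndex n) : (M *ᵥ a - b • v) p =
      (principalMatrix lam B j *ᵥ a) p -
        if Active lam j p then μ * a p + b * leadingVector hn lam B j (U j) μ p else 0 := by
    rw [Pi.sub_apply, mulVec_sub_diagonal_active, Pi.smul_apply, smul_eq_mul]
    simp only [v]
    split_ifs <;> ring
  obtain ⟨a, b, hab⟩ := exists_mulVec_sub_smul_eq (M := M) (v := v)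
    (w₀ := leadingVector hn lam B j (U j) μ)
    (fun w b hwb => kernel_eq_smul_leadingVector hL hμ0 hμ fun p => sub_eq_zero.mp <| by
      rw [← combine, sub_eq_zero.mpr hwb, Pi.zero_apply]) R
  exact ⟨a, b, fun p => (combine a b p).symm.trans (congrFun hab p)⟩

theorem exists_solution_of_not_isRoot (hnj : n j = 1)
    (hμ : ¬ (pseudoCharpoly hn lam B (lam j) (n j)).IsRoot μ) (R : BlockIndex n → ℂ) :
    ∃ a : BlockIndex n → ℂ, ∀ p, (principalMatrix lam B j *ᵥ a) p -
      (if Active lam j p then μ * a p else 0) = R p := by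
  let T := (principalMatrix lam B j - diagonal fun p => if Active lam j p then μ else 0).mulVecLin
  have hinj : Function.Injective T := by
    rw [injective_iff_map_eq_zero]
    intro w hw0
    have hw (p) : (principalMatrix lam B j *ᵥ w) p = if Active lam j p then μ * w p else 0 :=
      sub_eq_zero.mp ((mulVec_sub_diagonal_active w p).symm.trans (congrFun hw0 p))
    have hμ0 : 2 ≤ n j → μ ≠ 0 := fun h => by lia
    refine eq_zero_of_cellHead_eq_zero (hn := hn) hμ0 hw <| eq_zero_of_not_isRoot hμ
      (fun i hi => above_of_cellHead_ne_zero hi) fun i hi => ?_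
    rw [lidskii_mulVec_cellHead (u := 0) (b := 0) hμ0 (by simpa using hw) hi, hnj]
    simp
  obtain ⟨a, ha⟩ := LinearMap.injective_iff_surjective.mp hinj R
  exact ⟨a, fun p => (mulVec_sub_diagonal_active a p).symm.trans (congrFun ha p)⟩

end LinearEquations

/-! ### Ramified formal eigenvectors -/

section RamifiedEigenvectors

open PowerSeries Matrix

theorem exists_expand_eq_C_add_X_pow_mul {R : Type*} [CommRing R] {m : ℕ} (hm : m ≠ 0) (f : R⟦X⟧) :
    ∃ g, expand m hm f = C (coeff 0 f) + X ^ m * g ∧ constantCoeff g = coeff 1 f := by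
  refine ⟨expand m hm (mk fun k => coeff (k + 1) f), ?_, by simp⟩
  conv_lhs => rw [eq_X_mul_shift_add_const f]
  rw [map_add, map_mul, expand_X, expand_C, add_comm, coeff_zero_eq_constantCoeff_apply]

variable {s : ℕ} {n : Fin s → ℕ} {hn : ∀ j, 1 ≤ n j} {lam : Fin s → ℂ} {r : ℕ}
  {B : Matrix (BlockIndex n) (BlockIndex n) ℂ}
  {Ahat : Matrix (BlockIndex n) (BlockIndex n) ℂ⟦X⟧}

theorem colOrder_eq_rowOrder_of_ne_zero {j : Fin s} {p q : BlockIndex n}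
    (h : blockDiagonal' (fun i => jordanCell (lam i - lam j) (n i)) p q ≠ 0) :
    colOrder lam j q = rowOrder lam j p := by
  obtain ⟨i, a⟩ := p
  obtain ⟨k, b⟩ := q
  obtain rfl : i = k := by
    by_contra hik
    exact h (blockDiagonal'_apply_ne _ _ _ hik)
  rw [blockDiagonal'_apply_eq, jordanCell, of_apply] at h
  unfold colOrder rowOrder
  split_ifs at h with hab hab'
  · have hlam : lam i ≠ lam j := sub_ne_zero.mp h
    rw [if_neg hlam, if_neg hlam]
  · simp only [hab']
  · exact absurd rfl h

theorem blockDiagonal'_jordanCell_sub (lam : Fin s → ℂ) (j : Fin s) (p q : BlockIndex n) :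
    blockDiagonal' (fun i => jordanCell (lam i - lam j) (n i)) p q =
      blockDiagonal' (fun i => jordanCell (lam i) (n i)) p q - if p = q then lam j else 0 := by
  obtain ⟨i, a⟩ := p
  obtain ⟨k, b⟩ := q
  rcases eq_or_ne i k with rfl | hik
  · simp only [blockDiagonal'_apply_eq, jordanCell, of_apply, Sigma.mk.injEq, heq_eq_eq, true_and]
    split_ifs <;> ring
  · rw [blockDiagonal'_apply_ne _ _ _ hik, blockDiagonal'_apply_ne _ _ _ hik, if_neg, sub_zero]
    exact fun h => hik (congrArg Sigma.fst h)

theorem exists_rescaled_matrix (hn : ∀ j, 1 ≤ n j)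
    (h0 : ∀ p q, coeff 0 (Ahat p q) = blockDiagonal' (fun i => jordanCell (lam i) (n i)) p q)
    (h1 : ∀ p q, coeff 1 (Ahat p q) = B p q) (j : Fin s) :
    ∃ Bs : Matrix (BlockIndex n) (BlockIndex n) ℂ⟦X⟧,
      (∀ p q, (expand (n j) (Nat.one_le_iff_ne_zero.mp (hn j)) (Ahat p q) -
          if p = q then C (lam j) else 0) * X ^ colOrder lam j q =
        X ^ rowOrder lam j p * Bs p q) ∧
      ∀ p q, constantCoeff (Bs p q) = principalMatrix lam B j p q := by
  choose g hg hg0 using fun p q =>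
    exists_expand_eq_C_add_X_pow_mul (Nat.one_le_iff_ne_zero.mp (hn j)) (Ahat p q)
  set D := blockDiagonal' (fun i => jordanCell (lam i - lam j) (n i)) with hD
  refine ⟨of fun p q => C (D p q) +
    X ^ (n j - rowOrder lam j p + colOrder lam j q) * g p q, fun p q => ?_, fun p q => ?_⟩
  · have hdiag : expand (n j) (Nat.one_le_iff_ne_zero.mp (hn j)) (Ahat p q) -
        (if p = q then C (lam j) else 0) = C (D p q) + X ^ n j * g p q := by
      rw [hg, h0, hD, blockDiagonal'_jordanCell_sub, map_sub, apply_ite C, map_zero]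
      ring
    have hshift : C (D p q) * X ^ colOrder lam j q = X ^ rowOrder lam j p * C (D p q) := by
      rcases eq_or_ne (D p q) 0 with h | h
      · rw [h, map_zero, zero_mul, mul_zero]
      · rw [colOrder_eq_rowOrder_of_ne_zero h, mul_comm]
    have hpow : X ^ n j = (X : ℂ⟦X⟧) ^ rowOrder lam j p * X ^ (n j - rowOrder lam j p) := by
      rw [← pow_add, Nat.add_sub_of_le (rowOrder_le lam j p)]
    rw [hdiag, add_mul, hshift, hpow, of_apply, pow_add]
    ring
  · have hexp : n j - rowOrder lam j p + colOrder lam j q = 0 ↔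
        rowOrder lam j p = n j ∧ colOrder lam j q = 0 := by
      have := rowOrder_le lam j p
      lia
    simp only [of_apply, principalMatrix, Matrix.add_apply, map_add, constantCoeff_C, map_mul,
      map_pow, constantCoeff_X, hg0, h1, zero_pow_eq, hexp, ite_mul, one_mul, zero_mul, hD]

theorem Active.colOrder_eq_zero {j : Fin s} {p : BlockIndex n} (hp : Active lam j p)
    (hj : n j = 1) : colOrder lam j p = 0 := by
  have := hp.2
  unfold colOrder
  split_ifs <;> lia

/-- The exponent `α p` of the derivation in the `p`-th rescaled equation of the `j`-th cell. -/
def derivOrder (r : ℕ) (lam : Fin s → ℂ) (j : Fin s) (p : BlockIndex n) : ℕ :=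
  if Active lam j p then r * n j - 1 else r * n j

/-- The exponent `β p` of the eigenvalue in the `p`-th rescaled equation of the `j`-th cell. -/
def eigenvalueOrder (lam : Fin s → ℂ) (j : Fin s) (p : BlockIndex n) : ℕ :=
  if Active lam j p then 0 else 1

theorem eigenvalueOrder_eq_zero_iff {j : Fin s} {p : BlockIndex n} :
    eigenvalueOrder lam j p = 0 ↔ Active lam j p := by
  simp [eigenvalueOrder]

theorem derivOrder_eq_zero_iff {j : Fin s} {p : BlockIndex n} (hN : r * n j ≠ 0) :
    derivOrder r lam j p = 0 ↔ r * n j = 1 ∧ Active lam j p := by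
  unfold derivOrder
  split_ifs with hp
  · rw [and_iff_left hp]
    lia
  · exact iff_of_false hN fun h => hp h.2

theorem rowOrder_add_derivOrder {j : Fin s} (hN : r * n j ≠ 0) (p : BlockIndex n) :
    rowOrder lam j p + derivOrder r lam j p = colOrder lam j p + r * n j := by
  rw [rowOrder_eq, derivOrder]
  split_ifs <;> lia

theorem rowOrder_add_eigenvalueOrder (j : Fin s) (p : BlockIndex n) :
    rowOrder lam j p + eigenvalueOrder lam j p = colOrder lam j p + 1 := by
  rw [rowOrder_eq, eigenvalueOrder]
  split_ifs <;> rfl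

theorem exists_solution_of_nonresonant {ν : Fin s → ℂ} {U : Fin s → Fin s → ℂ}
    (hL : LidskiiBasis hn lam B ν U) (hr : 1 ≤ r)
    (hres : r = 1 → ∀ j, n j = 1 → ∀ μ ν : ℂ,
      (pseudoCharpoly hn lam B (lam j) 1).IsRoot μ →
      (pseudoCharpoly hn lam B (lam j) 1).IsRoot ν → ∀ k : ℤ, μ - ν = k → k = 0)
    {j : Fin s} {μ : ℂ} (hμ0 : μ ≠ 0) (hμ : μ ^ n j = ν j) {k : ℕ} (hk : 0 < k)
    (R : BlockIndex n → ℂ) :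
    ∃ (a : BlockIndex n → ℂ) (b : ℂ), ∀ p, (principalMatrix lam B j *ᵥ a) p +
      (if derivOrder r lam j p = 0 then (n j : ℂ)⁻¹ * ((k + colOrder lam j p) * a p) else 0) -
      (if eigenvalueOrder lam j p = 0 then
        μ * a p + b * leadingVector hn lam B j (U j) μ p else 0) = R p := by
  have hN : r * n j ≠ 0 := (Nat.mul_pos hr (hn j)).ne'
  simp only [eigenvalueOrder_eq_zero_iff, derivOrder_eq_zero_iff hN]
  by_cases hN1 : r * n j = 1
  · obtain ⟨rfl, hj⟩ := mul_eq_one.mp hN1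
    have isRoot_μ := hL.isRoot j
    rw [← hμ, hj, pow_one] at isRoot_μ
    have not_isRoot : ¬ (pseudoCharpoly hn lam B (lam j) (n j)).IsRoot (μ - k) := fun h => by
      rw [hj] at h
      have := hres rfl j hj _ _ isRoot_μ h k (by push_cast; ring)
      lia
    obtain ⟨a, ha⟩ := exists_solution_of_not_isRoot hj not_isRoot R
    refine ⟨a, 0, fun p => ?_⟩
    rw [← ha p]
    by_cases hp : Active lam j p
    · rw [if_pos (And.intro hN1 hp), if_pos hp, if_pos hp, hp.colOrder_eq_zero hj, hj]
      push_cast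
      ring
    · rw [if_neg fun h => hp h.2, if_neg hp, if_neg hp, add_zero]
  · obtain ⟨a, b, hab⟩ := exists_solution_of_simple hL hμ0 hμ R
    refine ⟨a, b, fun p => ?_⟩
    rw [if_neg (fun h => hN1 h.1), add_zero, hab p]

theorem exists_rescaled_eigenvector {ν : Fin s → ℂ} {U : Fin s → Fin s → ℂ}
    (hL : LidskiiBasis hn lam B ν U) (hr : 1 ≤ r)
    (hres : r = 1 → ∀ j, n j = 1 → ∀ μ ν : ℂ,
      (pseudoCharpoly hn lam B (lam j) 1).IsRoot μ →
      (pseudoCharpoly hn lam B (lam j) 1).IsRoot ν → ∀ k : ℤ, μ - ν = k → k = 0)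
    {j : Fin s} {μ : ℂ} (hμ0 : μ ≠ 0) (hμ : μ ^ n j = ν j)
    {Bs : Matrix (BlockIndex n) (BlockIndex n) ℂ⟦X⟧}
    (hBs : ∀ p q, constantCoeff (Bs p q) = principalMatrix lam B j p q) :
    ∃ w Q, (∀ p, constantCoeff (w p) = leadingVector hn lam B j (U j) μ p) ∧
      constantCoeff Q = μ ∧ residual Bs (n j : ℂ)⁻¹ (fun p => colOrder lam j p)
        (derivOrder r lam j) (eigenvalueOrder lam j) w Q = 0 := by
  have hN : r * n j ≠ 0 := (Nat.mul_pos hr (hn j)).ne'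
  have principal_apply (a : BlockIndex n → ℂ) (p : BlockIndex n) :
      ∑ q, constantCoeff (Bs p q) * a q = (principalMatrix lam B j *ᵥ a) p := by
    simp only [hBs, mulVec, dotProduct]
  refine exists_formal_eigenvector _ _ _ _ _ _ _ (fun p => ?_) fun k hk R => ?_
  · have deriv_eq_zero : (if derivOrder r lam j p = 0 then (n j : ℂ)⁻¹ *
        (colOrder lam j p * leadingVector hn lam B j (U j) μ p) else 0) = 0 := by
      rw [ite_eq_right_iff, derivOrder_eq_zero_iff hN]
      rintro ⟨hN1, hp⟩
      rw [hp.colOrder_eq_zero (mul_eq_one.mp hN1).2]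
      ring
    rw [principal_apply, deriv_eq_zero, add_zero, principalMatrix_mulVec_leadingVector hL j hμ]
    simp only [eigenvalueOrder_eq_zero_iff]
  · simp only [principal_apply]
    exact exists_solution_of_nonresonant hL hr hres hμ0 hμ hk R

theorem eigenvector_of_rescaled {j : Fin s} (hj : n j ≠ 0) (hr : 1 ≤ r)
    {Bs : Matrix (BlockIndex n) (BlockIndex n) ℂ⟦X⟧}
    (hBs : ∀ p q, (expand (n j) hj (Ahat p q) - if p = q then C (lam j) else 0) *
      X ^ colOrder lam j q = X ^ rowOrder lam j p * Bs p q) {κ : ℂ}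
    {w : BlockIndex n → ℂ⟦X⟧} {Q : ℂ⟦X⟧}
    (hw : residual Bs κ (fun p => colOrder lam j p) (derivOrder r lam j) (eigenvalueOrder lam j)
      w Q = 0) (p : BlockIndex n) :
    ∑ q, expand (n j) hj (Ahat p q) * (X ^ colOrder lam j q * w q) +
        C κ * X ^ (r * n j) * theta (X ^ colOrder lam j p * w p) =
      (C (lam j) + X * Q) * (X ^ colOrder lam j p * w p) := by
  have hN : r * n j ≠ 0 := (Nat.mul_pos hr hj.bot_lt).ne'
  have diagonal : ∑ q, (if p = q then C (lam j) else 0) * (X ^ colOrder lam j q * w q) =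
      C (lam j) * (X ^ colOrder lam j p * w p) := by
    simp only [ite_mul, zero_mul, Finset.sum_ite_eq, Finset.mem_univ, if_true]
  have rescaled : ∑ q, expand (n j) hj (Ahat p q) * (X ^ colOrder lam j q * w q) =
      X ^ rowOrder lam j p * ∑ q, Bs p q * w q + C (lam j) * (X ^ colOrder lam j p * w p) := by
    rw [← diagonal, Finset.mul_sum, ← Finset.sum_add_distrib]
    refine Finset.sum_congr rfl fun q _ => ?_
    rw [← mul_assoc (X ^ _) (Bs p q), ← hBs]
    ring
  have pow_deriv := congrArg (X (R := ℂ) ^ ·) (rowOrder_add_derivOrder (lam := lam) hN p)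
  have pow_eigenvalue := congrArg (X (R := ℂ) ^ ·) (rowOrder_add_eigenvalueOrder (lam := lam) j p)
  simp only [pow_add, pow_one] at pow_deriv pow_eigenvalue
  have hp := congrFun hw p
  simp only [residual, Pi.zero_apply] at hp
  rw [rescaled, theta_X_pow_mul]
  linear_combination X ^ rowOrder lam j p * hp -
    C κ * (theta (w p) + C (colOrder lam j p : ℂ) * w p) * pow_deriv + Q * w p * pow_eigenvalue

theorem exists_cell_eigenvector {ν : Fin s → ℂ} {U : Fin s → Fin s → ℂ}
    (hL : LidskiiBasis hn lam B ν U) (hr : 1 ≤ r)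
    (hres : r = 1 → ∀ j, n j = 1 → ∀ μ ν : ℂ,
      (pseudoCharpoly hn lam B (lam j) 1).IsRoot μ →
      (pseudoCharpoly hn lam B (lam j) 1).IsRoot ν → ∀ k : ℤ, μ - ν = k → k = 0)
    (h0 : ∀ p q, coeff 0 (Ahat p q) = blockDiagonal' (fun i => jordanCell (lam i) (n i)) p q)
    (h1 : ∀ p q, coeff 1 (Ahat p q) = B p q) (j : Fin s) {μ : ℂ} (hμ0 : μ ≠ 0)
    (hμ : μ ^ n j = ν j) :
    ∃ (v : BlockIndex n → ℂ⟦X⟧) (Q : ℂ⟦X⟧),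
      (∀ i, coeff 0 (v ⟨i, ⟨0, hn i⟩⟩) = U j i) ∧ coeff 0 Q = lam j ∧ coeff 1 Q = μ ∧
      (∀ i, r * n j < i → coeff i Q = 0) ∧
      ∀ p, ∑ q, expand (n j) (Nat.one_le_iff_ne_zero.mp (hn j)) (Ahat p q) * v q +
        C (n j : ℂ)⁻¹ * X ^ (r * n j) * theta (v p) = Q * v p := by
  have hj := Nat.one_le_iff_ne_zero.mp (hn j)
  have hN : 0 < r * n j := Nat.mul_pos hr (hn j)
  obtain ⟨Bs, hBs, hBs0⟩ := exists_rescaled_matrix hn h0 h1 j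
  obtain ⟨w, Q, hw0, hQ0, hw⟩ := exists_rescaled_eigenvector hL hr hres hμ0 hμ hBs0
  obtain ⟨f, hf0, hf⟩ := exists_truncated_eigenvalue
    (of fun p q => expand (n j) hj (Ahat p q)) (inv_ne_zero (Nat.cast_ne_zero.mpr hj)) (r * n j)
    (eigenvector_of_rescaled hj hr hBs hw)
  refine ⟨_, _, fun i => ?_, ?_, ?_, fun i hi => ?_, hf⟩
  · rw [colOrder_zero, pow_zero, one_mul, coeff_zero_eq_constantCoeff_apply, map_mul, hf0, one_mul,
      hw0, ← congrFun (cellHead_leadingVector (B := B) (hn := hn) (hL.support j) μ) i, cellHead]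
    split_ifs with h
    · rfl
    · exact leadingVector_of_not_above h
  · simp [coeff_trunc]
  · rw [Polynomial.coeff_coe, coeff_trunc, if_pos (by lia), map_add, coeff_C,
      if_neg one_ne_zero, zero_add, ← zero_add 1, coeff_succ_X_mul,
      coeff_zero_eq_constantCoeff_apply, hQ0]
  · rw [Polynomial.coeff_coe, coeff_trunc, if_neg (by lia)]

end RamifiedEigenvectors

/-! ### Sectors of a ramified series -/

section Sectors

open PowerSeries FormalSeries

/-- The part of `f` with exponents congruent to `b` modulo `m`. -/
def sector (m b : ℕ) (f : ℂ⟦X⟧) : ℂ⟦X⟧ := mk fun k => coeff (b + m * k) f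

/-- The coefficients of a power series, extended by zero to negative degrees. -/
def zcoeff (f : ℂ⟦X⟧) (k : ℤ) : ℂ := xcoeff (HahnSeries.ofPowerSeries ℤ ℂ f) (-k)

theorem zcoeff_natCast (f : ℂ⟦X⟧) (k : ℕ) : zcoeff f k = coeff k f := xcoeff_ofPowerSeries f k

theorem zcoeff_of_neg (f : ℂ⟦X⟧) {k : ℤ} (hk : k < 0) : zcoeff f k = 0 :=
  xcoeff_ofPowerSeries_of_pos f (by lia)

theorem zcoeff_sub (f g : ℂ⟦X⟧) (k : ℤ) : zcoeff (f - g) k = zcoeff f k - zcoeff g k := by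
  rw [zcoeff, map_sub, xcoeff_sub]
  rfl

theorem zcoeff_C_mul (c : ℂ) (f : ℂ⟦X⟧) (k : ℤ) : zcoeff (C c * f) k = c * zcoeff f k := by
  rw [zcoeff, map_mul, HahnSeries.ofPowerSeries_C, xcoeff_C_mul]
  rfl

theorem zcoeff_X_pow_mul (N : ℕ) (f : ℂ⟦X⟧) (k : ℤ) :
    zcoeff (X ^ N * f) k = zcoeff f (k - N) := by
  rw [zcoeff, map_mul, HahnSeries.ofPowerSeries_X_pow,
    show HahnSeries.single (N : ℤ) (1 : ℂ) = x ^ (-(N : ℤ)) by rw [x_zpow, neg_neg],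
    xcoeff_zpow_mul, zcoeff]
  congr 1
  ring

theorem zcoeff_theta (f : ℂ⟦X⟧) (k : ℤ) : zcoeff (theta f) k = k * zcoeff f k := by
  rcases lt_or_ge k 0 with h | h
  · rw [zcoeff_of_neg _ h, zcoeff_of_neg _ h, mul_zero]
  · obtain ⟨m, rfl⟩ := Int.eq_ofNat_of_zero_le h
    rw [zcoeff_natCast, zcoeff_natCast, coeff_theta]
    push_cast
    rfl

theorem zcoeff_mul_of_truncated {Q : ℂ⟦X⟧} {N : ℕ} (hQ : ∀ i, N < i → coeff i Q = 0)
    (f : ℂ⟦X⟧) (k : ℤ) :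
    zcoeff (Q * f) k = ∑ i ∈ Finset.range (N + 1), coeff i Q * zcoeff f (k - i) := by
  have h : Q = ∑ i ∈ Finset.range (N + 1), C (coeff i Q) * X ^ i := by
    ext l
    rw [map_sum]
    simp only [coeff_C_mul, coeff_X_pow, mul_ite, mul_one, mul_zero, Finset.sum_ite_eq,
      Finset.mem_range]
    split_ifs with h
    · rfl
    · exact hQ l (by lia)
  conv_lhs => rw [h, Finset.sum_mul, zcoeff, map_sum, xcoeff_sum]
  refine Finset.sum_congr rfl fun i _ => ?_
  change zcoeff _ _ = _
  rw [mul_assoc, zcoeff_C_mul, zcoeff_X_pow_mul]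

theorem xcoeff_sector {m : ℕ} (b : Fin m) (f : ℂ⟦X⟧) (k : ℤ) :
    xcoeff (HahnSeries.ofPowerSeries ℤ ℂ (sector m b f)) k = zcoeff f ((b : ℕ) - m * k) := by
  rcases lt_or_ge 0 k with h | h
  · rw [xcoeff_ofPowerSeries_of_pos _ h, zcoeff_of_neg]
    have := b.2
    nlinarith
  · obtain ⟨l, rfl⟩ : ∃ l : ℕ, k = -(l : ℤ) := ⟨(-k).toNat, by lia⟩
    rw [xcoeff_ofPowerSeries, sector, coeff_mk, ← zcoeff_natCast]
    congr 1
    push_cast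
    ring

theorem sector_expand_mul {m : ℕ} (hm : m ≠ 0) (b : Fin m) (f g : ℂ⟦X⟧) :
    sector m b (expand m hm f * g) = f * sector m b g := by
  ext k
  rw [sector, coeff_mk, coeff_mul, coeff_mul]
  symm
  refine Finset.sum_of_injOn (fun i => (m * i.1, (b : ℕ) + m * i.2)) ?_ ?_ ?_ ?_
  · rintro ⟨i, l⟩ - ⟨i', l'⟩ - h
    simp only [Prod.mk.injEq, add_right_inj, mul_eq_mul_left_iff] at h ⊢
    lia
  · rintro ⟨i, l⟩ h
    simp only [Finset.mem_coe, Finset.HasAntidiagonal.mem_antidiagonal] at h ⊢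
    rw [← h]
    ring
  · rintro ⟨i, l⟩ hil not_mem_image
    rw [Finset.HasAntidiagonal.mem_antidiagonal] at hil
    rw [coeff_expand_of_not_dvd, zero_mul]
    rintro ⟨i', rfl⟩
    have hi : i' ≤ k := by
      by_contra! hc
      nlinarith [b.2]
    refine not_mem_image ⟨(i', k - i'), by simp [hi], ?_⟩
    obtain ⟨e, rfl⟩ := Nat.exists_eq_add_of_le hi
    simp only [Nat.add_sub_cancel_left, Prod.mk.injEq, true_and]
    linarith
  · rintro ⟨i, l⟩ -
    rw [coeff_expand_mul, sector, coeff_mk]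

variable {s : ℕ} {n : Fin s → ℕ} {r : ℕ}

/-- The gauge whose `j`-th block of columns is made of the sectors of `v j`. -/
def sectorMatrix (n : Fin s → ℕ) (v : Fin s → BlockIndex n → ℂ⟦X⟧) :
    Matrix (BlockIndex n) (BlockIndex n) ℂ⟦X⟧ :=
  fun p q => sector (n q.1) q.2 (v q.1 p)

theorem x_mul_mul_sectorMatrix_apply
    {A : Matrix (BlockIndex n) (BlockIndex n) FormalSeries}
    {Ahat : Matrix (BlockIndex n) (BlockIndex n) ℂ⟦X⟧}
    (hA : ∀ p q, A p q = x ^ ((r : ℤ) - 1) * HahnSeries.ofPowerSeries ℤ ℂ (Ahat p q))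
    (v : Fin s → BlockIndex n → ℂ⟦X⟧) {j : Fin s} (hj : n j ≠ 0) (p : BlockIndex n)
    (b : Fin (n j)) :
    x * (A * (sectorMatrix n v).map (HahnSeries.ofPowerSeries ℤ ℂ)) p ⟨j, b⟩ =
      x ^ (r : ℤ) * HahnSeries.ofPowerSeries ℤ ℂ
        (sector (n j) b (∑ q, expand (n j) hj (Ahat p q) * v j q)) := by
  have sector_sum : sector (n j) b (∑ q, expand (n j) hj (Ahat p q) * v j q) =
      ∑ q, Ahat p q * sector (n j) b (v j q) := by
    simp_rw [← sector_expand_mul hj]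
    ext k
    simp only [sector, coeff_mk, map_sum]
  rw [sector_sum, map_sum, Finset.mul_sum, Matrix.mul_apply, Finset.mul_sum]
  refine Finset.sum_congr rfl fun q _ => ?_
  rw [hA, map_mul, Matrix.map_apply, sectorMatrix, ← mul_assoc, ← mul_assoc, ← mul_assoc,
    ← zpow_one_add₀ x_ne_zero, add_sub_cancel]

theorem xcoeff_sum_colExt_sector {m : ℕ} (hm : 1 ≤ m) {Q : ℂ⟦X⟧}
    (hQ : ∀ i, r * m < i → coeff i Q = 0) (f : ℂ⟦X⟧) (b : Fin m) (k : ℤ) :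
    xcoeff (∑ J ∈ Finset.range (r * m + 1), HahnSeries.C (m * coeff (r * m - J) Q) *
      colExt hm (fun b => HahnSeries.ofPowerSeries ℤ ℂ (sector m b f)) ((b : ℕ) + (J : ℕ))) k =
    m * zcoeff (Q * f) ((b : ℕ) - m * (k - r)) := by
  rw [zcoeff_mul_of_truncated hQ, ← Finset.sum_range_reflect, xcoeff_sum, Finset.mul_sum]
  refine Finset.sum_congr rfl fun J hJ => ?_
  have hJ' : J ≤ r * m := Finset.mem_range_succ_iff.mp hJ
  rw [Nat.add_sub_cancel, Nat.sub_sub_self hJ', xcoeff_C_mul, xcoeff_colExt, xcoeff_sector,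
    mul_assoc]
  congr 3
  have division := residue_add_ediv hm ((b : ℕ) + ((r * m - J : ℕ) : ℤ))
  rw [Nat.cast_sub hJ'] at division ⊢
  push_cast at division ⊢
  linear_combination division

theorem sectorMatrix_eqn (hn : ∀ j, 1 ≤ n j)
    {A : Matrix (BlockIndex n) (BlockIndex n) FormalSeries}
    {Ahat : Matrix (BlockIndex n) (BlockIndex n) ℂ⟦X⟧}
    (hA : ∀ p q, A p q = x ^ ((r : ℤ) - 1) * HahnSeries.ofPowerSeries ℤ ℂ (Ahat p q))
    {v : Fin s → BlockIndex n → ℂ⟦X⟧} {Q : Fin s → ℂ⟦X⟧}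
    (hQ : ∀ j i, r * n j < i → coeff i (Q j) = 0)
    (hv : ∀ j p, ∑ q, expand (n j) (Nat.one_le_iff_ne_zero.mp (hn j)) (Ahat p q) * v j q +
        C (n j : ℂ)⁻¹ * X ^ (r * n j) * theta (v j p) = Q j * v j p) :
    A * (sectorMatrix n v).map (HahnSeries.ofPowerSeries ℤ ℂ) -
        ((sectorMatrix n v).map (HahnSeries.ofPowerSeries ℤ ℂ)).map ddx =
      (sectorMatrix n v).map (HahnSeries.ofPowerSeries ℤ ℂ) *
        normalForm r n fun j J => n j * coeff (r * n j - J) (Q j) := by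
  refine Matrix.ext fun p ⟨j, b⟩ => ?_
  have hj := Nat.one_le_iff_ne_zero.mp (hn j)
  have hj' : (n j : ℂ) ≠ 0 := Nat.cast_ne_zero.mpr hj
  apply mul_left_cancel₀ (mul_ne_zero (natCast_ne_zero hj) x_ne_zero)
  rw [mul_normalForm_apply hn]
  refine xcoeff_ext fun k => ?_
  have exponent : ((b : ℕ) - n j * (k - r) - ((r * n j : ℕ) : ℤ) : ℤ) = (b : ℕ) - n j * k := by
    push_cast
    ring
  rw [Matrix.sub_apply, mul_assoc, mul_sub, x_mul_mul_sectorMatrix_apply hA v hj,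
    eq_sub_of_add_eq (hv j p)]
  simp only [Matrix.map_apply, sectorMatrix]
  rw [xcoeff_natCast_mul, xcoeff_sub, xcoeff_x_mul_ddx, xcoeff_zpow_mul, xcoeff_sector,
    xcoeff_sector, zcoeff_sub, mul_assoc, zcoeff_C_mul, zcoeff_X_pow_mul, zcoeff_theta, exponent,
    xcoeff_sub, xcoeff_sum_colExt_sector (hn j) (hQ j), xcoeff_natCast_mul, xcoeff_sector]
  push_cast
  field_simp
  ring

end Sectors

/-! ### Existence -/

section Existence

open PowerSeries Matrix FormalSeries

section Toeplitz

variable {K : Type*} [Field K] {m : ℕ} {q : ℕ → K}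

/-- The upper triangular Toeplitz matrix with entries `q (b - a)`. -/
def toeplitzCell (m : ℕ) (q : ℕ → K) : Matrix (Fin m) (Fin m) K :=
  of fun a b => if (a : ℕ) ≤ b then q (b - a) else 0

theorem toeplitzCell_mulVec_top {c : Fin m → K} {b : Fin m} (hc : ∀ b', b < b' → c b' = 0) :
    (toeplitzCell m q *ᵥ c) b = q 0 * c b := by
  rw [mulVec, dotProduct, Finset.sum_eq_single_of_mem b (Finset.mem_univ b)]
  · rw [toeplitzCell, of_apply, if_pos le_rfl, Nat.sub_self]
  · intro b' _ hne
    rcases hne.lt_or_gt with hlt | hgt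
    · rw [toeplitzCell, of_apply, if_neg (by simpa using hlt), zero_mul]
    · rw [hc b' hgt, mul_zero]

theorem toeplitzCell_mulVec_below_top {c : Fin m → K} {a b : Fin m} (hab : (a : ℕ) + 1 = b)
    (hc : ∀ b', b < b' → c b' = 0) :
    (toeplitzCell m q *ᵥ c) a = q 0 * c a + q 1 * c b := by
  have hne : a ≠ b := fun h => by rw [h] at hab; lia
  rw [mulVec, dotProduct, Finset.sum_eq_add a b hne]
  · simp only [toeplitzCell, of_apply, ← hab, le_refl, if_true, Nat.sub_self,
      Nat.le_add_right, Nat.add_sub_cancel_left]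
  · rintro b' - ⟨hb'a, hb'b⟩
    rcases lt_or_ge b b' with hgt | hle
    · rw [hc b' hgt, mul_zero]
    · rw [toeplitzCell, of_apply, if_neg, zero_mul]
      rw [Ne, Fin.ext_iff] at hb'a hb'b
      have : (b' : ℕ) ≤ b := hle
      lia
  · exact fun h => absurd (Finset.mem_univ _) h
  · exact fun h => absurd (Finset.mem_univ _) h

theorem toeplitzCell_eigenvector_support (hq : q 1 ≠ 0) {c : Fin m → K} {e : K}
    (h : toeplitzCell m q *ᵥ c = e • c) {a : Fin m} (ha : c a ≠ 0) : (a : ℕ) = 0 := by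
  classical
  obtain ⟨b, hb, hmax⟩ := Finset.exists_max_image (Finset.univ.filter fun b => c b ≠ 0) id
    ⟨a, by simpa using ha⟩
  simp only [Finset.mem_filter, Finset.mem_univ, true_and, id] at hb hmax
  have above_eq_zero (b' : Fin m) (hlt : b < b') : c b' = 0 := by
    by_contra hne
    exact (hmax b' hne).not_gt hlt
  have q_zero_eq : q 0 = e := by
    refine mul_right_cancel₀ hb ?_
    rw [← toeplitzCell_mulVec_top above_eq_zero, h, Pi.smul_apply, smul_eq_mul]
  suffices hb0 : (b : ℕ) = 0 from Nat.eq_zero_of_le_zero (hb0 ▸ hmax a ha)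
  by_contra hb0
  let a' : Fin m := ⟨b - 1, by lia⟩
  have below := toeplitzCell_mulVec_below_top (q := q) (a := a') (Nat.succ_pred hb0) above_eq_zero
  rw [h, Pi.smul_apply, smul_eq_mul, q_zero_eq, left_eq_add] at below
  exact mul_ne_zero hq hb below

theorem vecMul_toeplitzCell (f g : K⟦X⟧) (b : Fin m) :
    ((fun a : Fin m => coeff a f) ᵥ* toeplitzCell m fun i => coeff i g) b = coeff b (f * g) := by
  simp only [vecMul, dotProduct, toeplitzCell, of_apply, mul_ite, mul_zero]
  rw [Fin.sum_univ_eq_sum_range (fun a => if a ≤ (b : ℕ) then coeff a f * coeff (b - a) g else 0),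
    ← Finset.sum_filter, coeff_mul,
    Finset.Nat.sum_antidiagonal_eq_sum_range_succ (fun i l => coeff i f * coeff l g)]
  refine Finset.sum_congr (Finset.ext fun a => ?_) fun _ _ => rfl
  have := b.2
  rw [Finset.mem_filter, Finset.mem_range, Finset.mem_range]
  lia

end Toeplitz

theorem exists_eigenvector_mulVec_eq_zero {K ι : Type*} [Field K] [IsAlgClosed K] [Fintype ι]
    [DecidableEq ι] {J T Y : Matrix ι ι K} (hJY : J * Y = Y * T) (hY : Y.det = 0) :
    ∃ (c : ι → K) (e : K), c ≠ 0 ∧ Y *ᵥ c = 0 ∧ T *ᵥ c = e • c := by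
  obtain ⟨c₀, hc₀, hYc₀⟩ := exists_mulVec_eq_zero_iff.mpr hY
  let kernel := LinearMap.ker Y.mulVecLin
  have invariant : ∀ c ∈ kernel, T.mulVecLin c ∈ kernel := fun c hc => by
    have hc' : Y *ᵥ c = 0 := hc
    change Y *ᵥ (T *ᵥ c) = 0
    rw [mulVec_mulVec, ← hJY, ← mulVec_mulVec, hc', mulVec_zero]
  have : Nontrivial kernel := ⟨⟨⟨c₀, hYc₀⟩, 0, fun h => hc₀ (congrArg Subtype.val h)⟩⟩
  obtain ⟨e, he⟩ := Module.End.exists_eigenvalue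
    (T.mulVecLin.restrict invariant : Module.End K kernel)
  obtain ⟨⟨c, hc⟩, hce, hc0⟩ := he.exists_hasEigenvector
  exact ⟨c, e, fun h => hc0 (Subtype.ext h), hc,
    congrArg Subtype.val (Module.End.mem_eigenspace_iff.mp hce)⟩

variable {s : ℕ} {n : Fin s → ℕ} {r : ℕ} {hn : ∀ j, 1 ≤ n j} {lam : Fin s → ℂ}
  {B : Matrix (BlockIndex n) (BlockIndex n) ℂ} {ν : Fin s → ℂ} {U : Fin s → Fin s → ℂ}

theorem LidskiiBasis.linearIndependent (hL : LidskiiBasis hn lam B ν U) :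
    LinearIndependent ℂ U := by
  classical
  rw [Fintype.linearIndependent_iff]
  intro a ha
  by_contra! hne
  obtain ⟨j₀, hj₀⟩ := hne
  obtain ⟨j, hj, hmin⟩ := Finset.exists_min_image (Finset.univ.filter fun k => a k ≠ 0) n
    ⟨j₀, by simpa using hj₀⟩
  simp only [Finset.mem_filter, Finset.mem_univ, true_and] at hj hmin
  let a' : Fin s → ℂ := fun k => if lam k = lam j ∧ n k = n j then a k else 0
  have restricted_relation (i : Fin s) (hi : lam i = lam j) (hni : n i = n j) :
      ∑ k, a' k * U k i = 0 := by
    have relation := congrFun ha i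
    rw [Finset.sum_apply, Pi.zero_apply] at relation
    refine Eq.trans (Finset.sum_congr rfl fun k _ => ?_) relation
    rw [Pi.smul_apply, smul_eq_mul]
    by_cases hk : a k * U k i = 0
    · simp only [a', ite_mul, zero_mul, hk, ite_self]
    · obtain ⟨hki, hsize⟩ := hL.support k i (right_ne_zero_of_mul hk)
      have hmin' := hmin k (left_ne_zero_of_mul hk)
      simp only [a']
      rw [if_pos ⟨by rw [← hi, hki], by lia⟩]
  have hzero := congrFun (hL.indep j a' (fun k hk => (ite_ne_right_iff.mp hk).1)
    restricted_relation) j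
  rw [Pi.zero_apply] at hzero
  exact hj ((if_pos ⟨rfl, rfl⟩ : a' j = a j).symm.trans hzero)

theorem LidskiiBasis.det_ne_zero (hL : LidskiiBasis hn lam B ν U)
    {J Y : Matrix (BlockIndex n) (BlockIndex n) ℂ} {q : Fin s → ℕ → ℂ} (hq : ∀ j, q j 1 ≠ 0)
    (hJY : J * Y = Y * blockDiagonal' fun j => toeplitzCell (n j) (q j))
    (hU : ∀ i j, Y ⟨i, ⟨0, hn i⟩⟩ ⟨j, ⟨0, hn j⟩⟩ = U j i) : Y.det ≠ 0 := by
  intro hdet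
  obtain ⟨c, e, hc0, hYc, hTc⟩ := exists_eigenvector_mulVec_eq_zero hJY hdet
  have support (j : Fin s) (a : Fin (n j)) (ha : c ⟨j, a⟩ ≠ 0) : a = ⟨0, hn j⟩ := by
    refine Fin.ext (toeplitzCell_eigenvector_support (c := fun b => c ⟨j, b⟩) (e := e) (hq j)
      (funext fun b => ?_) ha)
    rw [← blockDiagonal'_mulVec_apply (fun j => toeplitzCell (n j) (q j)), hTc]
    rfl
  have heads_relation : ∑ k, c ⟨k, ⟨0, hn k⟩⟩ • U k = 0 := funext fun i => by
    have row := congrFun hYc ⟨i, ⟨0, hn i⟩⟩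
    rw [mulVec, dotProduct, Fintype.sum_sigma, Pi.zero_apply] at row
    rw [Finset.sum_apply, Pi.zero_apply, ← row]
    refine Finset.sum_congr rfl fun k _ => ?_
    rw [Finset.sum_eq_single_of_mem (⟨0, hn k⟩ : Fin (n k)) (Finset.mem_univ _), hU,
      Pi.smul_apply, smul_eq_mul, mul_comm]
    intro b _ hb
    by_contra hne
    exact hb (support k b (right_ne_zero_of_mul hne))
  have heads_zero := Fintype.linearIndependent_iff.mp hL.linearIndependent _ heads_relation
  refine hc0 (funext fun ⟨j, a⟩ => ?_)
  by_contra ha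
  rw [support j a ha] at ha
  exact ha (heads_zero j)

theorem coeff_expand_mul_of_lt {m b : ℕ} (hm : m ≠ 0) (hb : b < m) (f g : ℂ⟦X⟧) :
    coeff b (expand m hm f * g) = coeff 0 f * coeff b g := by
  obtain ⟨h, hf, -⟩ := exists_expand_eq_C_add_X_pow_mul hm f
  rw [hf, add_mul, mul_assoc, map_add, coeff_C_mul, coeff_X_pow_mul', if_neg hb.not_ge, add_zero]

theorem constantCoeff_sectorMatrix (v : Fin s → BlockIndex n → ℂ⟦X⟧) (p : BlockIndex n) (j : Fin s)
    (b : Fin (n j)) : constantCoeff (sectorMatrix n v p ⟨j, b⟩) = coeff b (v j p) := by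
  rw [← coeff_zero_eq_constantCoeff_apply, sectorMatrix, sector, coeff_mk, mul_zero, add_zero]

theorem leading_mul_sectorMatrix (hr : 1 ≤ r) (hn : ∀ j, 1 ≤ n j)
    {Ahat : Matrix (BlockIndex n) (BlockIndex n) ℂ⟦X⟧} {κ : Fin s → ℂ}
    {v : Fin s → BlockIndex n → ℂ⟦X⟧} {Q : Fin s → ℂ⟦X⟧}
    (hv : ∀ j p, ∑ q, expand (n j) (Nat.one_le_iff_ne_zero.mp (hn j)) (Ahat p q) * v j q +
        C (κ j) * X ^ (r * n j) * theta (v j p) = Q j * v j p) :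
    Ahat.map constantCoeff * (sectorMatrix n v).map constantCoeff =
      (sectorMatrix n v).map constantCoeff *
        blockDiagonal' fun j => toeplitzCell (n j) fun i => coeff i (Q j) := by
  refine Matrix.ext fun p ⟨j, b⟩ => ?_
  have hb : (b : ℕ) < r * n j := b.2.trans_le (Nat.le_mul_of_pos_left _ hr)
  have coeff_b := congrArg (coeff (b : ℕ)) (hv j p)
  rw [map_add, mul_assoc, coeff_C_mul, coeff_X_pow_mul', if_neg hb.not_ge, mul_zero, add_zero,
    map_sum, mul_comm (Q j)] at coeff_b
  simp only [coeff_expand_mul_of_lt _ b.2] at coeff_b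
  rw [mul_blockDiagonal'_apply, mul_apply]
  simp only [map_apply, constantCoeff_sectorMatrix]
  rw [vecMul_toeplitzCell, ← coeff_b]
  simp only [coeff_zero_eq_constantCoeff_apply]

theorem LidskiiBasis.isNonresonant (hL : LidskiiBasis hn lam B ν U)
    (hres : r = 1 → ∀ j, n j = 1 → ∀ μ ν : ℂ,
      (pseudoCharpoly hn lam B (lam j) 1).IsRoot μ →
      (pseudoCharpoly hn lam B (lam j) 1).IsRoot ν → ∀ k : ℤ, μ - ν = k → k = 0)
    {μ : Fin s → ℂ} (hμ0 : ∀ j, μ j ≠ 0) (hμ : ∀ j, μ j ^ n j = ν j) {t : Fin s → ℕ → ℂ}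
    (hlead : ∀ j, t j (r * n j) = n j * lam j) (hsub : ∀ j, t j (r * n j - 1) = n j * μ j) :
    IsNonresonant r n lam t := by
  have size_ne_zero (j : Fin s) : (n j : ℂ) ≠ 0 :=
    Nat.cast_ne_zero.mpr (Nat.one_le_iff_ne_zero.mp (hn j))
  refine ⟨⟨hlead, fun j _ => ?_⟩, fun i j hlam hsize hN k hk => ?_,
    fun i j hlam hsize _ hpow => ?_⟩
  · rw [hsub]
    exact mul_ne_zero (size_ne_zero j) (hμ0 j)
  · obtain ⟨rfl, hj⟩ := mul_eq_one.mp hN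
    have hi : n i = 1 := hsize.trans hj
    have residue_eq (l : Fin s) (hl : n l = 1) : t l 0 = ν l := by
      have hsub := hsub l
      have hμ := hμ l
      rw [hl, mul_one, Nat.sub_self, Nat.cast_one, one_mul] at hsub
      rw [hl, pow_one] at hμ
      rw [hsub, hμ]
    have isRoot_i := hL.isRoot i
    have isRoot_j := hL.isRoot j
    rw [hlam, hi] at isRoot_i
    rw [hj] at isRoot_j
    rw [residue_eq i hi, residue_eq j hj] at hk
    obtain rfl := hres rfl j hj _ _ isRoot_i isRoot_j k hk
    exact hL.injective i j hlam.symm hsize.symm (sub_eq_zero.mp (hk.trans Int.cast_zero))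
  · have hsub_i := hsub i
    have hμi := hμ i
    rw [hsize] at hsub_i hμi
    rw [hsub_i, hsub j, mul_pow, mul_pow, hμ j, hμi] at hpow
    exact hL.injective i j hlam.symm hsize.symm
      (mul_left_cancel₀ (pow_ne_zero _ (size_ne_zero j)) hpow)

theorem exists_leading_series {A : Matrix (BlockIndex n) (BlockIndex n) FormalSeries}
    {K : ℤ} (hdeg : ∀ k : ℤ, K < k → coeffMatrix A k = 0) :
    ∃ Ahat : Matrix (BlockIndex n) (BlockIndex n) ℂ⟦X⟧,
      (∀ p q, A p q = x ^ K * HahnSeries.ofPowerSeries ℤ ℂ (Ahat p q)) ∧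
      ∀ p q (k : ℕ), coeff k (Ahat p q) = coeffMatrix A (K - k) p q := by
  choose Ahat hA using fun p q => exists_zpow_mul_ofPowerSeries (f := A p q) (K := K)
    fun k hk => congrFun (congrFun (hdeg k hk) p) q
  refine ⟨Ahat, hA, fun p q k => ?_⟩
  rw [coeffMatrix, map_apply, hA, xcoeff_zpow_mul, sub_sub_cancel_left, xcoeff_ofPowerSeries]

theorem exists_nonresonant_gauge (hr : 1 ≤ r)
    {A : Matrix (BlockIndex n) (BlockIndex n) FormalSeries}
    (hdeg : ∀ k : ℤ, (r : ℤ) - 1 < k → coeffMatrix A k = 0)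
    (hlead : coeffMatrix A ((r : ℤ) - 1) = blockDiagonal' fun j => jordanCell (lam j) (n j))
    (hgen : LidskiiGeneric hn lam (coeffMatrix A ((r : ℤ) - 2)))
    (hres : r = 1 → ∀ j, n j = 1 → ∀ μ ν : ℂ,
      (pseudoCharpoly hn lam (coeffMatrix A ((r : ℤ) - 2)) (lam j) 1).IsRoot μ →
      (pseudoCharpoly hn lam (coeffMatrix A ((r : ℤ) - 2)) (lam j) 1).IsRoot ν →
      ∀ k : ℤ, μ - ν = k → k = 0) :
    ∃ Y t, IsNormalizingGauge r n lam A Y t ∧ IsNonresonant r n lam t := by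
  obtain ⟨ν, U, hL⟩ := exists_lidskiiBasis hgen
  choose μ hμ using fun j => IsAlgClosed.exists_pow_nat_eq (ν j) (hn j)
  have hn0 (j : Fin s) : n j ≠ 0 := Nat.one_le_iff_ne_zero.mp (hn j)
  have hμ0 (j : Fin s) : μ j ≠ 0 := fun h =>
    hL.ne_zero hgen j (by rw [← hμ j, h, zero_pow (hn0 j)])
  obtain ⟨Ahat, hA, hcoeff⟩ := exists_leading_series hdeg
  have h0 (p q) : coeff 0 (Ahat p q) =
      blockDiagonal' (fun j => jordanCell (lam j) (n j)) p q := by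
    rw [hcoeff, Nat.cast_zero, sub_zero, hlead]
  have h1 (p q) : coeff 1 (Ahat p q) = coeffMatrix A ((r : ℤ) - 2) p q := by
    rw [hcoeff, Nat.cast_one, sub_sub, one_add_one_eq_two]
  choose v Q hvU hQ0 hQ1 hQN hv using fun j => exists_cell_eigenvector hL hr hres h0 h1 j
    (hμ0 j) (hμ j)
  have det_ne_zero : ((sectorMatrix n v).map constantCoeff).det ≠ 0 := by
    refine hL.det_ne_zero (q := fun j i => coeff i (Q j)) (fun j => by rw [hQ1]; exact hμ0 j)
      (leading_mul_sectorMatrix hr hn hv) fun i j => ?_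
    rw [map_apply, constantCoeff_sectorMatrix, hvU]
  have det_isUnit : IsUnit (sectorMatrix n v).det := by
    rw [isUnit_iff_constantCoeff, RingHom.map_det]
    exact isUnit_iff_ne_zero.mpr det_ne_zero
  have hgauge : IsFormalGauge ((sectorMatrix n v).map (HahnSeries.ofPowerSeries ℤ ℂ)) :=
    isFormalGauge_iff.mpr ⟨_, rfl, det_isUnit⟩
  have leading (j : Fin s) : n j * coeff (r * n j - r * n j) (Q j) = n j * lam j := by
    rw [Nat.sub_self, hQ0]
  refine ⟨_, _, ⟨hgauge, leading, (gauge_eq_iff hgauge.isUnit_det).mpr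
    (sectorMatrix_eqn hn hA hQN hv)⟩, hL.isNonresonant hres hμ0 hμ leading fun j => ?_⟩
  have : r * n j - (r * n j - 1) = 1 := Nat.sub_sub_self (Nat.mul_pos hr (hn j))
  rw [this, hQ1]

end Existence

/-! ### The bare solution of a normal block -/

section BareBlock

open Matrix

theorem hasDerivAt_exp_of_commute {𝕜 𝔸 : Type*} [RCLike 𝕜] [NormedRing 𝔸] [NormedAlgebra 𝕜 𝔸]
    [CompleteSpace 𝔸] {S : 𝕜 → 𝔸} {S' : 𝔸} {w : 𝕜} (hS : HasDerivAt S S' w)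
    (hc : ∀ u, Commute (S u) (S w)) :
    HasDerivAt (fun u => NormedSpace.exp (S u)) (S' * NormedSpace.exp (S w)) w := by
  let _ : NormedAlgebra ℚ 𝔸 := NormedAlgebra.restrictScalars ℚ 𝕜 𝔸
  have exp_eq (u : 𝕜) : NormedSpace.exp (S u) =
      NormedSpace.exp (S u - S w) * NormedSpace.exp (S w) := by
    rw [← NormedSpace.exp_add_of_commute ((hc u).sub_left (Commute.refl _)), sub_add_cancel]
  have exp_deriv : HasFDerivAt (NormedSpace.exp : 𝔸 → 𝔸) (1 : 𝔸 →L[𝕜] 𝔸) (S w - S w) := by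
    rw [sub_self]
    exact hasFDerivAt_exp_zero
  rw [funext exp_eq]
  exact (exp_deriv.comp_hasDerivAt w (hS.sub_const (S w))).mul_const (NormedSpace.exp (S w))

variable {m : ℕ}

/-- The matrix `diag (0, 1, …, m - 1)`. -/
def grading (R : Type*) [Semiring R] (m : ℕ) : Matrix (Fin m) (Fin m) R :=
  diagonal fun a => ((a : ℕ) : R)

/-- The matrix `κ (∑_{J = 0}^N t_J H(y) ^ J - G)`. For suitable `κ` and `y` it is a block of the
normal form, with entries in any of the rings in which the normal form is considered. -/
def connectionBlock {R : Type*} [CommRing R] (N m : ℕ) (κ y : R) (t : ℕ → R) :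
    Matrix (Fin m) (Fin m) R :=
  κ • (∑ J ∈ Finset.range (N + 1), t J • shiftMatrix m y ^ J - grading R m)

/-- The matrix `x ^ (- G / m)`, `G = diag (0, 1, …, m - 1)`, at `w = log x`. -/
def twist (m : ℕ) (w : ℂ) : Matrix (Fin m) (Fin m) ℂ :=
  diagonal fun a => Complex.exp (-((a : ℕ) : ℂ) / m * w)

theorem twist_mul_twist_neg (w : ℂ) : twist m w * twist m (-w) = 1 := by
  rw [twist, twist, diagonal_mul_diagonal, ← diagonal_one]
  congr 1
  funext a
  rw [← Complex.exp_add, mul_neg, add_neg_cancel, Complex.exp_zero]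

theorem isUnit_twist (w : ℂ) : IsUnit (twist m w) :=
  IsUnit.of_mul_eq_one (twist m (-w)) (twist_mul_twist_neg w)

theorem twist_inv (w : ℂ) : (twist m w)⁻¹ = twist m (-w) :=
  inv_eq_right_inv (twist_mul_twist_neg w)

theorem twist_inv_mul_cancel (w : ℂ) : (twist m w)⁻¹ * twist m w = 1 :=
  nonsing_inv_mul _ ((isUnit_iff_isUnit_det _).mp (isUnit_twist w))

theorem shiftMatrix_exp (hm : m ≠ 0) (w : ℂ) : shiftMatrix m (Complex.exp w) =
    Complex.exp (w / m) • (twist m w * shiftMatrix m 1 * (twist m w)⁻¹) := by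
  have hm' : (m : ℂ) ≠ 0 := Nat.cast_ne_zero.mpr hm
  refine Matrix.ext fun a b => ?_
  rw [twist_inv, Matrix.smul_apply, twist, twist, mul_diagonal, diagonal_mul, smul_eq_mul]
  simp only [shiftMatrix, of_apply]
  split_ifs with below corner
  · rw [mul_one, ← Complex.exp_add, ← Complex.exp_add, ← Complex.exp_zero, below]
    congr 1
    push_cast
    ring
  · have last : ((b : ℕ) : ℂ) + 1 = m := mod_cast corner.2
    rw [mul_one, ← Complex.exp_add, ← Complex.exp_add, corner.1]
    congr 1
    field_simp
    linear_combination -w * last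
  · rw [mul_zero, zero_mul, mul_zero]

theorem shiftMatrix_exp_pow (hm : m ≠ 0) (w : ℂ) (J : ℕ) :
    shiftMatrix m (Complex.exp w) ^ J =
      Complex.exp (J * w / m) • (twist m w * shiftMatrix m 1 ^ J * (twist m w)⁻¹) := by
  obtain ⟨u, hu⟩ := isUnit_twist (m := m) w
  rw [shiftMatrix_exp hm, smul_pow, ← Complex.exp_nat_mul, mul_div_assoc, ← hu, ← coe_units_inv,
    Units.conj_pow]

/-- The exponent of the bare solution in the frame in which it has constant directions: its
conjugate by `twist m w`. -/
def untwistedExponent (r m : ℕ) (t : ℕ → ℂ) (w : ℂ) : Matrix (Fin m) (Fin m) ℂ :=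
  ∑ J ∈ Finset.Icc 1 (r * m), (t J / J * Complex.exp (J * w / m)) • shiftMatrix m (1 : ℂ) ^ J

theorem commute_untwistedExponent (r m : ℕ) (t : ℕ → ℂ) (u w : ℂ) :
    Commute (untwistedExponent r m t u) (untwistedExponent r m t w) :=
  Commute.sum_left _ _ _ fun J _ => Commute.sum_right _ _ _ fun J' _ =>
    (((Commute.refl _).pow_pow J J').smul_left _).smul_right _

theorem bareBlock_eq (hm : m ≠ 0) (r : ℕ) (t : ℕ → ℂ) (w : ℂ) :
    bareBlock r m t w = Complex.exp (t 0 / m * w) •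
      (twist m w * NormedSpace.exp (untwistedExponent r m t w)) := by
  have exponent_eq : ∑ J ∈ Finset.Icc 1 (r * m), (t J / J) • shiftMatrix m (Complex.exp w) ^ J =
      twist m w * untwistedExponent r m t w * (twist m w)⁻¹ := by
    rw [untwistedExponent, Finset.mul_sum, Finset.sum_mul]
    refine Finset.sum_congr rfl fun J _ => ?_
    rw [shiftMatrix_exp_pow hm, smul_smul, Matrix.mul_smul, Matrix.smul_mul]
  have power_eq : (diagonal fun a : Fin m => Complex.exp ((t 0 - (a : ℕ)) / m * w)) =
      Complex.exp (t 0 / m * w) • twist m w := by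
    rw [twist, ← diagonal_smul]
    congr 1
    funext a
    rw [Pi.smul_apply, smul_eq_mul, ← Complex.exp_add]
    congr 1
    ring
  rw [bareBlock, exponent_eq, power_eq, exp_conj _ _ (isUnit_twist w), Matrix.mul_smul,
    Matrix.mul_assoc, twist_inv_mul_cancel, Matrix.mul_one]

theorem sum_shiftMatrix_exp_mul_twist (hm : m ≠ 0) (N : ℕ) (t : ℕ → ℂ) (w : ℂ) :
    (∑ J ∈ Finset.range (N + 1), t J • shiftMatrix m (Complex.exp w) ^ J) * twist m w =
      t 0 • twist m w + twist m w * ∑ J ∈ Finset.Icc 1 N,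
        (t J * Complex.exp (J * w / m)) • shiftMatrix m (1 : ℂ) ^ J := by
  rw [Finset.range_eq_Ico, Finset.sum_eq_sum_Ico_succ_bot (Nat.succ_pos _), pow_zero, add_mul,
    Matrix.smul_mul, Matrix.one_mul, zero_add, Finset.sum_mul, Finset.mul_sum]
  congr 1
  refine Finset.sum_congr rfl fun J _ => ?_
  rw [shiftMatrix_exp_pow hm, Matrix.smul_mul, Matrix.smul_mul, Matrix.mul_assoc _ _ (twist m w),
    twist_inv_mul_cancel, Matrix.mul_one, smul_smul, Matrix.mul_smul]

theorem connectionBlock_mul_smul_twist_mul (hm : m ≠ 0) (N : ℕ) (t : ℕ → ℂ) (w c : ℂ)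
    (M : Matrix (Fin m) (Fin m) ℂ) :
    connectionBlock N m (m : ℂ)⁻¹ (Complex.exp w) t * c • (twist m w * M) =
      c • (-((m : ℂ)⁻¹ • grading ℂ m) * twist m w * M + twist m w * ((m : ℂ)⁻¹ •
        (∑ J ∈ Finset.Icc 1 N, (t J * Complex.exp (J * w / m)) • shiftMatrix m (1 : ℂ) ^ J) *
          M)) + (c * (t 0 / m)) • (twist m w * M) := by
  rw [connectionBlock, smul_mul_smul_comm, sub_mul, ← mul_assoc (∑ J ∈ _, _) (twist m w),
    sum_shiftMatrix_exp_mul_twist hm]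
  simp only [add_mul, neg_mul, smul_mul_assoc, mul_smul_comm, mul_assoc]
  module

attribute [local instance] Matrix.linftyOpNormedRing Matrix.linftyOpNormedAlgebra

theorem hasDerivAt_twist (w : ℂ) :
    HasDerivAt (twist m) (-((m : ℂ)⁻¹ • grading ℂ m) * twist m w) w := by
  have twist_eq (u : ℂ) : twist m u = NormedSpace.exp (u • -((m : ℂ)⁻¹ • grading ℂ m)) := by
    rw [grading, ← diagonal_smul, diagonal_neg, ← diagonal_smul, exp_diagonal, twist]
    congr 1
    funext a
    rw [Pi.coe_exp, Complex.exp_eq_exp_ℂ]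
    congr 1
    simp only [Pi.smul_apply, smul_eq_mul]
    ring
  rw [funext twist_eq]
  exact hasDerivAt_exp_smul_const' (𝕂 := ℂ) _ w

theorem hasDerivAt_untwistedExponent (r : ℕ) (t : ℕ → ℂ) (w : ℂ) :
    HasDerivAt (untwistedExponent r m t) ((m : ℂ)⁻¹ • ∑ J ∈ Finset.Icc 1 (r * m),
      (t J * Complex.exp (J * w / m)) • shiftMatrix m (1 : ℂ) ^ J) w := by
  rw [Finset.smul_sum]
  refine HasDerivAt.fun_sum fun J hJ => ?_
  have hJ0 : (J : ℂ) ≠ 0 :=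
    Nat.cast_ne_zero.mpr (Nat.one_le_iff_ne_zero.mp (Finset.mem_Icc.mp hJ).1)
  have inner_deriv : HasDerivAt (fun u : ℂ => (J : ℂ) * u / m) ((J : ℂ) / m) w := by
    simpa using ((hasDerivAt_id w).const_mul (J : ℂ)).div_const (m : ℂ)
  refine ((inner_deriv.cexp.const_mul (t J / J)).smul_const
    (shiftMatrix m (1 : ℂ) ^ J)).congr_deriv ?_
  rw [smul_smul]
  congr 1
  field_simp

theorem hasDerivAt_bareBlock (hm : m ≠ 0) (r : ℕ) (t : ℕ → ℂ) (w : ℂ) :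
    HasDerivAt (bareBlock r m t)
      (connectionBlock (r * m) m (m : ℂ)⁻¹ (Complex.exp w) t * bareBlock r m t w) w := by
  have scalar_deriv : HasDerivAt (fun u : ℂ => Complex.exp (t 0 / m * u))
      (Complex.exp (t 0 / m * w) * (t 0 / m)) w := by
    simpa using ((hasDerivAt_id w).const_mul (t 0 / m)).cexp
  have exp_deriv := hasDerivAt_exp_of_commute (hasDerivAt_untwistedExponent (m := m) r t w)
    fun u => commute_untwistedExponent r m t u w
  rw [funext (bareBlock_eq hm r t)]
  refine (scalar_deriv.smul ((hasDerivAt_twist w).mul exp_deriv)).congr_deriv ?_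
  exact (connectionBlock_mul_smul_twist_mul hm (r * m) t w _ _).symm

end BareBlock

/-! ### Fundamental solutions -/

section FundamentalSolutions

open Matrix

theorem HolFun.isUnit_of_forall_ne_zero {f : HolFun} (h : ∀ w, f.1 w ≠ 0) : IsUnit f := by
  have differentiable_inv : Differentiable ℂ fun w => (f.1 w)⁻¹ := fun w => (f.2 w).inv (h w)
  exact IsUnit.of_mul_eq_one (⟨_, differentiable_inv⟩ : HolFun)
    (Subtype.ext (funext fun w => mul_inv_cancel₀ (h w)))

/-- Evaluation at `w = log x`. -/
def HolFun.eval (w : ℂ) : HolFun →+* ℂ :=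
  (Pi.evalRingHom (fun _ : ℂ => ℂ) w).comp entireFunctions.val.toRingHom

theorem HolFun.eval_apply (w : ℂ) (f : HolFun) : HolFun.eval w f = f.1 w := rfl

theorem HolFun.ext_eval {f g : HolFun} (h : ∀ w, HolFun.eval w f = HolFun.eval w g) : f = g :=
  Subtype.ext (funext h)

theorem HolFun.eval_ddx (w : ℂ) (f : HolFun) :
    HolFun.eval w (HolFun.ddx f) = Complex.exp (-w) * deriv f.1 w := rfl

theorem HolFun.ddx_zero : HolFun.ddx 0 = 0 := by
  rw [← map_zero (algebraMap ℂ HolFun), HolFun.ddx_algebraMap, map_zero]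

theorem HolFun.ddx_one : HolFun.ddx 1 = 0 := by
  rw [← map_one (algebraMap ℂ HolFun), HolFun.ddx_algebraMap]

namespace FormalSolutionRing

/-- `ofSeries` as a ring homomorphism. -/
def ofSeriesHom : FormalSeries →+* FormalSolutionRing :=
  Algebra.TensorProduct.includeLeftRingHom

/-- `ofHol` as a ring homomorphism. -/
def ofHolHom : HolFun →+* FormalSolutionRing :=
  (Algebra.TensorProduct.includeRight (R := LaurentPolynomial ℂ) (A := FormalSeries)
    (B := HolFun)).toRingHom

theorem ofSeriesHom_apply (f : FormalSeries) : ofSeriesHom f = ofSeries f := rfl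

theorem ofHolHom_apply (f : HolFun) : ofHolHom f = ofHol f := rfl

theorem ofSeries_algebraMap (p : LaurentPolynomial ℂ) :
    ofSeries (algebraMap _ FormalSeries p) = ofHol (algebraMap _ HolFun p) := by
  rw [ofSeries, ofHol, Algebra.algebraMap_eq_smul_one, Algebra.algebraMap_eq_smul_one,
    TensorProduct.smul_tmul]

theorem ddx_ofSeries (f : FormalSeries) : ddx (ofSeries f) = ofSeries (FormalSeries.ddx f) := by
  rw [ofSeries, ddx_tmul, HolFun.ddx_one, TensorProduct.tmul_zero, add_zero, ofSeries]

theorem ddx_ofHol (φ : HolFun) : ddx (ofHol φ) = ofHol (HolFun.ddx φ) := by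
  have ddx_one : FormalSeries.ddx 1 = 0 := FormalSeries.ddx_C 1
  rw [ofHol, ddx_tmul, ddx_one, TensorProduct.zero_tmul, zero_add, ofHol]

end FormalSolutionRing

open FormalSolutionRing

theorem shiftMatrix_map {R S : Type*} [CommRing R] [CommRing S] (φ : R →+* S) (m : ℕ) (y : R) :
    (shiftMatrix m y).map φ = shiftMatrix m (φ y) := by
  refine Matrix.ext fun a b => ?_
  simp only [shiftMatrix, map_apply, of_apply, apply_ite φ, map_one, map_zero]

theorem connectionBlock_map {R S : Type*} [CommRing R] [CommRing S] (φ : R →+* S) (N m : ℕ)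
    (κ y : R) (t : ℕ → R) :
    (connectionBlock N m κ y t).map φ = connectionBlock N m (φ κ) (φ y) fun J => φ (t J) := by
  have grading_map : (grading R m).map φ = grading S m := by
    simp only [grading, diagonal_map (map_zero φ), map_natCast]
  have smul_map (c : R) (M : Matrix (Fin m) (Fin m) R) : (c • M).map φ = φ c • M.map φ :=
    map_smul' φ c M (map_mul φ)
  rw [connectionBlock, smul_map, ← RingHom.mapMatrix_apply φ (_ - _), map_sub, map_sum]
  simp only [RingHom.mapMatrix_apply, smul_map, grading_map]
  simp only [← RingHom.mapMatrix_apply, map_pow]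
  simp only [RingHom.mapMatrix_apply, shiftMatrix_map]
  rfl

section LaurentForm

open LaurentPolynomial

/-- The blocks of the normal form, as matrices of Laurent polynomials. -/
def laurentBlock (r m : ℕ) (t : ℕ → ℂ) : Matrix (Fin m) (Fin m) (LaurentPolynomial ℂ) :=
  connectionBlock (r * m) m (C (m : ℂ)⁻¹ * T (-1)) (T 1) fun J => C (t J)

theorem laurentBlock_map_algebraMap (r m : ℕ) (t : ℕ → ℂ) :
    (laurentBlock r m t).map (algebraMap _ FormalSeries) = normalBlock r m t := by
  have algebraMap_eq (p : LaurentPolynomial ℂ) : algebraMap _ FormalSeries p =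
    eval₂ HahnSeries.C FormalSeries.xUnit p := rfl
  have xUnit_inv : ((FormalSeries.xUnit⁻¹ : FormalSeriesˣ) : FormalSeries) = FormalSeries.x⁻¹ := by
    rw [Units.val_inv_eq_inv_val]
    rfl
  rw [laurentBlock, connectionBlock_map, normalBlock, mul_inv, FormalSeries.natCast_eq_C,
    ← map_inv₀, ← xUnit_inv]
  simp only [algebraMap_eq, map_mul, eval₂_C, eval₂_T, zpow_one, _root_.zpow_neg_one]
  rfl

theorem laurentBlock_map_eval (r m : ℕ) (t : ℕ → ℂ) (w : ℂ) :
    (laurentBlock r m t).map ((HolFun.eval w).comp (algebraMap _ HolFun)) =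
      Complex.exp (-w) • connectionBlock (r * m) m (m : ℂ)⁻¹ (Complex.exp w) t := by
  have algebraMap_eq (p : LaurentPolynomial ℂ) : algebraMap _ HolFun p =
    eval₂ (algebraMap ℂ HolFun) HolFun.xUnit p := rfl
  have eval_algebraMap (c : ℂ) : HolFun.eval w (algebraMap ℂ HolFun c) = c := rfl
  have eval_xUnit : HolFun.eval w HolFun.xUnit = Complex.exp w := rfl
  have eval_xUnit_inv : HolFun.eval w (HolFun.xUnit⁻¹ : HolFunˣ) = Complex.exp (-w) := rfl
  rw [laurentBlock, connectionBlock_map]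
  simp only [RingHom.comp_apply, algebraMap_eq, map_mul, eval₂_C, eval₂_T, zpow_one,
    _root_.zpow_neg_one, eval_algebraMap, eval_xUnit, eval_xUnit_inv, connectionBlock, smul_smul,
    mul_comm (m : ℂ)⁻¹]

variable {s : ℕ} {n : Fin s → ℕ} {r : ℕ}

/-- The normal form, as a matrix of Laurent polynomials. -/
def laurentForm (r : ℕ) (n : Fin s → ℕ) (t : Fin s → ℕ → ℂ) :
    Matrix (BlockIndex n) (BlockIndex n) (LaurentPolynomial ℂ) :=
  blockDiagonal' fun j => laurentBlock r (n j) (t j)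

theorem laurentForm_map_algebraMap (t : Fin s → ℕ → ℂ) :
    (laurentForm r n t).map (algebraMap _ FormalSeries) = normalForm r n t := by
  simp only [laurentForm, normalForm, blockDiagonal'_map _ _ (map_zero _),
    laurentBlock_map_algebraMap]

theorem laurentForm_map_ofHolHom (t : Fin s → ℕ → ℂ) :
    ((laurentForm r n t).map (algebraMap _ HolFun)).map ofHolHom =
      (normalForm r n t).map ofSeriesHom := by
  rw [← laurentForm_map_algebraMap]
  exact Matrix.ext fun p q => (ofSeries_algebraMap _).symm

end LaurentForm

theorem isUnit_bareBlock (r m : ℕ) (t : ℕ → ℂ) (w : ℂ) : IsUnit (bareBlock r m t w) :=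
  (isUnit_exp _).mul (isUnit_diagonal.mpr (Pi.isUnit_iff.mpr fun _ =>
    isUnit_iff_ne_zero.mpr (Complex.exp_ne_zero _)))

section

attribute [local instance] Matrix.linftyOpNormedRing Matrix.linftyOpNormedAlgebra

theorem deriv_bareBlock_apply {m : ℕ} (hm : m ≠ 0) (r : ℕ) (t : ℕ → ℂ) (w : ℂ) (a b : Fin m) :
    deriv (fun u => bareBlock r m t u a b) w =
      (connectionBlock (r * m) m (m : ℂ)⁻¹ (Complex.exp w) t * bareBlock r m t w) a b :=
  ((LinearMap.toContinuousLinearMap (entryLinearMap ℂ ℂ a b)).hasFDerivAt.comp_hasDerivAt w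
    (hasDerivAt_bareBlock hm r t w)).deriv

end

variable {s : ℕ} {n : Fin s → ℕ} {r : ℕ}

theorem bareSolution_map_eval (t : Fin s → ℕ → ℂ) (w : ℂ) :
    (bareSolution r n t).map (HolFun.eval w) =
      blockDiagonal' fun j => bareBlock r (n j) (t j) w := by
  rw [bareSolution, blockDiagonal'_map _ _ (map_zero _)]
  rfl

theorem isUnit_det_bareSolution (t : Fin s → ℕ → ℂ) : IsUnit (bareSolution r n t).det := by
  refine HolFun.isUnit_of_forall_ne_zero fun w => ?_
  rw [← HolFun.eval_apply, RingHom.map_det, RingHom.mapMatrix_apply, bareSolution_map_eval]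
  exact ((isUnit_iff_isUnit_det _).mp ((Pi.isUnit_iff.mpr fun j =>
    isUnit_bareBlock r (n j) (t j) w).map (blockDiagonal'RingHom (fun j => Fin (n j)) ℂ))).ne_zero

theorem ddx_bareSolution (hn : ∀ j, n j ≠ 0) (t : Fin s → ℕ → ℂ) :
    (bareSolution r n t).map HolFun.ddx =
      (laurentForm r n t).map (algebraMap _ HolFun) * bareSolution r n t := by
  rw [bareSolution, laurentForm, blockDiagonal'_map _ _ (map_zero _),
    blockDiagonal'_map _ _ HolFun.ddx_zero, ← blockDiagonal'_mul]
  congr 1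
  funext j
  refine Matrix.ext fun a b => HolFun.ext_eval fun w => ?_
  have eval_block (c : Fin (n j)) : HolFun.eval w (algebraMap _ HolFun
      (laurentBlock r (n j) (t j) a c)) = Complex.exp (-w) *
        connectionBlock (r * n j) (n j) (n j : ℂ)⁻¹ (Complex.exp w) (t j) a c :=
    congrFun (congrFun (laurentBlock_map_eval r (n j) (t j) w) a) c
  rw [map_apply, HolFun.eval_ddx, mul_apply, map_sum]
  refine (congrArg _ (deriv_bareBlock_apply (hn j) r (t j) w a b)).trans ?_
  simp only [mul_apply, Finset.mul_sum, map_mul, map_apply, eval_block, mul_assoc]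
  rfl

section

variable {Y : Matrix (BlockIndex n) (BlockIndex n) FormalSeries} {t : Fin s → ℕ → ℂ}

theorem formalSolution_eq : formalSolution r n Y t =
    Y.map ofSeriesHom * (bareSolution r n t).map ofHolHom := rfl

theorem ddx_formalSolution : (formalSolution r n Y t).map ddx =
    (Y.map FormalSeries.ddx).map ofSeriesHom * (bareSolution r n t).map ofHolHom +
      Y.map ofSeriesHom * ((bareSolution r n t).map HolFun.ddx).map ofHolHom := by
  refine Matrix.ext fun p q => ?_
  simp only [formalSolution, map_apply, mul_apply, Matrix.add_apply, map_sum, ddx_mul,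
    ddx_ofSeries, ddx_ofHol, Finset.sum_add_distrib, ofSeriesHom_apply, ofHolHom_apply]

theorem isUnit_det_formalSolution (hY : IsUnit Y.det) : IsUnit (formalSolution r n Y t).det := by
  rw [formalSolution_eq, det_mul, ← RingHom.mapMatrix_apply, ← RingHom.map_det,
    ← RingHom.mapMatrix_apply, ← RingHom.map_det]
  exact (hY.map _).mul ((isUnit_det_bareSolution t).map _)

theorem IsNormalizingGauge.isFundamentalSolution {lam : Fin s → ℂ} (hn : ∀ j, n j ≠ 0)
    {A : Matrix (BlockIndex n) (BlockIndex n) FormalSeries}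
    (h : IsNormalizingGauge r n lam A Y t) :
    IsFundamentalSolution A (formalSolution r n Y t) := by
  refine ⟨?_, isUnit_det_formalSolution h.1.isUnit_det⟩
  have gauge_eq : Y.map FormalSeries.ddx + Y * normalForm r n t = A * Y := by
    rw [← h.eqn, add_sub_cancel]
  calc (formalSolution r n Y t).map ddx
      = (Y.map FormalSeries.ddx + Y * normalForm r n t).map ofSeriesHom *
          (bareSolution r n t).map ofHolHom := by
        rw [ddx_formalSolution, ddx_bareSolution hn, Matrix.map_mul, laurentForm_map_ofHolHom,
          ← Matrix.mul_assoc, ← Matrix.map_mul, ← Matrix.add_mul,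
          Matrix.map_add ofSeriesHom (map_add ofSeriesHom)]
    _ = A.map ofSeries * formalSolution r n Y t := by
        rw [gauge_eq, Matrix.map_mul, Matrix.mul_assoc]
        rfl

end

end FundamentalSolutions

end ResonantConnection

end

open ResonantConnection in
theorem theorem3p1 (r : ℕ) (hr : 1 ≤ r) (s : ℕ) (n : Fin s → ℕ) (hn : ∀ j, 1 ≤ n j)
    (lam : Fin s → ℂ) (A : Matrix (BlockIndex n) (BlockIndex n) FormalSeries)
    (hdeg : ∀ k : ℤ, (r : ℤ) - 1 < k → coeffMatrix A k = 0)
    (hlead : coeffMatrix A ((r : ℤ) - 1)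
      = Matrix.blockDiagonal' fun j => jordanCell (lam j) (n j))
    (hgen : LidskiiGeneric hn lam (coeffMatrix A ((r : ℤ) - 2)))
    (hres : r = 1 → ∀ j, n j = 1 → ∀ μ ν : ℂ,
      (pseudoCharpoly hn lam (coeffMatrix A ((r : ℤ) - 2)) (lam j) 1).IsRoot μ →
      (pseudoCharpoly hn lam (coeffMatrix A ((r : ℤ) - 2)) (lam j) 1).IsRoot ν →
      ∀ k : ℤ, μ - ν = k → k = 0) :
    (∃ Y t, IsNormalizingGauge r n lam A Y t) ∧
    (∀ Y t, IsNormalizingGauge r n lam A Y t →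
      IsFundamentalSolution A (formalSolution r n Y t)) ∧
    (∀ Y Y' t, IsNormalizingGauge r n lam A Y t → IsNormalizingGauge r n lam A Y' t →
      ∃ c : Fin s → ℂ, (∀ j, c j ≠ 0) ∧
        Y' = Y * Matrix.diagonal fun p => HahnSeries.C (c p.1)) ∧
    (∀ Y t Y' t', IsNormalizingGauge r n lam A Y t → IsNormalizingGauge r n lam A Y' t' →
      ∃ (σ : Equiv.Perm (Fin s)) (ζ c : Fin s → ℂ),
        (∀ j, n (σ j) = n j ∧ lam (σ j) = lam j ∧ ζ j ^ n j = 1 ∧ c j ≠ 0) ∧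
        (∀ j, ∀ J ≤ r * n j, t (σ j) J = ζ j ^ J * t' j J) ∧
        Y' = Y * monomialMatrix n σ ζ c) := by
  obtain ⟨Y₀, t₀, h₀, hres₀⟩ := exists_nonresonant_gauge hr hdeg hlead hgen hres
  have nonresonant (Y t) (h : IsNormalizingGauge r n lam A Y t) : IsNonresonant r n lam t :=
    h₀.isNonresonant hr hn hdeg hlead hres₀ h
  exact ⟨⟨Y₀, t₀, h₀⟩,
    fun Y t h => h.isFundamentalSolution fun j => Nat.one_le_iff_ne_zero.mp (hn j),
    fun Y Y' t h h' => h.exists_diagonal hr hn hdeg hlead (nonresonant Y t h) h',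
    fun Y t Y' t' h h' => h.exists_monomialMatrix hr hn hdeg hlead (nonresonant Y t h) h'⟩
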